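/- **Setting.** A configuration of $k$ unit-square robots is a tuple $P=(p_1,\dots,p_k)$ of points of $\mathbb R^2$ with $\|p_i-p_j\|_\infty\ge 1$ for $i\ne j$. A feasible schedule from a configuration $A$ to a configuration $B$ over $[t_0,t_1]$ is a tuple $M=(m_1,\dots,m_k)$ of maps $m_i:[t_0,t_1]\to\mathbb R^2$ with $m_i(t_0)=a_i$, $m_i(t_1)=b_i$, that are $1$-Lipschitz for the $L_1$-norm, have polygonal chains as images, and are such that $M(t)$ is a configuration for all $t\in[t_0,t_1]$; its makespan is $t_1-t_0$. Min-Makespan CMP: given $k$ and two configurations $A,B$ of $k$ robots with rational coordinates (numerators and denominators in binary), compute the smallest makespan $L$ of a feasible schedule from $A$ to $B$, together with a schedule over $[0,L]$ that attains it, given by the breakpoints of its piecewise linear trajectories. An ordering assigns to each pair $i<j$ one of the four relations "right of" ($x(p_i)\ge x(p_j)+1$), "left of" ($x(p_j)\ge x(p_i)+1$), "above" ($y(p_i)\ge y(p_j)+1$), "below" ($y(p_j)\ge y(p_i)+1$); a configuration belongs to the ordering if all its relations hold. In the transition graph, two different orderings are adjacent if they do not assign opposite relations to any pair. A schedule over $[t_0,t_1]$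 obeys a sequence $O_1,\dots,O_\ell$ of orderings ($\ell\ge1$) if there are $t_0=\tau_0\le\tau_1\le\dots\le\tau_\ell=t_1$ such that $M(t)$ belongs to $O_u$ for all $t\in[\tau_{u-1},\tau_u]$, $1\le u\le \ell$. **Theorem.** 1. Min-Makespan CMP is fixed-parameter tractable in the number $k$ of robots: there are an algorithm (for a random access machine with logarithmic cost), a computable function $f:\mathbb N\to\mathbb N$ and a constant $c$ such that the algorithm solves every instance with $k$ robots and $n$ input bits in time at most $f(k)\cdot n^{c}$. 2. For all configurations $A,B$ of $k$ robots (with real coordinates) there is a feasible schedule from $A$ to $B$ that has minimum makespan among all feasible schedules from $A$ to $B$ and obeys a sequence of orderings that is a simple path of the transition graph. 3. Let $k\ge1$, let $O_1,\dots,O_\ell$ be any sequence of orderings of $k$ robots, and let $A,B$ be configurations. Consider the linear program with variables $I^u=(i^u_1,\dots,i^u_k)\in(\mathbb R^2)^k$ for $0\le u\le\ell$ and $\varphi^1,\dots,\varphi^{\ell}\in\mathbb R$: minimize $\varphi^1+\dots+\varphi^\ell$ subject to $I^0=A$, $I^\ell=B$, $\varphi^u\ge\|i^{u}_j-i^{u-1}_j\|_1$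 for $1\le j\le k$, and the relations of $O_u$ for both $I^{u-1}$ and $I^u$, for $1\le u\le \ell$. Writing each $L_1$-constraint as four linear inequalities and each equation as two, it has $2k(\ell+1)+\ell$ variables and $4k\ell+2\binom k2\ell+8k$ inequalities. It is feasible if and only if some feasible schedule from $A$ to $B$ obeys $O_1,\dots,O_\ell$; if it is feasible, it has an optimal solution, and its optimal value is the minimum makespan of the feasible schedules from $A$ to $B$ that obey $O_1,\dots,O_\ell$. -/

import Mathlib

open scoped Matrix

noncomputable section

namespace CMP

/-! ### Configurations, trajectories, schedules -/

/-- Points of the plane. -/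
abbrev Pt := ℝ × ℝ

/-- The `L₁`-norm. -/
def l1 (p : Pt) : ℝ := |p.1| + |p.2|

/-- The `L∞`-norm. -/
def linf (p : Pt) : ℝ := max |p.1| |p.2|

/-- Positions of `k` unit-square robots (centres of the squares). -/
abbrev Pos (k : ℕ) := Fin k → Pt

/-- The configuration space: the squares are pairwise interior disjoint. -/
def confSpace (k : ℕ) : Set (Pos k) :=
  {P | ∀ i j, i ≠ j → 1 ≤ linf (P i - P j)}

/-- A set that is (the point set of) a polygonal chain `v 0, v 1, …, v (n+1)`. -/
def IsPolygonalChain (S : Set Pt) : Prop :=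
  ∃ (n : ℕ) (v : ℕ → Pt), S = ⋃ i ∈ Finset.range (n + 1), segment ℝ (v i) (v (i + 1))

/-- `m` is a trajectory from `a` to `b` over `[t₀, t₁]`: a metric map for the `L₁`-distance whose
image is a polygonal chain. Only the values of `m` on `[t₀, t₁]` matter. -/
structure IsTrajectory (a b : Pt) (t₀ t₁ : ℝ) (m : ℝ → Pt) : Prop where
  le : t₀ ≤ t₁
  start : m t₀ = a
  target : m t₁ = b
  metric : ∀ s ∈ Set.Icc t₀ t₁, ∀ t ∈ Set.Icc t₀ t₁, l1 (m s - m t) ≤ |s - t|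
  chain : IsPolygonalChain (m '' Set.Icc t₀ t₁)

/-- `M` is a feasible schedule from `A` to `B` over `[t₀, t₁]`; its makespan is `t₁ - t₀`. -/
structure IsSchedule {k : ℕ} (A B : Pos k) (t₀ t₁ : ℝ) (M : Fin k → ℝ → Pt) : Prop where
  le : t₀ ≤ t₁
  traj : ∀ i, IsTrajectory (A i) (B i) t₀ t₁ (M i)
  feasible : ∀ t ∈ Set.Icc t₀ t₁, (fun i => M i t) ∈ confSpace k

/-- `L` is the smallest number such that some feasible schedule from `A` to `B` has makespan at
most `L`. -/
def IsMinMakespan {k : ℕ} (A B : Pos k) (L : ℝ) : Prop :=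
  IsLeast {L : ℝ | ∃ t₀ t₁ M, IsSchedule A B t₀ t₁ M ∧ t₁ - t₀ ≤ L} L

/-! ### Orderings and the transition graph -/

/-- Relative position of one robot with respect to another one. -/
inductive Dir
  | right | left | up | down
  deriving DecidableEq

/-- The opposite relative position. -/
def Dir.opp : Dir → Dir
  | .right => .left
  | .left => .right
  | .up => .down
  | .down => .up

/-- The robot at `p` is to the right of / left of / above / below the robot at `q`. -/
def Dir.Holds (d : Dir) (p q : Pt) : Prop :=
  match d with
  | .right => q.1 + 1 ≤ p.1
  | .left => p.1 + 1 ≤ q.1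
  | .up => q.2 + 1 ≤ p.2
  | .down => p.2 + 1 ≤ q.2

/-- Unordered pairs of distinct robots. -/
abbrev RobotPair (k : ℕ) := {p : Fin k × Fin k // p.1 < p.2}

/-- An ordering: one relative position for every pair of robots. -/
abbrev Ordering (k : ℕ) := RobotPair k → Dir

/-- The feasible configurations that belong to an ordering. -/
def Ordering.confs {k : ℕ} (O : Ordering k) : Set (Pos k) :=
  {P | P ∈ confSpace k ∧ ∀ e : RobotPair k, (O e).Holds (P e.1.1) (P e.1.2)}

/-- The transition graph: two different orderings are adjacent if no pair of robots has opposite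
relative positions in them. -/
def transitionGraph (k : ℕ) : SimpleGraph (Ordering k) where
  Adj O₁ O₂ := O₁ ≠ O₂ ∧ ∀ e, O₂ e ≠ (O₁ e).opp
  symm := ⟨by
    rintro O₁ O₂ ⟨h, h'⟩
    refine ⟨h.symm, fun e he => h' e ?_⟩
    rw [he]
    cases O₂ e <;> rfl⟩
  loopless := ⟨fun _ h => h.1 rfl⟩

/-- The sequence `O 0, …, O n` of `n + 1` orderings is a simple path of the transition graph. -/
def IsSimplePath {k n : ℕ} (O : Fin (n + 1) → Ordering k) : Prop :=
  Function.Injective O ∧ ∀ u : Fin n, (transitionGraph k).Adj (O u.castSucc) (O u.succ)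

/-- Over `[t₀, t₁]`, the schedule `M` obeys the sequence `O 0, …, O n` of orderings: the interval
can be cut into `n + 1` consecutive intervals so that `M` stays in `O u` during the `u`-th one. -/
def Obeys {k n : ℕ} (O : Fin (n + 1) → Ordering k) (t₀ t₁ : ℝ) (M : Fin k → ℝ → Pt) : Prop :=
  ∃ τ : Fin (n + 2) → ℝ, Monotone τ ∧ τ 0 = t₀ ∧ τ (Fin.last (n + 1)) = t₁ ∧
    ∀ u : Fin (n + 1), ∀ t ∈ Set.Icc (τ u.castSucc) (τ u.succ), (fun i => M i t) ∈ (O u).confs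

/-! ### The linear program of a sequence of orderings -/

/-- A linear program: minimize `obj ⬝ᵥ x` subject to `rhs ≤ lhs *ᵥ x`. -/
structure LinearProgram (V C : Type) where
  lhs : Matrix C V ℝ
  rhs : C → ℝ
  obj : V → ℝ

/-- Feasible points of a linear program. -/
def LinearProgram.Feasible {V C : Type} [Fintype V] (P : LinearProgram V C) (x : V → ℝ) : Prop :=
  P.rhs ≤ P.lhs *ᵥ x

/-- Optimal points of a linear program. -/
def LinearProgram.Optimal {V C : Type} [Fintype V] (P : LinearProgram V C) (x : V → ℝ) : Prop :=
  P.Feasible x ∧ ∀ y, P.Feasible y → P.obj ⬝ᵥ x ≤ P.obj ⬝ᵥ y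

/-- Variables for `n + 1` orderings: the coordinates (`false`: `x`, `true`: `y`) of the robots in
the configurations `I⁰, …, Iⁿ⁺¹`, and the durations `φ⁰, …, φⁿ` of the legs `Iᵘ → Iᵘ⁺¹`. -/
abbrev LPVar (k n : ℕ) := (Fin (n + 2) × Fin k × Bool) ⊕ Fin (n + 1)

/-- Constraints: the duration of each leg is at least the `L₁`-distance that each robot travels
(four linear inequalities, one for each choice of two signs); both ends of the leg `u` lie in the
`u`-th ordering; `I⁰` is the start and `Iⁿ⁺¹` is the target (each equation being two
inequalities). -/
abbrev LPCon (k n : ℕ) :=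
  (Fin (n + 1) × Fin k × Bool × Bool) ⊕ (Fin (n + 1) × RobotPair k × Bool) ⊕
    (Bool × Fin k × Bool × Bool)

/-- A sign. -/
def sgn (b : Bool) : ℝ := if b then -1 else 1

/-- The variable for a coordinate of robot `i` in the configuration `Iʷ`, as a row vector. -/
def coordVar {k n : ℕ} (w : Fin (n + 2)) (i : Fin k) (d : Bool) : LPVar k n → ℝ :=
  Pi.single (Sum.inl (w, i, d)) 1

/-- The variable for the duration of leg `u`, as a row vector. -/
def legVar {k n : ℕ} (u : Fin (n + 1)) : LPVar k n → ℝ :=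
  Pi.single (Sum.inr u) 1

/-- The row of the constraint that puts the robots `i` and `j` into the relative position `d` in
the configuration `Iʷ` (the right-hand side is `1`). -/
def sepRow {k n : ℕ} (w : Fin (n + 2)) (i j : Fin k) (d : Dir) : LPVar k n → ℝ :=
  match d with
  | .right => coordVar w i false - coordVar w j false
  | .left => coordVar w j false - coordVar w i false
  | .up => coordVar w i true - coordVar w j true
  | .down => coordVar w j true - coordVar w i true

/-- The linear program that optimizes the makespan along the sequence `O 0, …, O n`. -/
def makespanLP {k n : ℕ} (O : Fin (n + 1) → Ordering k) (A B : Pos k) :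
    LinearProgram (LPVar k n) (LPCon k n) where
  lhs c := match c with
    | .inl (u, i, b, b') =>
        legVar u - sgn b • (coordVar u.succ i false - coordVar u.castSucc i false)
          - sgn b' • (coordVar u.succ i true - coordVar u.castSucc i true)
    | .inr (.inl (u, e, z)) =>
        sepRow (if z then u.succ else u.castSucc) e.1.1 e.1.2 (O u e)
    | .inr (.inr (z, i, d, b)) =>
        sgn b • coordVar (if z then Fin.last (n + 1) else 0) i d
  rhs c := match c with
    | .inl _ => 0
    | .inr (.inl _) => 1
    | .inr (.inr (z, i, d, b)) =>
        let p : Pt := if z then B i else A i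
        sgn b * (if d then p.2 else p.1)
  obj := ∑ u, legVar u

/-! ### Random access machines with logarithmic cost -/

/-- Contents of the memory: integer registers, with integers as addresses. -/
abbrev Store := ℤ → ℤ

/-- Number of bits of an integer, with a sign bit. -/
def bitLen (z : ℤ) : ℕ := Nat.size z.natAbs + 1

/-- Cost of reading the register `r`: the bits of the address and of the contents. -/
def acc (s : Store) (r : ℤ) : ℕ := bitLen r + bitLen (s r)

/-- Structured programs of a random access machine. -/
inductive Prog
  /-- `X_r ← c` -/
  | const (r c : ℤ)
  /-- `X_r ← X_a + X_b` -/
  | add (r a b : ℤ)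
  /-- `X_r ← X_a - X_b` -/
  | sub (r a b : ℤ)
  /-- `X_r ← X_a * X_b` -/
  | mul (r a b : ℤ)
  /-- `X_r ← X_{X_a}` -/
  | load (r a : ℤ)
  /-- `X_{X_a} ← X_r` -/
  | store (a r : ℤ)
  | seq (p q : Prog)
  /-- if `X_r > 0` then `p` else `q` -/
  | ifPos (r : ℤ) (p q : Prog)
  /-- while `X_r > 0` do `p` -/
  | whilePos (r : ℤ) (p : Prog)

/-- `Exec p s s' t`: started with memory `s`, the program `p` halts with memory `s'` after a
computation of total logarithmic cost `t`. -/
inductive Exec : Prog → Store → Store → ℕ → Prop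
  | const (r c : ℤ) (s : Store) :
      Exec (.const r c) s (Function.update s r c) (1 + bitLen r + bitLen c)
  | add (r a b : ℤ) (s : Store) :
      Exec (.add r a b) s (Function.update s r (s a + s b)) (1 + bitLen r + acc s a + acc s b)
  | sub (r a b : ℤ) (s : Store) :
      Exec (.sub r a b) s (Function.update s r (s a - s b)) (1 + bitLen r + acc s a + acc s b)
  | mul (r a b : ℤ) (s : Store) :
      Exec (.mul r a b) s (Function.update s r (s a * s b)) (1 + bitLen r + acc s a + acc s b)
  | load (r a : ℤ) (s : Store) :
      Exec (.load r a) s (Function.update s r (s (s a))) (1 + bitLen r + acc s a + acc s (s a))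
  | store (a r : ℤ) (s : Store) :
      Exec (.store a r) s (Function.update s (s a) (s r)) (1 + acc s a + acc s r)
  | seq {p q : Prog} {s s' s'' : Store} {t t' : ℕ} :
      Exec p s s' t → Exec q s' s'' t' → Exec (.seq p q) s s'' (t + t')
  | ifTrue {r : ℤ} {p q : Prog} {s s' : Store} {t : ℕ} :
      0 < s r → Exec p s s' t → Exec (.ifPos r p q) s s' (1 + acc s r + t)
  | ifFalse {r : ℤ} {p q : Prog} {s s' : Store} {t : ℕ} :
      ¬ 0 < s r → Exec q s s' t → Exec (.ifPos r p q) s s' (1 + acc s r + t)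
  | whileTrue {r : ℤ} {p : Prog} {s s' s'' : Store} {t t' : ℕ} :
      0 < s r → Exec p s s' t → Exec (.whilePos r p) s' s'' t' →
        Exec (.whilePos r p) s s'' (1 + acc s r + t + t')
  | whileFalse {r : ℤ} {p : Prog} {s : Store} :
      ¬ 0 < s r → Exec (.whilePos r p) s s (1 + acc s r)

/-- The memory that holds the input word in the registers `0, 1, 2, …` and `0` elsewhere. -/
def inputStore (w : List ℤ) : Store := fun z => if 0 ≤ z then w.getD z.toNat 0 else 0

/-- The output word: register `0` holds its length `m`, the registers `1, …, m` its entries. -/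
def outputWord (s : Store) : List ℤ := (List.range (s 0).toNat).map fun j => s ((j : ℤ) + 1)

/-- Number of bits of a word of integers. -/
def wordLen (w : List ℤ) : ℕ := (w.map bitLen).sum

/-! ### Fixed-parameter tractability -/

/-- A parameterized search problem: instances with their encoding, the parameter, and the
relation between an instance and the words that are correct answers. -/
structure ParamProblem where
  Inst : Type
  encode : Inst → List ℤ
  param : Inst → ℕ
  Answer : Inst → List ℤ → Prop

/-- Fixed-parameter tractability: one program answers every instance correctly in time
`f (parameter) * (number of input bits) ^ c` (the bits of the output are counted as well), with `f`
computable and `c` constant. -/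
def ParamProblem.IsFPT (Q : ParamProblem) : Prop :=
  ∃ (p : Prog) (f : ℕ → ℕ) (c : ℕ), Computable f ∧
    ∀ I : Q.Inst, ∃ (s : Store) (t : ℕ), Exec p (inputStore (Q.encode I)) s t ∧
      t + wordLen (outputWord s) ≤ f (Q.param I) * wordLen (Q.encode I) ^ c ∧
      Q.Answer I (outputWord s)

/-! ### Min-Makespan CMP as a parameterized problem -/

/-- A rational point as a point of the plane. -/
def toPt (p : ℚ × ℚ) : Pt := ((p.1 : ℝ), (p.2 : ℝ))

/-- An instance: a number of robots and two feasible configurations with rational coordinates. -/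
structure Instance where
  k : ℕ
  A : Fin k → ℚ × ℚ
  B : Fin k → ℚ × ℚ
  hA : (fun i => toPt (A i)) ∈ confSpace k
  hB : (fun i => toPt (B i)) ∈ confSpace k

/-- A rational point, by numerators and denominators. -/
def encodePt (p : ℚ × ℚ) : List ℤ := [p.1.num, p.1.den, p.2.num, p.2.den]

/-- The input word: `k`, followed by start and target of each robot. -/
def Instance.encode (I : Instance) : List ℤ :=
  (I.k : ℤ) :: (List.finRange I.k).flatMap fun i => encodePt (I.A i) ++ encodePt (I.B i)

/-- The fraction whose numerator and denominator are the entries `p` and `p + 1` of a word. -/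
def fracAt (w : List ℤ) (p : ℕ) : ℝ := (w.getD p 0 : ℝ) / (w.getD (p + 1) 0 : ℝ)

/-- Correct answers: the word lists the minimum makespan `L` (numerator, denominator), a number
`N`, and, for each robot, `N + 1` breakpoints (time, `x`, `y`; each by numerator and denominator),
such that moving with constant velocity between successive breakpoints is a feasible schedule from
the start to the target over the time interval `[0, L]`. -/
def Instance.Answer (I : Instance) (w : List ℤ) : Prop :=
  ∃ N : ℕ, w.getD 2 0 = N ∧ w.length = 3 + 6 * (I.k * (N + 1)) ∧
    let idx : Fin I.k → ℕ → ℕ := fun i j => 3 + 6 * (i.val * (N + 1) + j)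
    let L : ℝ := fracAt w 0
    let time : Fin I.k → ℕ → ℝ := fun i j => fracAt w (idx i j)
    let pos : Fin I.k → ℕ → Pt := fun i j => (fracAt w (idx i j + 2), fracAt w (idx i j + 4))
    0 < w.getD 1 0 ∧
    (∀ i, ∀ j ≤ N, 0 < w.getD (idx i j + 1) 0 ∧ 0 < w.getD (idx i j + 3) 0 ∧
      0 < w.getD (idx i j + 5) 0) ∧
    IsMinMakespan (fun i => toPt (I.A i)) (fun i => toPt (I.B i)) L ∧
    (∀ i, time i 0 = 0 ∧ time i N = L ∧ ∀ j < N, time i j ≤ time i (j + 1)) ∧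
    ∃ M : Fin I.k → ℝ → Pt,
      IsSchedule (fun i => toPt (I.A i)) (fun i => toPt (I.B i)) 0 L M ∧
      (∀ i, ∀ j ≤ N, M i (time i j) = pos i j) ∧
      ∀ i, ∀ j < N, ∀ a ∈ Set.Icc (0 : ℝ) 1,
        M i ((1 - a) * time i j + a * time i (j + 1)) = (1 - a) • pos i j + a • pos i (j + 1)

/-- Min-Makespan CMP for unit-square robots in the plane, parameterized by the number of robots. -/
def minMakespanCMP : ParamProblem where
  Inst := Instance
  encode := Instance.encode
  param := Instance.k
  Answer := Instance.Answer

end CMP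

end

/-! Every relation of an ordering is one linear inequality, so the configurations of an ordering
form a convex set (`Dir.Holds.combo`). Hence only the configurations at the changes of ordering
matter: straight motion between two configurations of one ordering stays in it, and it is admissible
as soon as its duration is at least the `L₁`-distance travelled by each robot. Sampling a schedule
at the cut times gives a feasible point of the linear program, and joining the configurations of a
feasible point by straight legs gives back a schedule whose makespan is the objective value
(`IsSchedule.feasible_lpPoint`, `exists_schedule_of_feasible`). For `k > 0` the program has a
nonnegative objective and contains no line, so a feasible program has an optimal vertex
(`LinearProgram.Feasible.exists_optimal_isVertex`).

A schedule is replaced by one along a simple path, without loss of time, by leaving each ordering at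
the last time at which the schedule belongs to it. Orderings are closed sets and finite in number,
so the configuration at that time also lies in an ordering that has not been used
(`IsSchedule.exists_simplePath_from`). Some schedule exists, since every configuration can be moved
to a fixed column (`exists_legs_to_column`); there are finitely many simple paths, so the best of
their programs attains the minimum makespan.

For fixed-parameter tractability no linear program is solved. After padding the path to a length
that depends on `k` only, the matrix is integral, its size and its entries are bounded in terms of
`k`, and each right-hand side is `0`, `1` or a signed input coordinate. By Cramer's rule the
coordinates of a vertex are combinations of the input coordinates and `1`, with coefficients from a
finite set that depends on `k` only (`exists_combination_of_isVertex`). A single number encodes all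
coefficients as digits, and a search through all codes below a bound in `k` meets an optimal path;
candidates are tested in integers, after multiplication by all denominators (`exists_best`).

The weight of the computation is bounded by a function of `k`, and an instruction of weight `N`
multiplies the bit lengths by at most `2 ^ N`. So the lengths of all numbers, and with them the
total cost, are at most a function of `k` times the input length. The search is written in the small
language `Fn`, which `implementable` compiles for the machine. -/

namespace CMP

/-! ### Vertices of linear programs -/

namespace LinearProgram

variable {V C : Type} [Fintype V]

/-- The feasible point `x` is a vertex: the rows that are tight at `x` have trivial kernel. -/
def IsVertex (P : LinearProgram V C) (x : V → ℝ) : Prop :=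
  P.Feasible x ∧ ∀ d : V → ℝ, (∀ c, P.lhs c ⬝ᵥ x = P.rhs c → P.lhs c ⬝ᵥ d = 0) → d = 0

theorem IsVertex.eq_of_tight_iff {P : LinearProgram V C} {x y : V → ℝ} (hx : P.IsVertex x)
    (h : ∀ c, P.lhs c ⬝ᵥ x = P.rhs c ↔ P.lhs c ⬝ᵥ y = P.rhs c) : x = y := by
  refine sub_eq_zero.1 (hx.2 (x - y) fun c hc => ?_)
  rw [dotProduct_sub, hc, (h c).1 hc, sub_self]

/-- A vertex is determined by its set of tight rows, and there are finitely many such sets. -/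
theorem finite_setOf_isVertex [Finite C] (P : LinearProgram V C) : {x | P.IsVertex x}.Finite := by
  refine Set.Finite.of_injOn (f := fun x => {c | P.lhs c ⬝ᵥ x = P.rhs c}) (t := Set.univ)
    (fun _ _ => Set.mem_univ _) ?_ Set.finite_univ
  intro x hx y _ hxy
  exact IsVertex.eq_of_tight_iff hx fun c => Set.ext_iff.1 hxy c

/-- Moving from a feasible point in a direction that keeps the tight rows tight, until a further
row becomes tight. -/
theorem Feasible.exists_move [Fintype C] {P : LinearProgram V C} {x d : V → ℝ} (hx : P.Feasible x)
    (hd : ∀ c, P.lhs c ⬝ᵥ x = P.rhs c → P.lhs c ⬝ᵥ d = 0) (hneg : ∃ c, P.lhs c ⬝ᵥ d < 0) :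
    ∃ ε : ℝ, 0 ≤ ε ∧ P.Feasible (x + ε • d) ∧
      {c | P.lhs c ⬝ᵥ x = P.rhs c} ⊂ {c | P.lhs c ⬝ᵥ (x + ε • d) = P.rhs c} := by
  classical
  obtain ⟨c₀, hc₀⟩ := hneg
  have hx' : ∀ c, P.rhs c ≤ P.lhs c ⬝ᵥ x := fun c => hx c
  -- Ratio test: among the rows that decrease along `d`, the row `c₁` is a first one to become
  -- tight.
  obtain ⟨c₁, hc₁, hmin⟩ := Finset.exists_min_image
    (Finset.univ.filter fun c => P.lhs c ⬝ᵥ d < 0)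
    (fun c => (P.lhs c ⬝ᵥ x - P.rhs c) / (-(P.lhs c ⬝ᵥ d))) ⟨c₀, by simpa using hc₀⟩
  have hc₁' : P.lhs c₁ ⬝ᵥ d < 0 := by simpa using hc₁
  set ε := (P.lhs c₁ ⬝ᵥ x - P.rhs c₁) / (-(P.lhs c₁ ⬝ᵥ d)) with hε
  have hε0 : 0 ≤ ε := div_nonneg (sub_nonneg.2 (hx' c₁)) (by linarith)
  have hval : ∀ c, P.lhs c ⬝ᵥ (x + ε • d) = P.lhs c ⬝ᵥ x + ε * (P.lhs c ⬝ᵥ d) := by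
    intro c
    rw [dotProduct_add, dotProduct_smul, smul_eq_mul]
  have htight : P.lhs c₁ ⬝ᵥ (x + ε • d) = P.rhs c₁ := by
    rw [hval, hε]
    have : P.lhs c₁ ⬝ᵥ d ≠ 0 := hc₁'.ne
    field_simp
    ring
  refine ⟨ε, hε0, fun c => ?_, ?_⟩
  · change P.rhs c ≤ P.lhs c ⬝ᵥ (x + ε • d)
    rw [hval]
    rcases lt_or_ge (P.lhs c ⬝ᵥ d) 0 with h | h
    · have h1 := hmin c (by simpa using h)
      rw [le_div_iff₀ (by linarith)] at h1
      linarith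
    · have := mul_nonneg hε0 h
      linarith [hx' c]
  · refine ⟨fun c hc => ?_, fun h => ?_⟩
    · change P.lhs c ⬝ᵥ (x + ε • d) = P.rhs c
      rw [hval, hd c hc, mul_zero, add_zero]
      exact hc
    · have := hd c₁ (h htight)
      linarith

/-- At a feasible point that is not a vertex, some nonzero direction keeps the tight rows tight.
With the right sign it does not increase the objective and runs into a further row, because the
objective is bounded below and there is no line. Every move makes more rows tight, so the process
ends, and it can only end at a vertex. -/
theorem Feasible.exists_isVertex_le [Fintype C] {P : LinearProgram V C}
    (hline : ∀ d, P.lhs *ᵥ d = 0 → d = 0) {β : ℝ} (hβ : ∀ x, P.Feasible x → β ≤ P.obj ⬝ᵥ x)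
    {x : V → ℝ} (hx : P.Feasible x) : ∃ y, P.IsVertex y ∧ P.obj ⬝ᵥ y ≤ P.obj ⬝ᵥ x := by
  classical
  induction hm : Fintype.card C - {c | P.lhs c ⬝ᵥ x = P.rhs c}.ncard using
    Nat.strong_induction_on generalizing x with
  | _ m ih =>
  by_cases hv : P.IsVertex x
  · exact ⟨x, hv, le_rfl⟩
  have : ∃ d : V → ℝ, (∀ c, P.lhs c ⬝ᵥ x = P.rhs c → P.lhs c ⬝ᵥ d = 0) ∧ d ≠ 0 := by
    by_contra! h
    exact hv ⟨hx, h⟩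
  obtain ⟨d, hd, hd0⟩ := this
  obtain ⟨c₂, hc₂⟩ : ∃ c, P.lhs c ⬝ᵥ d ≠ 0 := by
    by_contra! h
    exact hd0 (hline d (funext h))
  -- a direction that does not increase the objective and runs into a constraint
  have key : ∃ e : V → ℝ, (∀ c, P.lhs c ⬝ᵥ x = P.rhs c → P.lhs c ⬝ᵥ e = 0) ∧
      P.obj ⬝ᵥ e ≤ 0 ∧ ∃ c, P.lhs c ⬝ᵥ e < 0 := by
    -- A direction that strictly decreases the objective is blocked by some row: otherwise the step
    -- `s` would bring the objective down to `β - 1`.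
    have hblock : ∀ e : V → ℝ, P.obj ⬝ᵥ e < 0 → ∃ c, P.lhs c ⬝ᵥ e < 0 := by
      intro e he
      by_contra! hall
      set s := (P.obj ⬝ᵥ x - β + 1) / (-(P.obj ⬝ᵥ e)) with hs
      have hs0 : 0 ≤ s := div_nonneg (by linarith [hβ x hx]) (by linarith)
      have hf : P.Feasible (x + s • e) := by
        intro c
        change P.rhs c ≤ P.lhs c ⬝ᵥ (x + s • e)
        rw [dotProduct_add, dotProduct_smul, smul_eq_mul]
        have h1 := mul_nonneg hs0 (hall c)
        have h2 : P.rhs c ≤ P.lhs c ⬝ᵥ x := hx c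
        linarith
      have h3 := hβ _ hf
      rw [dotProduct_add, dotProduct_smul, smul_eq_mul] at h3
      have h4 : s * (P.obj ⬝ᵥ e) = -(P.obj ⬝ᵥ x - β + 1) := by
        rw [hs]
        field_simp [he.ne]
      linarith
    have hnegd : ∀ c, P.lhs c ⬝ᵥ x = P.rhs c → P.lhs c ⬝ᵥ (-d) = 0 := fun c hc => by
      rw [dotProduct_neg, hd c hc, neg_zero]
    rcases lt_trichotomy (P.obj ⬝ᵥ d) 0 with h | h | h
    · exact ⟨d, hd, h.le, hblock d h⟩
    · rcases lt_or_gt_of_ne hc₂ with h' | h'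
      · exact ⟨d, hd, h.le, c₂, h'⟩
      · exact ⟨-d, hnegd, by rw [dotProduct_neg, h, neg_zero], c₂, by
          rw [dotProduct_neg]; linarith⟩
    · have h' : P.obj ⬝ᵥ (-d) < 0 := by rw [dotProduct_neg]; linarith
      exact ⟨-d, hnegd, h'.le, hblock _ h'⟩
  obtain ⟨e, he, hobj, hneg⟩ := key
  obtain ⟨ε, hε, hf, hss⟩ := hx.exists_move he hneg
  have hlt := Set.ncard_lt_ncard hss (Set.toFinite _)
  have hle : {c | P.lhs c ⬝ᵥ (x + ε • e) = P.rhs c}.ncard ≤ Fintype.card C := by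
    rw [← Nat.card_eq_fintype_card, ← Set.ncard_univ]
    exact Set.ncard_le_ncard (Set.subset_univ _) (Set.toFinite _)
  obtain ⟨y, hy, hyo⟩ := ih _ (by omega) hf rfl
  refine ⟨y, hy, hyo.trans ?_⟩
  rw [dotProduct_add, dotProduct_smul, smul_eq_mul]
  have := mul_nonneg hε (neg_nonneg.2 hobj)
  linarith

/-- Each feasible point is dominated by a vertex, so the best of the finitely many vertices is
optimal. -/
theorem Feasible.exists_optimal_isVertex [Fintype C] {P : LinearProgram V C}
    (hline : ∀ d, P.lhs *ᵥ d = 0 → d = 0) {β : ℝ} (hβ : ∀ x, P.Feasible x → β ≤ P.obj ⬝ᵥ x)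
    {x : V → ℝ} (hx : P.Feasible x) : ∃ y, P.Optimal y ∧ P.IsVertex y := by
  obtain ⟨z, hz, -⟩ := hx.exists_isVertex_le hline hβ
  obtain ⟨y, hy, hmin⟩ := Set.exists_min_image _ (fun y => P.obj ⬝ᵥ y) P.finite_setOf_isVertex
    ⟨z, hz⟩
  refine ⟨y, ⟨hy.1, fun w hw => ?_⟩, hy⟩
  obtain ⟨v, hv, hvw⟩ := hw.exists_isVertex_le hline hβ
  exact (hmin v hv).trans hvw

/-- A proper subspace lies in the kernel of a nonzero functional, and a functional on `V → ℝ` is a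
dot product. This turns the trivial kernel in `IsVertex` into full rank of the tight rows. -/
theorem span_eq_top_of_forall_dotProduct [DecidableEq V] {S : Set (V → ℝ)}
    (h : ∀ d : V → ℝ, (∀ r ∈ S, r ⬝ᵥ d = 0) → d = 0) : Submodule.span ℝ S = ⊤ := by
  by_contra hne
  obtain ⟨f, hf0, hf⟩ := Submodule.exists_le_ker_of_lt_top _ (lt_top_iff_ne_top.2 hne)
  have hfd : ∀ w : V → ℝ, f w = w ⬝ᵥ fun v => f (Pi.single v 1) := by
    intro w
    conv_lhs => rw [pi_eq_sum_univ' w]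
    simp [dotProduct, map_sum]
  refine hf0 (LinearMap.ext fun w => ?_)
  have := h (fun v => f (Pi.single v 1)) fun r hr => by
    rw [← hfd]
    exact hf (Submodule.subset_span hr)
  rw [hfd, this]
  simp

/-- At a vertex, a square system of tight rows determines the point. -/
theorem IsVertex.exists_det_ne_zero [DecidableEq V] {P : LinearProgram V C} {x : V → ℝ}
    (hx : P.IsVertex x) :
    ∃ g : V → C, (∀ v, P.lhs (g v) ⬝ᵥ x = P.rhs (g v)) ∧ (P.lhs.submatrix g id).det ≠ 0 := by
  set S : Set (V → ℝ) := {r | ∃ c, P.lhs c ⬝ᵥ x = P.rhs c ∧ P.lhs c = r} with hS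
  have htop : Submodule.span ℝ S = ⊤ := span_eq_top_of_forall_dotProduct fun d hd =>
    hx.2 d fun c hc => hd _ ⟨c, hc, rfl⟩
  -- A basis of the row space chosen among the tight rows. Its length is `Fintype.card V`, so these
  -- rows form a square matrix.
  obtain ⟨f, hfS, -, hli⟩ := Submodule.exists_fun_fin_finrank_span_eq ℝ S
  have hrank : Module.finrank ℝ (Submodule.span ℝ S) = Fintype.card V := by
    rw [htop, finrank_top, Module.finrank_fintype_fun_eq_card]
  let e : V ≃ Fin (Module.finrank ℝ (Submodule.span ℝ S)) :=
    (Fintype.equivFin V).trans (finCongr hrank.symm)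
  choose c hc hcr using hfS
  refine ⟨fun v => c (e v), fun v => hc _, ?_⟩
  have hli' : LinearIndependent ℝ (P.lhs.submatrix (fun v => c (e v)) id).row := by
    have : (P.lhs.submatrix (fun v => c (e v)) id).row = f ∘ e := by
      funext v
      exact hcr (e v)
    rw [this]
    exact hli.comp _ e.injective
  have := Matrix.linearIndependent_rows_iff_isUnit.1 hli'
  rw [Matrix.isUnit_iff_isUnit_det] at this
  exact this.ne_zero

end LinearProgram

/-! ### The `L₁`-norm -/

theorem l1_nonneg (p : Pt) : 0 ≤ l1 p := add_nonneg (abs_nonneg _) (abs_nonneg _)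

theorem l1_zero : l1 0 = 0 := by simp [l1]

theorem l1_add_le (p q : Pt) : l1 (p + q) ≤ l1 p + l1 q := by
  simp only [l1, Prod.fst_add, Prod.snd_add]
  linarith [abs_add_le p.1 q.1, abs_add_le p.2 q.2]

theorem l1_smul (a : ℝ) (p : Pt) : l1 (a • p) = |a| * l1 p := by
  simp only [l1, Prod.smul_fst, Prod.smul_snd, smul_eq_mul, abs_mul]
  ring

theorem l1_sub_comm (p q : Pt) : l1 (p - q) = l1 (q - p) := by
  simp only [l1, Prod.fst_sub, Prod.snd_sub, abs_sub_comm]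

theorem l1_sub_le (p q r : Pt) : l1 (p - r) ≤ l1 (p - q) + l1 (q - r) := by
  simpa using l1_add_le (p - q) (q - r)

theorem eq_of_l1_sub_le_zero {p q : Pt} (h : l1 (p - q) ≤ 0) : p = q := by
  simp only [l1, Prod.fst_sub, Prod.snd_sub] at h
  have h1 := abs_nonneg (p.1 - q.1)
  have h2 := abs_nonneg (p.2 - q.2)
  ext
  · exact sub_eq_zero.1 (abs_eq_zero.1 (by linarith))
  · exact sub_eq_zero.1 (abs_eq_zero.1 (by linarith))

/-! ### Membership in orderings -/

theorem one_le_linf_of_holds {d : Dir} {p q : Pt} (h : d.Holds p q) : 1 ≤ linf (p - q) := by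
  simp only [linf, le_max_iff, Prod.fst_sub, Prod.snd_sub]
  cases d <;> simp only [Dir.Holds] at h
  · exact Or.inl (le_abs.2 (Or.inl (by linarith)))
  · exact Or.inl (le_abs.2 (Or.inr (by linarith)))
  · exact Or.inr (le_abs.2 (Or.inl (by linarith)))
  · exact Or.inr (le_abs.2 (Or.inr (by linarith)))

theorem exists_holds_of_one_le_linf {p q : Pt} (h : 1 ≤ linf (p - q)) : ∃ d : Dir, d.Holds p q := by
  simp only [linf, le_max_iff, Prod.fst_sub, Prod.snd_sub, le_abs] at h
  rcases h with (h | h) | (h | h)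
  · exact ⟨.right, by simp only [Dir.Holds]; linarith⟩
  · exact ⟨.left, by simp only [Dir.Holds]; linarith⟩
  · exact ⟨.up, by simp only [Dir.Holds]; linarith⟩
  · exact ⟨.down, by simp only [Dir.Holds]; linarith⟩

theorem linf_sub_comm (p q : Pt) : linf (p - q) = linf (q - p) := by
  simp only [linf, Prod.fst_sub, Prod.snd_sub, abs_sub_comm]

theorem mem_confSpace_iff {k : ℕ} {P : Pos k} :
    P ∈ confSpace k ↔ ∀ e : RobotPair k, 1 ≤ linf (P e.1.1 - P e.1.2) := by
  refine ⟨fun h e => h _ _ e.2.ne, fun h i j hij => ?_⟩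
  rcases lt_or_gt_of_ne hij with hlt | hlt
  · exact h ⟨(i, j), hlt⟩
  · rw [linf_sub_comm]
    exact h ⟨(j, i), hlt⟩

/-- A single relation already forces `L∞`-distance at least `1`, so membership in `confSpace`
follows from the relations. -/
theorem mem_confs_iff {k : ℕ} {O : Ordering k} {P : Pos k} :
    P ∈ O.confs ↔ ∀ e : RobotPair k, (O e).Holds (P e.1.1) (P e.1.2) :=
  ⟨fun h => h.2, fun h => ⟨mem_confSpace_iff.2 fun e => one_le_linf_of_holds (h e), h⟩⟩

theorem exists_mem_confs {k : ℕ} {P : Pos k} (hP : P ∈ confSpace k) :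
    ∃ O : Ordering k, P ∈ O.confs := by
  choose O hO using fun e => exists_holds_of_one_le_linf (mem_confSpace_iff.1 hP e)
  exact ⟨O, mem_confs_iff.2 hO⟩

/-- A relation is one linear inequality and thus a convex condition; this is what keeps straight
motion inside an ordering. -/
theorem Dir.Holds.combo {d : Dir} {p q p' q' : Pt} (h : d.Holds p q) (h' : d.Holds p' q') {a : ℝ}
    (ha : a ∈ Set.Icc (0 : ℝ) 1) :
    d.Holds ((1 - a) • p + a • p') ((1 - a) • q + a • q') := by
  have h0 : 0 ≤ 1 - a := by linarith [ha.2]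
  cases d <;> simp only [Dir.Holds, Prod.fst_add, Prod.snd_add, Prod.smul_fst, Prod.smul_snd,
    smul_eq_mul] at * <;> nlinarith [mul_le_mul_of_nonneg_left h h0,
      mul_le_mul_of_nonneg_left h' ha.1]

/-! ### Polygonal interpolation -/

theorem Icc_exists_combo {s t x : ℝ} (hx : x ∈ Set.Icc s t) :
    ∃ a ∈ Set.Icc (0 : ℝ) 1, x = (1 - a) * s + a * t := by
  rcases (hx.1.trans hx.2).eq_or_lt with h | h
  · exact ⟨0, by simp, by linarith [hx.1, hx.2]⟩
  · have hp : 0 < t - s := sub_pos.2 h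
    refine ⟨(x - s) / (t - s), ⟨div_nonneg (by linarith [hx.1]) hp.le,
      (div_le_one hp).2 (by linarith [hx.2])⟩, ?_⟩
    field_simp
    ring

theorem monotone_upto {τ : ℕ → ℝ} {N : ℕ} (h : ∀ u < N, τ u ≤ τ (u + 1)) :
    ∀ {u v : ℕ}, u ≤ v → v ≤ N → τ u ≤ τ v := by
  intro u v huv
  induction v, huv using Nat.le_induction with
  | base => intro _; exact le_rfl
  | succ v _ ih => intro hv; exact (ih (by omega)).trans (h v (by omega))

theorem exists_leg {τ : ℕ → ℝ} {N : ℕ} {t : ℝ} (ht : t ∈ Set.Icc (τ 0) (τ (N + 1))) :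
    ∃ u < N + 1, t ∈ Set.Icc (τ u) (τ (u + 1)) := by
  induction N with
  | zero => exact ⟨0, by omega, ht⟩
  | succ N ih =>
    rcases le_total t (τ (N + 1)) with h | h
    · obtain ⟨u, hu, hut⟩ := ih ⟨ht.1, h⟩
      exact ⟨u, by omega, hut⟩
    · exact ⟨N + 1, by omega, h, ht.2⟩

/-- A polygonal path through given points at given times. -/
theorem exists_polyline (τ : ℕ → ℝ) (v : ℕ → Pt) (N : ℕ)
    (h : ∀ u < N, l1 (v (u + 1) - v u) ≤ τ (u + 1) - τ u) :
    ∃ m : ℝ → Pt, (∀ u ≤ N, m (τ u) = v u) ∧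
      (∀ u < N, ∀ a ∈ Set.Icc (0 : ℝ) 1,
        m ((1 - a) * τ u + a * τ (u + 1)) = (1 - a) • v u + a • v (u + 1)) ∧
      ∀ s ∈ Set.Icc (τ 0) (τ N), ∀ t ∈ Set.Icc (τ 0) (τ N), l1 (m s - m t) ≤ |s - t| := by
  have hstep : ∀ u < N, τ u ≤ τ (u + 1) := fun u hu => by
    linarith [l1_nonneg (v (u + 1) - v u), h u hu]
  induction N with
  | zero =>
    refine ⟨fun _ => v 0, ?_, by simp, fun s _ t _ => ?_⟩
    · intro u hu
      rw [Nat.le_zero.1 hu]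
    · simp [l1_zero]
  | succ N ih =>
    obtain ⟨m, hm1, hm2, hm3⟩ := ih (fun u hu => h u (by omega)) fun u hu => hstep u (by omega)
    have hmono : ∀ {u v : ℕ}, u ≤ v → v ≤ N + 1 → τ u ≤ τ v := monotone_upto hstep
    -- The last leg at constant velocity. If its duration is `0`, division by zero makes `q`
    -- constantly `v N`, which is the right value because then `v (N + 1) = v N` (`hdeg`).
    set q : ℝ → Pt := fun t =>
      v N + ((t - τ N) / (τ (N + 1) - τ N)) • (v (N + 1) - v N) with hq
    set m' : ℝ → Pt := fun t => if t ≤ τ N then m t else q t with hm'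
    have hlow : ∀ t, t ≤ τ N → m' t = m t := fun t ht => if_pos ht
    have hN : m' (τ N) = v N := by rw [hlow _ le_rfl, hm1 N le_rfl]
    have hhigh : ∀ t, τ N ≤ t → m' t = q t := by
      intro t ht
      rcases ht.eq_or_lt with rfl | ht
      · rw [hN, hq]
        simp
      · exact if_neg ht.not_ge
    have hqv : τ N < τ (N + 1) → q (τ (N + 1)) = v (N + 1) := by
      intro hlt
      simp only [hq]
      rw [div_self (by linarith), one_smul]
      abel
    have hdeg : τ N = τ (N + 1) → v (N + 1) = v N := by
      intro he
      have := h N (by omega)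
      exact eq_of_l1_sub_le_zero (by linarith)
    have hend : m' (τ (N + 1)) = v (N + 1) := by
      rcases (hstep N (by omega)).eq_or_lt with he | hlt
      · rw [← he, hN, hdeg he]
      · rw [hhigh _ hlt.le, hqv hlt]
    have hqm : ∀ s t, l1 (q s - q t) ≤ |s - t| := by
      intro s t
      have e : q s - q t = ((s - t) / (τ (N + 1) - τ N)) • (v (N + 1) - v N) := by
        simp only [hq, add_sub_add_left_eq_sub, ← sub_smul]
        congr 1
        ring
      rw [e, l1_smul, abs_div]
      rcases (hstep N (by omega)).eq_or_lt with he | hlt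
      · rw [← he]
        simp
      · rw [abs_of_pos (sub_pos.2 hlt), div_mul_eq_mul_div, div_le_iff₀ (sub_pos.2 hlt)]
        exact mul_le_mul_of_nonneg_left (h N (by omega)) (abs_nonneg _)
    refine ⟨m', ?_, ?_, ?_⟩
    · intro u hu
      rcases Nat.le_succ_iff.1 hu with hu | rfl
      · rw [hlow _ (hmono hu (by omega)), hm1 u hu]
      · exact hend
    · intro u hu a ha
      have h0 : 0 ≤ 1 - a := by linarith [ha.2]
      rcases Nat.lt_succ_iff_lt_or_eq.1 hu with hu' | rfl
      · rw [hlow _ _, hm2 u hu' a ha]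
        have h1 := hmono hu'.le (by omega)
        have h2 := hmono (Nat.succ_le_of_lt hu') (by omega)
        nlinarith [mul_le_mul_of_nonneg_left h1 h0, mul_le_mul_of_nonneg_left h2 ha.1]
      · rcases (hstep u (by omega)).eq_or_lt with he | hlt
        · rw [hdeg he, ← he, ← add_smul]
          simp only [sub_add_cancel, one_smul]
          rw [← add_mul]
          simpa using hN
        · rw [hhigh _ (by nlinarith [ha.1])]
          have : (1 - a) * τ u + a * τ (u + 1) - τ u = a * (τ (u + 1) - τ u) := by ring
          simp only [hq]
          rw [this, mul_div_assoc, div_self (by linarith), mul_one, sub_smul, smul_sub, one_smul]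
          abel
    · have key : ∀ s ∈ Set.Icc (τ 0) (τ (N + 1)), ∀ t ∈ Set.Icc (τ 0) (τ (N + 1)), s ≤ t →
          l1 (m' s - m' t) ≤ |s - t| := by
        intro s hs t ht hst
        rcases le_total t (τ N) with h1 | h1
        · rw [hlow s (hst.trans h1), hlow t h1]
          exact hm3 s ⟨hs.1, hst.trans h1⟩ t ⟨ht.1, h1⟩
        rcases le_total s (τ N) with h2 | h2
        -- The two times lie on different sides of the breakpoint `τ N`; the estimates for both
        -- sides add up there.
        · refine (l1_sub_le _ (m' (τ N)) _).trans ?_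
          have e1 : l1 (m' s - m' (τ N)) ≤ |s - τ N| := by
            rw [hlow s h2, hlow _ le_rfl]
            exact hm3 s ⟨hs.1, h2⟩ _ ⟨hmono (Nat.zero_le _) (by omega), le_rfl⟩
          have e2 : l1 (m' (τ N) - m' t) ≤ |τ N - t| := by
            rw [hhigh _ le_rfl, hhigh t h1]
            exact hqm _ _
          rw [abs_of_nonpos (by linarith)] at e1 e2 ⊢
          linarith
        · rw [hhigh s h2, hhigh t h1]
          exact hqm s t
      intro s hs t ht
      rcases le_total s t with hst | hst
      · exact key s hs t ht hst
      · rw [l1_sub_comm, abs_sub_comm]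
        exact key t ht s hs hst

theorem isPolygonalChain_image {τ : ℕ → ℝ} {v : ℕ → Pt} {N : ℕ} {m : ℝ → Pt}
    (hτ : ∀ u < N + 1, τ u ≤ τ (u + 1))
    (hm : ∀ u < N + 1, ∀ a ∈ Set.Icc (0 : ℝ) 1,
        m ((1 - a) * τ u + a * τ (u + 1)) = (1 - a) • v u + a • v (u + 1)) :
    IsPolygonalChain (m '' Set.Icc (τ 0) (τ (N + 1))) := by
  refine ⟨N, v, ?_⟩
  ext p
  simp only [Set.mem_image, Set.mem_iUnion, Finset.mem_range, exists_prop]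
  constructor
  · rintro ⟨t, ht, rfl⟩
    obtain ⟨u, hu, hut⟩ := exists_leg ht
    obtain ⟨a, ha, rfl⟩ := Icc_exists_combo hut
    exact ⟨u, hu, 1 - a, a, by linarith [ha.2], ha.1, by ring, (hm u hu a ha).symm⟩
  · rintro ⟨u, hu, b, a, hb, ha, hab, rfl⟩
    have hb' : b = 1 - a := by linarith
    subst hb'
    refine ⟨(1 - a) * τ u + a * τ (u + 1), ?_, hm u hu a ⟨ha, by linarith⟩⟩
    have h1 : τ 0 ≤ τ u := monotone_upto hτ (Nat.zero_le _) hu.le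
    have h2 := hτ u hu
    have h3 : τ (u + 1) ≤ τ (N + 1) := monotone_upto hτ (by omega) le_rfl
    constructor <;> nlinarith

/-! ### Paths of configurations -/

/-- A path of configurations `I 0, …, I N` with durations `φ u` such that the straight motion from
`I u` to `I (u + 1)` stays in one ordering and is fast enough. -/
structure IsPath {k : ℕ} (N : ℕ) (I : ℕ → Pos k) (φ : ℕ → ℝ) : Prop where
  nonneg : ∀ u < N, 0 ≤ φ u
  metric : ∀ u < N, ∀ i, l1 (I (u + 1) i - I u i) ≤ φ u
  ordered : ∀ u < N, ∃ O : Ordering k, I u ∈ O.confs ∧ I (u + 1) ∈ O.confs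

/-- The time at which a path reaches its `u`-th configuration. -/
def arrival (φ : ℕ → ℝ) (u : ℕ) : ℝ := ∑ j ∈ Finset.range u, φ j

theorem arrival_zero (φ : ℕ → ℝ) : arrival φ 0 = 0 := by simp [arrival]

theorem arrival_succ (φ : ℕ → ℝ) (u : ℕ) : arrival φ (u + 1) = arrival φ u + φ u :=
  Finset.sum_range_succ _ _

/-- Moving straight along a path of configurations is a feasible schedule. -/
theorem IsPath.exists_schedule {k N : ℕ} {I : ℕ → Pos k} {φ : ℕ → ℝ} (h : IsPath (N + 1) I φ) :
    ∃ M : Fin k → ℝ → Pt, IsSchedule (I 0) (I (N + 1)) 0 (arrival φ (N + 1)) M ∧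
      (∀ i, ∀ u ≤ N + 1, M i (arrival φ u) = I u i) ∧
      (∀ i, ∀ u < N + 1, ∀ a ∈ Set.Icc (0 : ℝ) 1,
        M i ((1 - a) * arrival φ u + a * arrival φ (u + 1)) = (1 - a) • I u i + a • I (u + 1) i) ∧
      ∀ u < N + 1, ∀ O : Ordering k, I u ∈ O.confs → I (u + 1) ∈ O.confs →
        ∀ t ∈ Set.Icc (arrival φ u) (arrival φ (u + 1)), (fun i => M i t) ∈ O.confs := by
  have hτ : ∀ u < N + 1, arrival φ u ≤ arrival φ (u + 1) := fun u hu => by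
    rw [arrival_succ]
    linarith [h.nonneg u hu]
  choose M hM1 hM2 hM3 using fun i => exists_polyline (arrival φ) (fun u => I u i) (N + 1)
    fun u hu => by
      rw [arrival_succ, add_sub_cancel_left]
      exact h.metric u hu i
  have hord : ∀ u < N + 1, ∀ O : Ordering k, I u ∈ O.confs → I (u + 1) ∈ O.confs →
        ∀ t ∈ Set.Icc (arrival φ u) (arrival φ (u + 1)), (fun i => M i t) ∈ O.confs := by
    intro u hu O h1 h2 t ht
    obtain ⟨a, ha, rfl⟩ := Icc_exists_combo ht
    rw [mem_confs_iff] at *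
    intro e
    rw [hM2 _ u hu a ha, hM2 _ u hu a ha]
    exact (h1 e).combo (h2 e) ha
  have hle : (0 : ℝ) ≤ arrival φ (N + 1) := by
    rw [← arrival_zero φ]
    exact monotone_upto hτ (Nat.zero_le _) le_rfl
  refine ⟨M, ⟨hle, fun i => ⟨hle, ?_, ?_, ?_, ?_⟩, ?_⟩, hM1, hM2, hord⟩
  · simpa [arrival_zero] using hM1 i 0 (Nat.zero_le _)
  · exact hM1 i (N + 1) le_rfl
  · simpa [arrival_zero] using hM3 i
  · simpa [arrival_zero] using isPolygonalChain_image hτ (hM2 i)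
  · intro t ht
    rw [← arrival_zero φ] at ht
    obtain ⟨u, hu, hut⟩ := exists_leg ht
    obtain ⟨O, h1, h2⟩ := h.ordered u hu
    exact (hord u hu O h1 h2 t hut).1

/-! ### The linear program of a sequence of orderings -/

section MakespanLP

variable {k n : ℕ}

/-- The configuration `Iʷ` of a point of the linear program. -/
def lpConf (x : LPVar k n → ℝ) (w : Fin (n + 2)) : Pos k :=
  fun i => (x (Sum.inl (w, i, false)), x (Sum.inl (w, i, true)))

/-- The point of the linear program with given configurations and durations. -/
def lpPoint (I : Fin (n + 2) → Pos k) (φ : Fin (n + 1) → ℝ) : LPVar k n → ℝ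
  | .inl (w, i, d) => if d then (I w i).2 else (I w i).1
  | .inr u => φ u

theorem lpConf_lpPoint (I : Fin (n + 2) → Pos k) (φ : Fin (n + 1) → ℝ) (w : Fin (n + 2)) :
    lpConf (lpPoint I φ) w = I w := by
  funext i
  simp [lpConf, lpPoint]

theorem coordVar_dotProduct (w : Fin (n + 2)) (i : Fin k) (d : Bool) (x : LPVar k n → ℝ) :
    coordVar w i d ⬝ᵥ x = x (Sum.inl (w, i, d)) := by
  simp [coordVar]

theorem legVar_dotProduct (u : Fin (n + 1)) (x : LPVar k n → ℝ) :
    legVar u ⬝ᵥ x = x (Sum.inr u) := by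
  simp [legVar]

theorem obj_dotProduct (O : Fin (n + 1) → Ordering k) (A B : Pos k) (x : LPVar k n → ℝ) :
    (makespanLP O A B).obj ⬝ᵥ x = ∑ u, x (Sum.inr u) := by
  simp [makespanLP, sum_dotProduct, legVar_dotProduct]

theorem one_le_sepRow_dotProduct (w : Fin (n + 2)) (i j : Fin k) (d : Dir) (x : LPVar k n → ℝ) :
    1 ≤ sepRow w i j d ⬝ᵥ x ↔ d.Holds (lpConf x w i) (lpConf x w j) := by
  cases d <;> simp only [sepRow, sub_dotProduct, coordVar_dotProduct, Dir.Holds, lpConf] <;>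
    constructor <;> intro h <;> linarith

/-- For the signs of `p` and `q` the expression is `a - |p| - |q|`, and for other signs it is at
least that. -/
theorem forall_sgn_le_iff {a p q : ℝ} :
    (∀ b b', 0 ≤ a - sgn b * p - sgn b' * q) ↔ |p| + |q| ≤ a := by
  simp only [sgn, Bool.forall_bool, if_true, Bool.false_eq_true, if_false]
  constructor
  · rintro ⟨⟨h1, h2⟩, h3, h4⟩
    rcases abs_cases p with ⟨hp, _⟩ | ⟨hp, _⟩ <;> rcases abs_cases q with ⟨hq, _⟩ | ⟨hq, _⟩ <;>
      rw [hp, hq] <;> linarith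
  · intro h
    have := neg_abs_le p
    have := neg_abs_le q
    have := le_abs_self p
    have := le_abs_self q
    refine ⟨⟨?_, ?_⟩, ?_, ?_⟩ <;> linarith

theorem forall_sgn_mul_le_iff {a p : ℝ} : (∀ b, sgn b * a ≤ sgn b * p) ↔ p = a := by
  simp only [sgn, Bool.forall_bool, if_true, Bool.false_eq_true, if_false]
  constructor
  · rintro ⟨h1, h2⟩
    linarith
  · rintro rfl
    exact ⟨le_rfl, le_rfl⟩

theorem makespanLP_lhs_leg (O : Fin (n + 1) → Ordering k) (A B : Pos k) (x : LPVar k n → ℝ)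
    (u : Fin (n + 1)) (i : Fin k) (b b' : Bool) :
    (makespanLP O A B).lhs (.inl (u, i, b, b')) ⬝ᵥ x =
      x (.inr u) - sgn b * (lpConf x u.succ i - lpConf x u.castSucc i).1
        - sgn b' * (lpConf x u.succ i - lpConf x u.castSucc i).2 := by
  simp [makespanLP, sub_dotProduct, legVar_dotProduct, coordVar_dotProduct, smul_dotProduct, lpConf]

theorem makespanLP_lhs_end (O : Fin (n + 1) → Ordering k) (A B : Pos k) (x : LPVar k n → ℝ)
    (z : Bool) (i : Fin k) (d b : Bool) :
    (makespanLP O A B).lhs (.inr (.inr (z, i, d, b))) ⬝ᵥ x =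
      sgn b * x (.inl (if z then Fin.last (n + 1) else 0, i, d)) := by
  simp [makespanLP, coordVar_dotProduct, smul_dotProduct]

theorem makespanLP_feasible_iff {O : Fin (n + 1) → Ordering k} {A B : Pos k}
    {x : LPVar k n → ℝ} :
    (makespanLP O A B).Feasible x ↔
      (∀ u : Fin (n + 1), ∀ i,
        l1 (lpConf x u.succ i - lpConf x u.castSucc i) ≤ x (Sum.inr u)) ∧
      (∀ u : Fin (n + 1), lpConf x u.castSucc ∈ (O u).confs ∧ lpConf x u.succ ∈ (O u).confs) ∧
      lpConf x 0 = A ∧ lpConf x (Fin.last (n + 1)) = B := by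
  have h1 : ∀ u i, (∀ b b', (makespanLP O A B).rhs (.inl (u, i, b, b')) ≤
      (makespanLP O A B).lhs (.inl (u, i, b, b')) ⬝ᵥ x) ↔
      l1 (lpConf x u.succ i - lpConf x u.castSucc i) ≤ x (Sum.inr u) := by
    intro u i
    simp only [makespanLP_lhs_leg]
    exact forall_sgn_le_iff
  have h2 : ∀ u e z, (makespanLP O A B).rhs (.inr (.inl (u, e, z))) ≤
      (makespanLP O A B).lhs (.inr (.inl (u, e, z))) ⬝ᵥ x ↔
      (O u e).Holds (lpConf x (if z then u.succ else u.castSucc) e.1.1)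
        (lpConf x (if z then u.succ else u.castSucc) e.1.2) := by
    intro u e z
    exact one_le_sepRow_dotProduct _ _ _ _ _
  have h3 : ∀ z i d, (∀ b, (makespanLP O A B).rhs (.inr (.inr (z, i, d, b))) ≤
      (makespanLP O A B).lhs (.inr (.inr (z, i, d, b))) ⬝ᵥ x) ↔
      x (.inl (if z then Fin.last (n + 1) else 0, i, d)) =
        if d then (if z then B i else A i).2 else (if z then B i else A i).1 := by
    intro z i d
    simp only [makespanLP_lhs_end]
    exact forall_sgn_mul_le_iff
  constructor
  · intro h
    have h' : ∀ c, (makespanLP O A B).rhs c ≤ (makespanLP O A B).lhs c ⬝ᵥ x := fun c => h c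
    refine ⟨fun u i => (h1 u i).1 fun b b' => h' _, fun u => ⟨mem_confs_iff.2 fun e => ?_,
      mem_confs_iff.2 fun e => ?_⟩, funext fun i => ?_, funext fun i => ?_⟩
    · simpa using (h2 u e false).1 (h' _)
    · simpa using (h2 u e true).1 (h' _)
    · have e1 := (h3 false i false).1 fun b => h' _
      have e2 := (h3 false i true).1 fun b => h' _
      simp only [Bool.false_eq_true, if_false, if_true] at e1 e2
      exact Prod.ext e1 e2
    · have e1 := (h3 true i false).1 fun b => h' _
      have e2 := (h3 true i true).1 fun b => h' _
      simp only [Bool.false_eq_true, if_false, if_true] at e1 e2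
      exact Prod.ext e1 e2
  · rintro ⟨ha, hb, hc, hd⟩ c
    rcases c with ⟨u, i, b, b'⟩ | ⟨u, e, z⟩ | ⟨z, i, d, b⟩
    · exact (h1 u i).2 (ha u i) b b'
    · refine (h2 u e z).2 ?_
      cases z
      · exact mem_confs_iff.1 (hb u).1 e
      · exact mem_confs_iff.1 (hb u).2 e
    · refine (h3 z i d).2 ?_ b
      have e1 := congrFun hc i
      have e2 := congrFun hd i
      cases z <;> cases d <;> simp only [Bool.false_eq_true, if_false, if_true]
      · rw [← e1]; rfl
      · rw [← e1]; rfl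
      · rw [← e2]; rfl
      · rw [← e2]; rfl

theorem makespanLP_obj_nonneg (hk : 0 < k) {O : Fin (n + 1) → Ordering k} {A B : Pos k}
    {x : LPVar k n → ℝ} (hx : (makespanLP O A B).Feasible x) :
    0 ≤ (makespanLP O A B).obj ⬝ᵥ x := by
  rw [obj_dotProduct]
  refine Finset.sum_nonneg fun u _ => ?_
  exact (l1_nonneg _).trans ((makespanLP_feasible_iff.1 hx).1 u ⟨0, hk⟩)

/-- The four signs of the leg rows force a zero duration and a zero displacement, the rows of the
start force the first configuration to vanish, and induction carries this along the legs. A robot is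
needed because without robots no row involves the durations. -/
theorem makespanLP_no_line (hk : 0 < k) (O : Fin (n + 1) → Ordering k) (A B : Pos k)
    (d : LPVar k n → ℝ) (hd : (makespanLP O A B).lhs *ᵥ d = 0) : d = 0 := by
  have h' : ∀ c, (makespanLP O A B).lhs c ⬝ᵥ d = 0 := fun c => congrFun hd c
  have hleg : ∀ u i, d (.inr u) = 0 ∧ lpConf d u.succ i = lpConf d u.castSucc i := by
    intro u i
    have e : ∀ b b', _ = _ := fun b b' =>
      (makespanLP_lhs_leg O A B d u i b b').symm.trans (h' (.inl (u, i, b, b')))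
    have e1 := e false false
    have e2 := e false true
    have e3 := e true false
    have e4 := e true true
    simp only [sgn, if_true, Bool.false_eq_true, if_false, Prod.fst_sub,
      Prod.snd_sub] at e1 e2 e3 e4
    exact ⟨by linarith, Prod.ext (by linarith) (by linarith)⟩
  have h0 : ∀ i, lpConf d 0 i = 0 := by
    intro i
    have e : ∀ q, d (.inl (0, i, q)) = 0 := fun q => by
      have := (makespanLP_lhs_end O A B d false i q false).symm.trans (h' _)
      simpa [sgn] using this
    exact Prod.ext (e false) (e true)
  have hall : ∀ (w : Fin (n + 2)) i, lpConf d w i = 0 := by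
    intro w i
    induction w using Fin.induction with
    | zero => exact h0 i
    | succ u ih => rw [(hleg u i).2, ih]
  funext v
  rcases v with ⟨w, i, b⟩ | u
  · have := hall w i
    cases b
    · exact congrArg Prod.fst this
    · exact congrArg Prod.snd this
  · exact (hleg u ⟨0, hk⟩).1

theorem makespanLP_exists_optimal (hk : 0 < k) {O : Fin (n + 1) → Ordering k} {A B : Pos k}
    {x : LPVar k n → ℝ} (hx : (makespanLP O A B).Feasible x) :
    ∃ y, (makespanLP O A B).Optimal y ∧ (makespanLP O A B).IsVertex y :=
  hx.exists_optimal_isVertex (makespanLP_no_line hk O A B) fun _ => makespanLP_obj_nonneg hk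

/-- The configurations of a point of the linear program, indexed by natural numbers. -/
def lpPath (x : LPVar k n → ℝ) (u : ℕ) : Pos k := lpConf x (Fin.ofNat (n + 2) (min u (n + 1)))

/-- The durations of a point of the linear program, indexed by natural numbers. -/
def lpDur (x : LPVar k n → ℝ) (u : ℕ) : ℝ := x (.inr (Fin.ofNat (n + 1) u))

theorem lpPath_val (x : LPVar k n → ℝ) (w : Fin (n + 2)) : lpPath x w = lpConf x w := by
  have : min (w : ℕ) (n + 1) = w := min_eq_left (by omega)
  rw [lpPath, this]
  congr 1
  ext
  simp

theorem lpDur_val (x : LPVar k n → ℝ) (u : Fin (n + 1)) : lpDur x u = x (.inr u) := by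
  rw [lpDur]
  congr 2
  ext
  simp

theorem arrival_lpDur (x : LPVar k n → ℝ) :
    arrival (lpDur x) (n + 1) = ∑ u, x (Sum.inr u) := by
  rw [arrival, ← Fin.sum_univ_eq_sum_range]
  exact Finset.sum_congr rfl fun u _ => lpDur_val x u

theorem isPath_of_feasible (hk : 0 < k) {O : Fin (n + 1) → Ordering k} {A B : Pos k}
    {x : LPVar k n → ℝ} (hx : (makespanLP O A B).Feasible x) :
    IsPath (n + 1) (lpPath x) (lpDur x) := by
  obtain ⟨h1, h2, -, -⟩ := makespanLP_feasible_iff.1 hx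
  have hm : ∀ u < n + 1, ∀ i, l1 (lpPath x (u + 1) i - lpPath x u i) ≤ lpDur x u := by
    intro u hu i
    have := h1 ⟨u, hu⟩ i
    rw [← lpPath_val, ← lpPath_val, ← lpDur_val x ⟨u, hu⟩] at this
    exact this
  refine ⟨fun u hu => (l1_nonneg _).trans (hm u hu ⟨0, hk⟩), hm, fun u hu => ⟨O ⟨u, hu⟩, ?_⟩⟩
  have := h2 ⟨u, hu⟩
  rw [← lpPath_val, ← lpPath_val] at this
  exact this

/-- Robots move straight, with the durations of the point. Convexity keeps each leg in its ordering,
and the `L₁`-speeds are at most `1` because a duration dominates every displacement of its leg. -/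
theorem exists_schedule_of_feasible (hk : 0 < k) {O : Fin (n + 1) → Ordering k} {A B : Pos k}
    {x : LPVar k n → ℝ} (hx : (makespanLP O A B).Feasible x) :
    ∃ M, IsSchedule A B 0 ((makespanLP O A B).obj ⬝ᵥ x) M ∧
      Obeys O 0 ((makespanLP O A B).obj ⬝ᵥ x) M := by
  obtain ⟨h1, h2, h3, h4⟩ := makespanLP_feasible_iff.1 hx
  obtain ⟨M, hM, -, -, hO⟩ := (isPath_of_feasible hk hx).exists_schedule
  have e0 : lpPath x 0 = A := (lpPath_val x 0).trans h3
  have e1 : lpPath x (n + 1) = B := (lpPath_val x (Fin.last (n + 1))).trans h4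
  rw [obj_dotProduct, ← arrival_lpDur]
  rw [e0, e1] at hM
  refine ⟨M, hM, fun w => arrival (lpDur x) w, ?_, by simp [arrival_zero], by simp, ?_⟩
  · refine Fin.monotone_iff_le_succ.2 fun u => ?_
    simp only [Fin.val_castSucc, Fin.val_succ, arrival_succ]
    linarith [(isPath_of_feasible hk hx).nonneg u u.2]
  · intro u t ht
    refine hO u u.2 (O u) ?_ ?_ t (by simpa using ht)
    · have := (h2 u).1
      rwa [← lpPath_val] at this
    · have := (h2 u).2
      rwa [← lpPath_val] at this

theorem sum_succ_sub_castSucc (τ : Fin (n + 2) → ℝ) :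
    ∑ u : Fin (n + 1), (τ u.succ - τ u.castSucc) = τ (Fin.last (n + 1)) - τ 0 := by
  rw [Finset.sum_sub_distrib]
  linarith [Fin.sum_univ_succ τ, Fin.sum_univ_castSucc τ]

/-- Configurations of a schedule at increasing times, successive ones in a common ordering, are a
feasible point of the linear program. -/
theorem IsSchedule.feasible_lpPoint {A B : Pos k} {t₀ t₁ : ℝ} {M : Fin k → ℝ → Pt}
    (hM : IsSchedule A B t₀ t₁ M) {O : Fin (n + 1) → Ordering k} {τ : Fin (n + 2) → ℝ}
    (hτ : Monotone τ) (h0 : τ 0 = t₀) (h1 : τ (Fin.last (n + 1)) = t₁)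
    (hO : ∀ u : Fin (n + 1), (fun i => M i (τ u.castSucc)) ∈ (O u).confs ∧
      (fun i => M i (τ u.succ)) ∈ (O u).confs) :
    ∃ x, (makespanLP O A B).Feasible x ∧ (makespanLP O A B).obj ⬝ᵥ x = t₁ - t₀ := by
  refine ⟨lpPoint (fun w i => M i (τ w)) fun u => τ u.succ - τ u.castSucc, ?_, ?_⟩
  · have hmem : ∀ w, τ w ∈ Set.Icc t₀ t₁ := fun w =>
      ⟨h0 ▸ hτ (Fin.zero_le w), h1 ▸ hτ (Fin.le_last w)⟩
    rw [makespanLP_feasible_iff]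
    simp only [lpConf_lpPoint]
    refine ⟨fun u i => ?_, hO, ?_, ?_⟩
    · refine ((hM.traj i).metric _ (hmem u.succ) _ (hmem u.castSucc)).trans ?_
      rw [abs_of_nonneg (sub_nonneg.2 (hτ u.castSucc_le_succ))]
      exact le_rfl
    · funext i
      rw [h0, (hM.traj i).start]
    · funext i
      rw [h1, (hM.traj i).target]
  · rw [obj_dotProduct, ← h0, ← h1, ← sum_succ_sub_castSucc]
    rfl

theorem exists_feasible_of_obeys {O : Fin (n + 1) → Ordering k} {A B : Pos k} {t₀ t₁ : ℝ}
    {M : Fin k → ℝ → Pt} (hM : IsSchedule A B t₀ t₁ M) (hO : Obeys O t₀ t₁ M) :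
    ∃ x, (makespanLP O A B).Feasible x ∧ (makespanLP O A B).obj ⬝ᵥ x = t₁ - t₀ := by
  obtain ⟨τ, hτ, h0, h1, h⟩ := hO
  exact hM.feasible_lpPoint hτ h0 h1 fun u =>
    ⟨h u _ ⟨le_rfl, hτ u.castSucc_le_succ⟩, h u _ ⟨hτ u.castSucc_le_succ, le_rfl⟩⟩

theorem isLeast_of_optimal (hk : 0 < k) {O : Fin (n + 1) → Ordering k} {A B : Pos k}
    {x : LPVar k n → ℝ} (hx : (makespanLP O A B).Optimal x) :
    IsLeast {L : ℝ | ∃ t₀ t₁ M, IsSchedule A B t₀ t₁ M ∧ Obeys O t₀ t₁ M ∧ t₁ - t₀ = L}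
      ((makespanLP O A B).obj ⬝ᵥ x) := by
  constructor
  · obtain ⟨M, h1, h2⟩ := exists_schedule_of_feasible hk hx.1
    exact ⟨_, _, M, h1, h2, sub_zero _⟩
  · rintro L ⟨t₀, t₁, M, h1, h2, rfl⟩
    obtain ⟨y, hy, hyo⟩ := exists_feasible_of_obeys h1 h2
    rw [← hyo]
    exact hx.2 y hy

/-! ### Numbers of variables and constraints -/

theorem card_robotPair (k : ℕ) : Fintype.card (RobotPair k) = k.choose 2 := by
  rw [Fintype.card_subtype, Fintype.card_product_filter_lt, Fintype.card_fin]

theorem card_lpVar (k n : ℕ) : Fintype.card (LPVar k n) = 2 * k * (n + 2) + (n + 1) := by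
  simp only [LPVar, Fintype.card_sum, Fintype.card_prod, Fintype.card_fin, Fintype.card_bool]
  ring

theorem card_lpCon (k n : ℕ) : Fintype.card (LPCon k n) =
    4 * k * (n + 1) + 2 * k.choose 2 * (n + 1) + 8 * k := by
  simp only [LPCon, Fintype.card_sum, Fintype.card_prod, Fintype.card_fin, Fintype.card_bool,
    card_robotPair]
  ring

end MakespanLP

/-! ### Existence of schedules -/

section Existence

variable {k : ℕ}

/-- Two configurations that belong to a common ordering. -/
def ShareOrdering (P Q : Pos k) : Prop := ∃ O : Ordering k, P ∈ O.confs ∧ Q ∈ O.confs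

theorem ShareOrdering.symm {P Q : Pos k} (h : ShareOrdering P Q) : ShareOrdering Q P :=
  h.imp fun _ h => h.symm

theorem shareOrdering_iff {P Q : Pos k} : ShareOrdering P Q ↔
    ∀ i j, i < j → ∃ d : Dir, d.Holds (P i) (P j) ∧ d.Holds (Q i) (Q j) := by
  constructor
  · rintro ⟨O, h1, h2⟩ i j hij
    exact ⟨O ⟨(i, j), hij⟩, mem_confs_iff.1 h1 ⟨(i, j), hij⟩, mem_confs_iff.1 h2 ⟨(i, j), hij⟩⟩
  · intro h
    choose O hO using fun e : RobotPair k => h e.1.1 e.1.2 e.2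
    exact ⟨O, mem_confs_iff.2 fun e => (hO e).1, mem_confs_iff.2 fun e => (hO e).2⟩

/-- Every configuration is connected with the configuration of a column of robots, by three legs. -/
theorem exists_legs_to_column {A : Pos k} (hA : A ∈ confSpace k) :
    ∃ S U : Pos k, ShareOrdering A S ∧ ShareOrdering S U ∧
      ShareOrdering U fun i => (0, 2 * (i : ℝ)) := by
  -- Robots are ranked by their `x`-coordinates. Replacing these coordinates by the ranks preserves
  -- all left-right relations (`hrank`) and separates any two robots horizontally (`hne`). Then the
  -- `y`-coordinates may be changed to `2 * i` arbitrarily, and these in turn allow the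
  -- `x`-coordinates to become `0`.
  set σ := Tuple.sort fun i => (A i).1 with hσ
  have hmono : Monotone ((fun i => (A i).1) ∘ σ) := Tuple.monotone_sort _
  have hrank : ∀ i j, (A i).1 + 1 ≤ (A j).1 → ((σ.symm i : ℕ) : ℝ) + 1 ≤ (σ.symm j : ℕ) := by
    intro i j hij
    have : σ.symm i < σ.symm j := by
      by_contra! hle
      have := hmono hle
      simp only [Function.comp_apply, Equiv.apply_symm_apply] at this
      linarith
    exact_mod_cast this
  have hne : ∀ i j, i < j → ((σ.symm i : ℕ) : ℝ) + 1 ≤ (σ.symm j : ℕ) ∨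
      ((σ.symm j : ℕ) : ℝ) + 1 ≤ (σ.symm i : ℕ) := by
    intro i j hij
    rcases lt_or_gt_of_ne (σ.symm.injective.ne hij.ne) with h | h
    · exact Or.inl (by exact_mod_cast h)
    · exact Or.inr (by exact_mod_cast h)
  refine ⟨fun i => ((σ.symm i : ℕ), (A i).2), fun i => ((σ.symm i : ℕ), 2 * (i : ℝ)), ?_, ?_,
    ?_⟩ <;>
    rw [shareOrdering_iff] <;> intro i j hij
  · obtain ⟨d, hd⟩ := exists_holds_of_one_le_linf (hA i j hij.ne)
    refine ⟨d, hd, ?_⟩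
    cases d
    · exact hrank j i hd
    · exact hrank i j hd
    · exact hd
    · exact hd
  · rcases hne i j hij with h | h
    · exact ⟨.left, h, h⟩
    · exact ⟨.right, h, h⟩
  · have : (i : ℝ) + 1 ≤ (j : ℝ) := by exact_mod_cast hij
    exact ⟨.down, by simp only [Dir.Holds]; linarith, by simp only [Dir.Holds]; linarith⟩

/-- Both configurations lead to the same column, and the second path is run backwards. The sum of
all displacements is a crude but sufficient duration of a leg. -/
theorem exists_schedule {A B : Pos k} (hA : A ∈ confSpace k) (hB : B ∈ confSpace k) :
    ∃ t₀ t₁ M, IsSchedule A B t₀ t₁ M := by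
  obtain ⟨S, U, a1, a2, a3⟩ := exists_legs_to_column hA
  obtain ⟨S', U', b1, b2, b3⟩ := exists_legs_to_column hB
  let I : ℕ → Pos k := fun u => match u with
    | 0 => A
    | 1 => S
    | 2 => U
    | 3 => fun i => (0, 2 * (i : ℝ))
    | 4 => U'
    | 5 => S'
    | _ => B
  have hI : IsPath 6 I fun u => ∑ i, l1 (I (u + 1) i - I u i) := by
    refine ⟨fun u _ => Finset.sum_nonneg fun i _ => l1_nonneg _, fun u _ i =>
      Finset.single_le_sum (f := fun i => l1 (I (u + 1) i - I u i)) (fun i _ => l1_nonneg _)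
        (Finset.mem_univ i), fun u hu => ?_⟩
    interval_cases u
    · exact a1
    · exact a2
    · exact a3
    · exact b3.symm
    · exact b2.symm
    · exact b1.symm
  obtain ⟨M, hM, -⟩ := hI.exists_schedule
  exact ⟨_, _, M, hM⟩

end Existence

/-! ### Simple paths of orderings -/

section SimplePath

variable {k : ℕ}

theorem not_holds_opp {d : Dir} {p q : Pt} (h : d.Holds p q) : ¬ d.opp.Holds p q := by
  cases d <;> simp only [Dir.opp, Dir.Holds] at * <;> linarith

/-- Opposite relations exclude each other, so they cannot both hold in a common configuration. The
edges of the simple path arise in this way. -/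
theorem transitionGraph_adj_of_mem {O₁ O₂ : Ordering k} {P : Pos k} (h₁ : P ∈ O₁.confs)
    (h₂ : P ∈ O₂.confs) (hne : O₁ ≠ O₂) : (transitionGraph k).Adj O₁ O₂ := by
  refine ⟨hne, fun e he => not_holds_opp (mem_confs_iff.1 h₁ e) ?_⟩
  rw [← he]
  exact mem_confs_iff.1 h₂ e

theorem isClosed_confs (O : Ordering k) : IsClosed O.confs := by
  have : O.confs = ⋂ e : RobotPair k, {P | (O e).Holds (P e.1.1) (P e.1.2)} := by
    ext P
    simp [mem_confs_iff]
  rw [this]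
  refine isClosed_iInter fun e => ?_
  cases O e <;> simp only [Dir.Holds] <;> exact isClosed_le (by fun_prop) (by fun_prop)

theorem norm_le_l1 (p : Pt) : ‖p‖ ≤ l1 p := by
  rw [Prod.norm_def, l1, Real.norm_eq_abs, Real.norm_eq_abs]
  exact max_le (by linarith [abs_nonneg p.2]) (by linarith [abs_nonneg p.1])

theorem IsSchedule.continuousOn {A B : Pos k} {t₀ t₁ : ℝ} {M : Fin k → ℝ → Pt}
    (hM : IsSchedule A B t₀ t₁ M) :
    ContinuousOn (fun t => fun i => M i t) (Set.Icc t₀ t₁) := by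
  refine continuousOn_pi.2 fun i => ?_
  refine LipschitzOnWith.continuousOn (K := 1) (LipschitzOnWith.of_dist_le_mul fun s hs t ht => ?_)
  rw [dist_eq_norm, Real.dist_eq, NNReal.coe_one, one_mul]
  exact (norm_le_l1 _).trans ((hM.traj i).metric s hs t ht)

instance : Finite Dir := Finite.of_injective
  (fun d : Dir => match d with | .right => (0 : Fin 4) | .left => 1 | .up => 2 | .down => 3)
  (by intro a b; cases a <;> cases b <;> simp)

/-- At every time before the end, a schedule belongs to an ordering outside any set of orderings
that are not visited later. -/
theorem IsSchedule.exists_mem_confs_notMem {A B : Pos k} {t₀ t₁ : ℝ} {M : Fin k → ℝ → Pt}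
    (hM : IsSchedule A B t₀ t₁ M) (U : Set (Ordering k)) {t : ℝ} (ht : t ∈ Set.Ico t₀ t₁)
    (hU : ∀ O ∈ U, ∀ s ∈ Set.Ioc t t₁, (fun i => M i s) ∉ O.confs) :
    ∃ O : Ordering k, O ∉ U ∧ (fun i => M i t) ∈ O.confs := by
  by_contra! hall
  -- Suppose that no ordering outside `U` contains the configuration at time `t`. By closedness and
  -- continuity none of them does immediately after `t`, and those in `U` are excluded there by
  -- assumption. But every configuration belongs to some ordering.
  have hev : ∀ O : Ordering k, ∀ᶠ s in nhdsWithin t (Set.Ioc t t₁), (fun i => M i s) ∉ O.confs := by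
    intro O
    by_cases hO : O ∈ U
    · exact eventually_nhdsWithin_of_forall (hU O hO)
    · have hc : ContinuousWithinAt (fun s => fun i => M i s) (Set.Ioc t t₁) t :=
        (hM.continuousOn t ⟨ht.1, ht.2.le⟩).mono fun s hs => ⟨ht.1.trans hs.1.le, hs.2⟩
      exact hc.eventually ((isClosed_confs O).isOpen_compl.mem_nhds (hall O hO))
  have hne : (nhdsWithin t (Set.Ioc t t₁)).NeBot := by
    rw [nhdsWithin_Ioc_eq_nhdsGT ht.2]
    infer_instance
  obtain ⟨s, hs, hst⟩ := ((Filter.eventually_all.2 hev).and self_mem_nhdsWithin).exists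
  obtain ⟨O, hO⟩ := exists_mem_confs (hM.feasible s ⟨ht.1.trans hst.1.le, hst.2⟩)
  exact hs O hO

/-- A simple path of orderings that a schedule follows from time `t` on, cut at the last times at
which it belongs to the orderings. -/
theorem IsSchedule.exists_simplePath_from {A B : Pos k} {t₀ t₁ : ℝ} {M : Fin k → ℝ → Pt}
    (hM : IsSchedule A B t₀ t₁ M) {t : ℝ} (ht : t ∈ Set.Icc t₀ t₁) (U : Set (Ordering k))
    (hU : ∀ O ∈ U, ∀ s ∈ Set.Ioc t t₁, (fun i => M i s) ∉ O.confs) {O : Ordering k} (hOU : O ∉ U)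
    (hO : (fun i => M i t) ∈ O.confs) :
    ∃ (n : ℕ) (Os : Fin (n + 1) → Ordering k) (τ : Fin (n + 2) → ℝ),
      Os 0 = O ∧ τ 0 = t ∧ τ (Fin.last (n + 1)) = t₁ ∧ Monotone τ ∧
      (∀ u : Fin (n + 1), (fun i => M i (τ u.castSucc)) ∈ (Os u).confs ∧
        (fun i => M i (τ u.succ)) ∈ (Os u).confs) ∧
      (∀ u, Os u ∉ U) ∧ IsSimplePath Os := by
  classical
  -- `U` collects the orderings that have been used up; it grows with every step, so the recursion
  -- ends.
  induction hm : Uᶜ.ncard using Nat.strong_induction_on generalizing t U O with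
  | _ m ih =>
  have hclosed : IsClosed {s ∈ Set.Icc t t₁ | (fun i => M i s) ∈ O.confs} :=
    (hM.continuousOn.mono (Set.Icc_subset_Icc_left ht.1)).preimage_isClosed_of_isClosed
      isClosed_Icc (isClosed_confs O)
  have hcomp : IsCompact {s ∈ Set.Icc t t₁ | (fun i => M i s) ∈ O.confs} :=
    isCompact_Icc.of_isClosed_subset hclosed fun s hs => hs.1
  -- `r` is the last time at which the schedule belongs to `O`. In between it may leave `O`, but
  -- only the configurations at `t` and `r` are used. After `r` the ordering `O` never recurs and
  -- can be added to `U`.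
  obtain ⟨r, ⟨⟨htr, hrt⟩, hr⟩, hmax⟩ := hcomp.exists_isGreatest ⟨t, ⟨le_rfl, ht.2⟩, hO⟩
  rcases hrt.eq_or_lt with rfl | hlt
  · refine ⟨0, ![O], ![t, r], rfl, rfl, rfl, ?_, ?_, ?_, ?_, ?_⟩
    · refine Fin.monotone_iff_le_succ.2 fun u => ?_
      fin_cases u
      simpa using htr
    · intro u
      fin_cases u
      exact ⟨hO, hr⟩
    · intro u
      fin_cases u
      exact hOU
    · intro a b _
      exact Subsingleton.elim (α := Fin 1) a b
    · exact fun u => u.elim0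
  · have hU' : ∀ O' ∈ insert O U, ∀ s ∈ Set.Ioc r t₁, (fun i => M i s) ∉ O'.confs := by
      rintro O' (rfl | hO') s hs hmem
      · exact absurd (hmax ⟨⟨htr.trans hs.1.le, hs.2⟩, hmem⟩) (not_le.2 hs.1)
      · exact hU O' hO' s ⟨htr.trans_lt hs.1, hs.2⟩ hmem
    obtain ⟨O₂, hO₂U, hO₂⟩ := hM.exists_mem_confs_notMem _ ⟨ht.1.trans htr, hlt⟩ hU'
    have hcard : (insert O U)ᶜ.ncard < m := by
      rw [← hm]
      refine Set.ncard_lt_ncard ⟨Set.compl_subset_compl.2 (Set.subset_insert _ _), fun h => ?_⟩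
        (Set.toFinite _)
      exact h hOU (Set.mem_insert _ _)
    obtain ⟨n, Os, τ, h1, h2, h3, h4, h5, h6, h7⟩ :=
      ih _ hcard ⟨ht.1.trans htr, hlt.le⟩ _ hU' hO₂U hO₂ rfl
    refine ⟨n + 1, Fin.cons O Os, Fin.cons t τ, rfl, rfl, ?_, ?_, ?_, ?_, ?_, ?_⟩
    · rw [← Fin.succ_last, Fin.cons_succ, h3]
    · refine Fin.monotone_iff_le_succ.2 fun u => ?_
      induction u using Fin.cases with
      | zero => simpa [h2] using htr
      | succ u =>
        rw [← Fin.succ_castSucc, Fin.cons_succ, Fin.cons_succ]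
        exact h4 u.castSucc_le_succ
    · intro u
      induction u using Fin.cases with
      | zero =>
        simp only [Fin.castSucc_zero, Fin.cons_zero, Fin.cons_succ, h2]
        exact ⟨hO, hr⟩
      | succ u =>
        rw [← Fin.succ_castSucc]
        simp only [Fin.cons_succ]
        exact h5 u
    · intro u
      induction u using Fin.cases with
      | zero => exact hOU
      | succ u =>
        rw [Fin.cons_succ]
        exact fun h => h6 u (Set.mem_insert_of_mem _ h)
    · refine Fin.cons_injective_iff.2 ⟨?_, h7.1⟩
      rintro ⟨u, hu⟩
      exact h6 u (hu ▸ Set.mem_insert _ _)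
    · intro u
      induction u using Fin.cases with
      | zero =>
        simp only [Fin.castSucc_zero, Fin.cons_zero, Fin.cons_succ, h1]
        refine transitionGraph_adj_of_mem hr hO₂ ?_
        rintro rfl
        exact hO₂U (Set.mem_insert _ _)
      | succ u =>
        rw [← Fin.succ_castSucc]
        simp only [Fin.cons_succ]
        exact h7.2 u

/-- The schedule itself need not obey the simple path. Its configurations at the cut times suffice
for a feasible point with the same total duration. -/
theorem IsSchedule.exists_simplePath {A B : Pos k} {t₀ t₁ : ℝ} {M : Fin k → ℝ → Pt}
    (hM : IsSchedule A B t₀ t₁ M) :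
    ∃ (n : ℕ) (O : Fin (n + 1) → Ordering k), IsSimplePath O ∧
      ∃ x, (makespanLP O A B).Feasible x ∧ (makespanLP O A B).obj ⬝ᵥ x = t₁ - t₀ := by
  have ht : t₀ ∈ Set.Icc t₀ t₁ := ⟨le_rfl, hM.le⟩
  obtain ⟨O, hO⟩ := exists_mem_confs (hM.feasible t₀ ht)
  obtain ⟨n, Os, τ, -, h2, h3, h4, h5, -, h7⟩ :=
    hM.exists_simplePath_from ht ∅ (by simp) (Set.notMem_empty O) hO
  exact ⟨n, Os, h7, hM.feasible_lpPoint h4 h2 h3 h5⟩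

/-! ### Optimal schedules along simple paths -/

theorem IsSimplePath.lt_card {n : ℕ} {O : Fin (n + 1) → Ordering k} (hO : IsSimplePath O) :
    n < Nat.card (Ordering k) := by
  have := Nat.card_le_card_of_injective O hO.1
  rw [Nat.card_eq_fintype_card, Fintype.card_fin] at this
  omega

/-- The smallest makespan is the optimal value of the linear program of some simple path. -/
theorem exists_simplePath_isMinMakespan (hk : 0 < k) {A B : Pos k} (hA : A ∈ confSpace k)
    (hB : B ∈ confSpace k) :
    ∃ (n : ℕ) (O : Fin (n + 1) → Ordering k) (x : LPVar k n → ℝ), IsSimplePath O ∧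
      (makespanLP O A B).Feasible x ∧ IsMinMakespan A B ((makespanLP O A B).obj ⬝ᵥ x) := by
  -- The simple paths with a feasible program. This type is finite because injectivity bounds the
  -- length of a simple path by the number of orderings.
  let S : Type := {p : Σ n : Fin (Nat.card (Ordering k)), (Fin ((n : ℕ) + 1) → Ordering k) //
    IsSimplePath p.2 ∧ ∃ x, (makespanLP p.2 A B).Feasible x}
  have hopt : ∀ p : S, ∃ x, (makespanLP p.1.2 A B).Optimal x := fun p => by
    obtain ⟨x, hx⟩ := p.2.2
    obtain ⟨y, hy, -⟩ := makespanLP_exists_optimal hk hx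
    exact ⟨y, hy⟩
  choose X hX using hopt
  have hS : ∀ t₀ t₁ M, IsSchedule A B t₀ t₁ M →
      ∃ p : S, (makespanLP p.1.2 A B).obj ⬝ᵥ X p ≤ t₁ - t₀ := by
    intro t₀ t₁ M hM
    obtain ⟨n, O, hO, x, hx, hxo⟩ := hM.exists_simplePath
    refine ⟨⟨⟨⟨n, hO.lt_card⟩, O⟩, hO, x, hx⟩, ?_⟩
    rw [← hxo]
    exact (hX ⟨⟨⟨n, hO.lt_card⟩, O⟩, hO, x, hx⟩).2 x hx
  obtain ⟨t₀, t₁, M, hM⟩ := exists_schedule hA hB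
  have : Nonempty S := ⟨(hS t₀ t₁ M hM).choose⟩
  obtain ⟨p, hp⟩ := Finite.exists_min fun p : S => (makespanLP p.1.2 A B).obj ⬝ᵥ X p
  refine ⟨_, p.1.2, X p, p.2.1, (hX p).1, ?_, ?_⟩
  · obtain ⟨M, hM, -⟩ := exists_schedule_of_feasible hk (hX p).1
    exact ⟨_, _, M, hM, by rw [sub_zero]⟩
  · rintro L ⟨s₀, s₁, M', hM', hL⟩
    obtain ⟨q, hq⟩ := hS _ _ _ hM'
    exact (hp q).trans (hq.trans hL)

theorem exists_simplePath_schedule (k : ℕ) (A B : Pos k) (hA : A ∈ confSpace k)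
    (hB : B ∈ confSpace k) :
    ∃ (n : ℕ) (O : Fin (n + 1) → Ordering k) (t₀ t₁ : ℝ) (M : Fin k → ℝ → Pt),
      IsSimplePath O ∧ IsSchedule A B t₀ t₁ M ∧ Obeys O t₀ t₁ M ∧
        IsMinMakespan A B (t₁ - t₀) := by
  rcases Nat.eq_zero_or_pos k with rfl | hk
  -- Without robots the linear program leaves the durations unconstrained, so this case is treated
  -- directly.
  · have hs : IsSchedule A B 0 0 fun i => i.elim0 :=
      ⟨le_rfl, fun i => i.elim0, fun _ _ i => i.elim0⟩
    refine ⟨0, fun _ e => e.1.1.elim0, 0, 0, fun i => i.elim0, ⟨fun a b _ => ?_, fun u => u.elim0⟩,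
      hs, ⟨fun _ => 0, monotone_const, rfl, rfl, fun _ _ _ => mem_confs_iff.2 fun e => e.1.1.elim0⟩,
      ⟨0, 0, _, hs, le_rfl⟩, ?_⟩
    · exact Subsingleton.elim (α := Fin 1) a b
    · rintro L ⟨s₀, s₁, M', hM', hL⟩
      linarith [hM'.le]
  · obtain ⟨n, O, x, hO, hx, hmin⟩ := exists_simplePath_isMinMakespan hk hA hB
    obtain ⟨M, hM, hMO⟩ := exists_schedule_of_feasible hk hx
    exact ⟨n, O, 0, _, M, hO, hM, hMO, by rwa [sub_zero]⟩

/-- If a schedule obeys a sequence of orderings, then also the sequence that repeats the last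
ordering. -/
theorem Obeys.pad {n N : ℕ} (hN : n ≤ N) {O : Fin (n + 1) → Ordering k} {t₀ t₁ : ℝ}
    {M : Fin k → ℝ → Pt} (h : Obeys O t₀ t₁ M) :
    Obeys (fun u : Fin (N + 1) => O ⟨min u n, by omega⟩) t₀ t₁ M := by
  obtain ⟨τ, hτ, h0, h1, h2⟩ := h
  refine ⟨fun w => τ ⟨min w (n + 1), by omega⟩, fun a b hab => hτ ?_, ?_, ?_, fun u t ht => ?_⟩
  · simp only [Fin.mk_le_mk]
    exact min_le_min_right _ hab
  · simpa using h0
  · rw [← h1]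
    refine congrArg τ (Fin.ext ?_)
    simp only [Fin.val_last]
    omega
  · simp only [Fin.val_castSucc, Fin.val_succ] at ht
    refine h2 _ t ?_
    rcases le_or_gt (u : ℕ) n with hu | hu
    · convert ht using 3 <;> ext <;> simp <;> omega
    -- The added intervals have length zero: both ends are the final time, which belongs to the last
    -- of the original intervals.
    · have e1 : min (u : ℕ) (n + 1) = n + 1 := by omega
      have e2 : min ((u : ℕ) + 1) (n + 1) = n + 1 := by omega
      have e3 : min (u : ℕ) n = n := by omega
      simp only [e1, e2] at ht
      simp only [e3]
      exact ⟨(hτ (Fin.mk_le_mk.2 (Nat.le_succ n))).trans ht.1, ht.2⟩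

/-- The smallest makespan is attained at a vertex of the linear program of some sequence of
orderings of any prescribed length that is large enough. -/
theorem exists_isVertex_isMinMakespan (hk : 0 < k) {N : ℕ} (hN : Nat.card (Ordering k) ≤ N + 1)
    {A B : Pos k} (hA : A ∈ confSpace k) (hB : B ∈ confSpace k) :
    ∃ (O : Fin (N + 1) → Ordering k) (x : LPVar k N → ℝ), (makespanLP O A B).IsVertex x ∧
      IsMinMakespan A B ((makespanLP O A B).obj ⬝ᵥ x) := by
  obtain ⟨n, O, y, hO, hy, hmin⟩ := exists_simplePath_isMinMakespan hk hA hB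
  obtain ⟨M, hM, hMO⟩ := exists_schedule_of_feasible hk hy
  -- The search needs one number of legs for all instances with `k` robots; repeating the last
  -- ordering takes no time.
  have hMO' := hMO.pad (show n ≤ N by have := hO.lt_card; omega)
  obtain ⟨z, hz, hzo⟩ := exists_feasible_of_obeys hM hMO'
  obtain ⟨x, hx, hxv⟩ := makespanLP_exists_optimal hk hz
  refine ⟨_, x, hxv, ?_⟩
  have hle := hx.2 z hz
  rw [hzo, sub_zero] at hle
  obtain ⟨M', hM', -⟩ := exists_schedule_of_feasible hk hx.1
  have hge := hmin.2 ⟨_, _, M', hM', le_rfl⟩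
  rw [sub_zero] at hge
  rwa [le_antisymm hle hge]

end SimplePath

/-! ### Vertices as bounded combinations of the input coordinates -/

section Lattice

theorem abs_det_le {V : Type} [Fintype V] [DecidableEq V] {Z : Matrix V V ℤ} {b : ℤ}
    (hZ : ∀ i j, |Z i j| ≤ b) :
    |Z.det| ≤ (Fintype.card V).factorial * b ^ Fintype.card V := by
  have := Matrix.det_le (A := Z) (abv := AbsoluteValue.abs) (x := b) hZ
  simpa using this

/-- An entry of the adjugate is the determinant of the matrix with one row replaced by a unit
vector, whose entries respect the bound since `1 ≤ b`. -/
theorem abs_adjugate_le {V : Type} [Fintype V] [DecidableEq V] {Z : Matrix V V ℤ} {b : ℤ}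
    (hb : 1 ≤ b) (hZ : ∀ i j, |Z i j| ≤ b) (i j : V) :
    |Z.adjugate i j| ≤ (Fintype.card V).factorial * b ^ Fintype.card V := by
  rw [Matrix.adjugate_apply]
  refine abs_det_le fun r s => ?_
  rw [Matrix.updateRow_apply]
  split_ifs
  · rw [Pi.single_apply]
    split_ifs <;> simp <;> omega
  · exact hZ r s

/-- Cramer's rule for the vertices of a linear program with integer matrix whose right-hand sides
are integer multiples of given parameters. -/
theorem LinearProgram.IsVertex.exists_combination {V C : Type} [Fintype V] [DecidableEq V]
    {P : LinearProgram V C} {x : V → ℝ} (hx : P.IsVertex x) {Z : Matrix C V ℤ} {b : ℤ} (hb : 1 ≤ b)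
    (hZ : ∀ c v, P.lhs c v = Z c v ∧ |Z c v| ≤ b) {J : ℕ} {θ : ℕ → ℝ} {ζ : C → ℤ} {jx : C → ℕ}
    (hζ : ∀ c, P.rhs c = ζ c * θ (jx c) ∧ |ζ c| ≤ 1 ∧ jx c < J) {Q E : ℕ}
    (hQ : (Fintype.card V : ℤ) * ((Fintype.card V).factorial * b ^ Fintype.card V) ≤ Q)
    (hE : ∀ q, 0 < q → q ≤ Q → q ∣ E) (v : V) :
    ∃ c : ℕ → ℤ, (∀ j, |c j| ≤ E * Q) ∧
      (E : ℝ) * x v = ∑ j ∈ Finset.range J, (c j : ℝ) * θ j := by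
  obtain ⟨g, hg, hdet⟩ := hx.exists_det_ne_zero
  set Y : Matrix V V ℤ := Z.submatrix g id with hY
  set bd : ℤ := (Fintype.card V).factorial * b ^ Fintype.card V with hbd
  have hbd0 : 0 ≤ bd := by positivity
  have hcard : (1 : ℤ) ≤ Fintype.card V := by
    have : 0 < Fintype.card V := Fintype.card_pos_iff.2 ⟨v⟩
    exact_mod_cast this
  have hmap : P.lhs.submatrix g id = Y.map (Int.cast : ℤ → ℝ) := by
    ext r s
    exact (hZ (g r) s).1
  have hYb : ∀ i j, |Y i j| ≤ b := fun i j => (hZ (g i) j).2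
  have hdetY : (P.lhs.submatrix g id).det = (Y.det : ℝ) := by
    rw [hmap]
    exact (Int.cast_det Y).symm
  have hY0 : Y.det ≠ 0 := by
    intro h
    rw [hdetY, h] at hdet
    simp at hdet
  -- Cramer's rule without division: the square system of tight rows is multiplied by its adjugate.
  have hsolve : (Y.det : ℝ) * x v = ∑ w, (Y.adjugate v w : ℝ) * P.rhs (g w) := by
    have h1 : (P.lhs.submatrix g id) *ᵥ x = fun w => P.rhs (g w) := funext hg
    have h2 : (P.lhs.submatrix g id).adjugate *ᵥ (fun w => P.rhs (g w)) =
        (P.lhs.submatrix g id).det • x := by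
      rw [← h1, Matrix.mulVec_mulVec, Matrix.adjugate_mul, Matrix.smul_mulVec, Matrix.one_mulVec]
    have h3 := congrFun h2 v
    have h4 : (P.lhs.submatrix g id).adjugate = Y.adjugate.map (Int.cast : ℤ → ℝ) := by
      rw [hmap]
      exact ((Int.castRingHom ℝ).map_adjugate Y).symm
    rw [hdetY, h4] at h3
    simpa [Matrix.mulVec, dotProduct] using h3.symm
  -- The determinant depends on the vertex, but its absolute value is at most `Q`, so it divides
  -- `E`. Hence `E` is a common denominator for all vertices.
  obtain ⟨q, hq⟩ : Y.det ∣ (E : ℤ) := by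
    rw [← Int.natAbs_dvd, Int.natCast_dvd_natCast]
    refine hE _ (Int.natAbs_pos.2 hY0) ?_
    zify
    refine (abs_det_le hYb).trans (le_trans ?_ hQ)
    nlinarith
  have hqE : |q| ≤ E := by
    have h1 : |Y.det| * |q| = E := by rw [← abs_mul, ← hq]; simp
    have h2 : 1 ≤ |Y.det| := Int.one_le_abs hY0
    nlinarith [abs_nonneg q]
  -- The coefficient of `θ j` collects the adjugate entries of the selected rows whose right-hand
  -- side is a multiple of `θ j`.
  refine ⟨fun j => q * ∑ w, if jx (g w) = j then Y.adjugate v w * ζ (g w) else 0, fun j => ?_, ?_⟩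
  · rw [abs_mul]
    refine mul_le_mul hqE ?_ (abs_nonneg _) (by positivity)
    refine (Finset.abs_sum_le_sum_abs _ _).trans (le_trans ?_ hQ)
    rw [← nsmul_eq_mul, ← Finset.card_univ, ← Finset.sum_const]
    refine Finset.sum_le_sum fun w _ => ?_
    split_ifs
    · rw [abs_mul]
      have h1 := abs_adjugate_le hb hYb v w
      have h2 := (hζ (g w)).2.1
      nlinarith [abs_nonneg (Y.adjugate v w), abs_nonneg (ζ (g w))]
    · simpa using hbd0
  · have hE' : (E : ℝ) = q * (Y.det : ℝ) := by
      have : ((E : ℤ) : ℝ) = ((Y.det * q : ℤ) : ℝ) := by rw [hq]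
      rw [Int.cast_mul, Int.cast_natCast] at this
      linarith
    rw [hE', mul_assoc, hsolve]
    push_cast
    simp_rw [mul_assoc]
    rw [← Finset.mul_sum]
    congr 1
    simp_rw [Finset.sum_mul]
    rw [Finset.sum_comm]
    refine Finset.sum_congr rfl fun w _ => ?_
    rw [Finset.sum_eq_single (jx (g w))]
    · rw [if_pos rfl, (hζ (g w)).1]
      ring
    · intro j _ hj
      rw [if_neg (Ne.symm hj), zero_mul]
    · intro h
      exact absurd (Finset.mem_range.2 (hζ (g w)).2.2) h

/-- A real number that is an integer of absolute value at most `b`. -/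
def IsIntLE (b : ℤ) (r : ℝ) : Prop := ∃ z : ℤ, r = z ∧ |z| ≤ b

theorem IsIntLE.sub {a b : ℤ} {r s : ℝ} (h : IsIntLE a r) (h' : IsIntLE b s) :
    IsIntLE (a + b) (r - s) := by
  obtain ⟨z, rfl, hz⟩ := h
  obtain ⟨w, rfl, hw⟩ := h'
  exact ⟨z - w, by push_cast; rfl, (abs_sub z w).trans (add_le_add hz hw)⟩

theorem IsIntLE.sgn_mul {b : ℤ} {r : ℝ} (h : IsIntLE b r) (c : Bool) : IsIntLE b (sgn c * r) := by
  obtain ⟨z, rfl, hz⟩ := h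
  cases c
  · exact ⟨z, by simp [sgn], hz⟩
  · exact ⟨-z, by simp [sgn], by rwa [abs_neg]⟩

theorem IsIntLE.mono {a b : ℤ} {r : ℝ} (h : IsIntLE a r) (hab : a ≤ b) : IsIntLE b r :=
  h.imp fun _ h => ⟨h.1, h.2.trans hab⟩

theorem isIntLE_single {V : Type} [DecidableEq V] (v w : V) :
    IsIntLE 1 ((Pi.single v 1 : V → ℝ) w) := by
  rw [Pi.single_apply]
  split_ifs
  · exact ⟨1, by simp, by simp⟩
  · exact ⟨0, by simp, by simp⟩

variable {k n : ℕ}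

/-- A leg row combines five signed unit vectors and the other rows fewer; the triangle inequality
gives `5` without deciding which of them coincide. -/
theorem isIntLE_makespanLP_lhs (O : Fin (n + 1) → Ordering k) (A B : Pos k) (c : LPCon k n)
    (v : LPVar k n) : IsIntLE 5 ((makespanLP O A B).lhs c v) := by
  rcases c with ⟨u, i, b, b'⟩ | ⟨u, e, z⟩ | ⟨z, i, d, b⟩
  · exact (((isIntLE_single _ _).sub (((isIntLE_single _ _).sub (isIntLE_single _ _)).sgn_mul b)).sub
      (((isIntLE_single _ _).sub (isIntLE_single _ _)).sgn_mul b')).mono (by norm_num)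
  · have : ∀ d w i j, IsIntLE 5 (sepRow (k := k) (n := n) w i j d v) := by
      intro d w i j
      cases d <;> exact ((isIntLE_single _ _).sub (isIntLE_single _ _)).mono (by norm_num)
    exact this _ _ _ _
  · exact ((isIntLE_single _ _).sgn_mul b).mono (by norm_num)

/-- The parameters of an instance: the coordinate `d` of the start (`z = 0`) or the target
(`z = 1`) of robot `i` has index `4 * i + 2 * z + d`, and the constant `1` has index `4 * k`. -/
structure IsParams (A B : Pos k) (θ : ℕ → ℝ) : Prop where
  one : θ (4 * k) = 1
  startX : ∀ i : Fin k, θ (4 * i) = (A i).1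
  startY : ∀ i : Fin k, θ (4 * i + 1) = (A i).2
  targetX : ∀ i : Fin k, θ (4 * i + 2) = (B i).1
  targetY : ∀ i : Fin k, θ (4 * i + 3) = (B i).2

/-- The coordinates of a vertex are combinations of the parameters with bounded coefficients and
with a common denominator. -/
theorem exists_combination_of_isVertex {O : Fin (n + 1) → Ordering k} {A B : Pos k}
    {x : LPVar k n → ℝ} (hx : (makespanLP O A B).IsVertex x) {θ : ℕ → ℝ} (hθ : IsParams A B θ)
    {m Q E : ℕ} (hm : m = 2 * k * (n + 2) + (n + 1)) (hQ : m * (m.factorial * 5 ^ m) ≤ Q)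
    (hE : ∀ q, 0 < q → q ≤ Q → q ∣ E) (v : LPVar k n) :
    ∃ c : ℕ → ℤ, (∀ j, |c j| ≤ E * Q) ∧
      (E : ℝ) * x v = ∑ j ∈ Finset.range (4 * k + 1), (c j : ℝ) * θ j := by
  choose Z hZ using isIntLE_makespanLP_lhs O A B
  refine hx.exists_combination (b := 5) (by norm_num) hZ
    -- Right-hand sides are `0`, the constant `1` with index `4 * k`, or a signed input coordinate.
    -- For `0` any index in range will do.
    (ζ := fun c => match c with
      | .inl _ => 0
      | .inr (.inl _) => 1
      | .inr (.inr (_, _, _, b)) => if b then -1 else 1)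
    (jx := fun c => match c with
      | .inl _ => 0
      | .inr (.inl _) => 4 * k
      | .inr (.inr (z, i, d, _)) => 4 * i + (if z then 2 else 0) + if d then 1 else 0)
    (fun c => ?_) ?_ hE v
  · rcases c with ⟨u, i, b, b'⟩ | ⟨u, e, z⟩ | ⟨z, i, d, b⟩
    · simp [makespanLP]
    · simp [makespanLP, hθ.one]
    · refine ⟨?_, ?_, ?_⟩
      · simp only [makespanLP]
        have : sgn b = ((if b then -1 else 1 : ℤ) : ℝ) := by cases b <;> simp [sgn]
        rw [this]
        congr 1
        cases z <;> cases d <;> simp [hθ.startX, hθ.startY, hθ.targetX, hθ.targetY]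
      · cases b <;> simp
      · have := i.2
        dsimp only
        split_ifs <;> omega
  · rw [card_lpVar, ← hm]
    exact_mod_cast hQ

theorem card_dir_le : Nat.card Dir ≤ 4 := by
  have h := Nat.card_le_card_of_injective
    (fun d : Dir => match d with | .right => (0 : Fin 4) | .left => 1 | .up => 2 | .down => 3)
    (by intro a b; cases a <;> cases b <;> simp)
  simpa using h

theorem card_ordering_le (k : ℕ) : Nat.card (Ordering k) ≤ 4 ^ k.choose 2 := by
  rw [Nat.card_fun, Nat.card_eq_fintype_card (α := RobotPair k), card_robotPair]
  exact Nat.pow_le_pow_left card_dir_le _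

/-- There is an optimal path of prescribed length whose coordinates are combinations of the
parameters with bounded coefficients and common denominator `E`. -/
theorem exists_optimal_path {A B : Pos k} (hA : A ∈ confSpace k) (hB : B ∈ confSpace k)
    {θ : ℕ → ℝ} (hθ : IsParams A B θ) {ℓ m Q E : ℕ} (hℓ : 0 < ℓ) (hℓk : 4 ^ k.choose 2 ≤ ℓ)
    (hm : m = 2 * k * (ℓ + 1) + ℓ) (hQ : m * (m.factorial * 5 ^ m) ≤ Q)
    (hE : ∀ q, 0 < q → q ≤ Q → q ∣ E) :
    ∃ (I : ℕ → Pos k) (φ : ℕ → ℝ), I 0 = A ∧ I ℓ = B ∧ IsPath ℓ I φ ∧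
      IsMinMakespan A B (arrival φ ℓ) ∧
      ∃ c : ℕ → Fin k → Bool → ℕ → ℤ, (∀ u i d j, |c u i d j| ≤ E * Q) ∧
        ∀ u i, (E : ℝ) * (I u i).1 = ∑ j ∈ Finset.range (4 * k + 1), (c u i false j : ℝ) * θ j ∧
          (E : ℝ) * (I u i).2 = ∑ j ∈ Finset.range (4 * k + 1), (c u i true j : ℝ) * θ j := by
  rcases Nat.eq_zero_or_pos k with rfl | hk
  · have hφ : arrival (fun _ => 0) ℓ = 0 := by simp [arrival]
    refine ⟨fun _ i => i.elim0, fun _ => 0, funext fun i => i.elim0, funext fun i => i.elim0,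
      ⟨fun _ _ => le_rfl, fun _ _ i => i.elim0, fun _ _ => ⟨fun e => e.1.1.elim0,
        mem_confs_iff.2 fun e => e.1.1.elim0, mem_confs_iff.2 fun e => e.1.1.elim0⟩⟩,
      ⟨⟨0, 0, fun i => i.elim0, ⟨le_rfl, fun i => i.elim0, fun _ _ i => i.elim0⟩, ?_⟩, ?_⟩,
      fun _ i => i.elim0, fun _ i => i.elim0, fun _ i => i.elim0⟩
    · rw [hφ, sub_zero]
    · rintro L ⟨s₀, s₁, M', hM', hL⟩
      rw [hφ]
      linarith [hM'.le]
  · obtain ⟨N, rfl⟩ : ∃ N, ℓ = N + 1 := ⟨ℓ - 1, by omega⟩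
    obtain ⟨O, x, hx, hmin⟩ := exists_isVertex_isMinMakespan hk
      ((card_ordering_le k).trans hℓk) hA hB
    obtain ⟨-, -, h3, h4⟩ := makespanLP_feasible_iff.1 hx.1
    choose c hc hcx using exists_combination_of_isVertex hx hθ hm hQ hE
    refine ⟨lpPath x, lpDur x, (lpPath_val x 0).trans h3,
      (lpPath_val x (Fin.last (N + 1))).trans h4, isPath_of_feasible hk hx.1, ?_,
      fun u i d => c (.inl (Fin.ofNat (N + 2) (min u (N + 1)), i, d)), fun u i d j => hc _ j,
      fun u i => ⟨hcx _, hcx _⟩⟩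
    rwa [arrival_lpDur, ← obj_dotProduct O A B]

end Lattice

/-! ### Growth of numbers in a computation -/

section Growth

theorem bitLen_pos (z : ℤ) : 1 ≤ bitLen z := by simp [bitLen]

theorem bitLen_zero : bitLen 0 = 1 := by simp [bitLen]

theorem bitLen_mul_le (x y : ℤ) : bitLen (x * y) ≤ bitLen x + bitLen y := by
  have : Nat.size (x * y).natAbs ≤ Nat.size x.natAbs + Nat.size y.natAbs := by
    rw [Nat.size_le, Int.natAbs_mul, pow_add]
    exact Nat.mul_lt_mul'' (Nat.lt_size_self _) (Nat.lt_size_self _)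
  simp only [bitLen]
  omega

/-- The possible carry is paid for by the second sign bit on the right. -/
theorem bitLen_le_of_natAbs_le_add {x y z : ℤ} (h : z.natAbs ≤ x.natAbs + y.natAbs) :
    bitLen z ≤ bitLen x + bitLen y := by
  have : Nat.size z.natAbs ≤ Nat.size x.natAbs + Nat.size y.natAbs + 1 := by
    rw [Nat.size_le, pow_succ]
    have h1 : 2 ^ Nat.size x.natAbs ≤ 2 ^ (Nat.size x.natAbs + Nat.size y.natAbs) :=
      Nat.pow_le_pow_right (by norm_num) (by omega)
    have h2 : 2 ^ Nat.size y.natAbs ≤ 2 ^ (Nat.size x.natAbs + Nat.size y.natAbs) :=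
      Nat.pow_le_pow_right (by norm_num) (by omega)
    have h3 := Nat.lt_size_self x.natAbs
    have h4 := Nat.lt_size_self y.natAbs
    omega
  simp only [bitLen]
  omega

theorem bitLen_add_le (x y : ℤ) : bitLen (x + y) ≤ bitLen x + bitLen y :=
  bitLen_le_of_natAbs_le_add (Int.natAbs_add_le x y)

theorem bitLen_sub_le (x y : ℤ) : bitLen (x - y) ≤ bitLen x + bitLen y :=
  bitLen_le_of_natAbs_le_add (Int.natAbs_sub_le x y)

/-- All registers hold numbers with at most `b` bits. -/
def BitBound (σ : Store) (b : ℕ) : Prop := ∀ r, bitLen (σ r) ≤ b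

theorem BitBound.mono {σ : Store} {a b : ℕ} (h : BitBound σ a) (hab : a ≤ b) : BitBound σ b :=
  fun r => (h r).trans hab

theorem BitBound.update {σ : Store} {b : ℕ} (h : BitBound σ b) {r x : ℤ} (hx : bitLen x ≤ b) :
    BitBound (Function.update σ r x) b := by
  intro r'
  rw [Function.update_apply]
  split_ifs
  · exact hx
  · exact h r'

/-- Bound on the cost of a computation of weight `N` on numbers with `b` bits. -/
def costBound (N b : ℕ) : ℕ := N * (6 * 2 ^ N * b)

/-- Sequential composition: the second computation starts with numbers of up to `2 ^ N₁ * b` bits,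
and the exponential factor in `costBound` absorbs this growth. -/
theorem costBound_add_le (N₁ N₂ b : ℕ) :
    costBound N₁ b + costBound N₂ (2 ^ N₁ * b) ≤ costBound (N₁ + N₂) b := by
  simp only [costBound]
  have e : 2 ^ N₁ ≤ 2 ^ (N₁ + N₂) := Nat.pow_le_pow_right (by norm_num) (by omega)
  calc N₁ * (6 * 2 ^ N₁ * b) + N₂ * (6 * 2 ^ N₂ * (2 ^ N₁ * b))
      = N₁ * (6 * 2 ^ N₁ * b) + N₂ * (6 * 2 ^ (N₁ + N₂) * b) := by rw [pow_add]; ring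
    _ ≤ N₁ * (6 * 2 ^ (N₁ + N₂) * b) + N₂ * (6 * 2 ^ (N₁ + N₂) * b) := by gcongr
    _ = _ := by ring

theorem le_costBound {N b t : ℕ} (hN : 1 ≤ N) (hb : 1 ≤ b) (ht : t ≤ N + 3 * b) :
    t ≤ costBound N b := by
  have h1 : 1 ≤ 2 ^ N := Nat.one_le_two_pow
  have h2 : 1 ≤ 2 ^ N * b := Nat.mul_pos h1 hb
  have h3 : b ≤ 2 ^ N * b := Nat.le_mul_of_pos_left b h1
  have h4 : N * 1 ≤ N * (2 ^ N * b) := Nat.mul_le_mul_left N h2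
  have h5 : 1 * (2 ^ N * b) ≤ N * (2 ^ N * b) := Nat.mul_le_mul_right _ hN
  calc t ≤ N + 3 * b := ht
    _ ≤ 6 * (N * (2 ^ N * b)) := by omega
    _ = costBound N b := by simp only [costBound]; ring

theorem costBound_mono {N N' b : ℕ} (h : N ≤ N') : costBound N b ≤ costBound N' b := by
  have : 2 ^ N ≤ 2 ^ N' := Nat.pow_le_pow_right (by norm_num) h
  simp only [costBound]
  gcongr

/-- `p` leads from `σ` to `σ'` in a computation of weight at most `N`. The weight counts the
instructions together with the bits of the constants in them. It also bounds the growth of numbers: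
every instruction at most doubles their lengths. -/
def Within (p : Prog) (σ σ' : Store) (N : ℕ) : Prop :=
  ∀ b, 1 ≤ b → BitBound σ b →
    ∃ t, Exec p σ σ' t ∧ t ≤ costBound N b ∧ BitBound σ' (2 ^ N * b)

theorem Within.mono {p : Prog} {σ σ' : Store} {N N' : ℕ} (h : Within p σ σ' N) (hN : N ≤ N') :
    Within p σ σ' N' := by
  intro b hb hσ
  obtain ⟨t, h1, h2, h3⟩ := h b hb hσ
  exact ⟨t, h1, h2.trans (costBound_mono hN),
    h3.mono (Nat.mul_le_mul_right _ (Nat.pow_le_pow_right (by norm_num) hN))⟩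

/-- `p` started in `σ` halts within weight `N` in a memory that satisfies `Q`. -/
def Runs (p : Prog) (N : ℕ) (σ : Store) (Q : Store → Prop) : Prop :=
  ∃ σ', Within p σ σ' N ∧ Q σ'

theorem Runs.imp {p : Prog} {N N' : ℕ} {σ : Store} {Q Q' : Store → Prop} (h : Runs p N σ Q)
    (hN : N ≤ N') (hQ : ∀ σ', Q σ' → Q' σ') : Runs p N' σ Q' := by
  obtain ⟨σ', h1, h2⟩ := h
  exact ⟨σ', h1.mono hN, hQ _ h2⟩

theorem Runs.seq {p q : Prog} {N N' : ℕ} {σ : Store} {Q Q' : Store → Prop} (h : Runs p N σ Q)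
    (h' : ∀ σ', Q σ' → Runs q N' σ' Q') : Runs (.seq p q) (N + N') σ Q' := by
  obtain ⟨σ', h1, h2⟩ := h
  obtain ⟨σ'', h3, h4⟩ := h' σ' h2
  refine ⟨σ'', fun b hb hσ => ?_, h4⟩
  obtain ⟨t, e1, e2, e3⟩ := h1 b hb hσ
  obtain ⟨t', f1, f2, f3⟩ := h3 (2 ^ N * b) (Nat.mul_pos (by positivity) hb) e3
  refine ⟨t + t', Exec.seq e1 f1, (add_le_add e2 f2).trans (costBound_add_le _ _ _), ?_⟩
  refine f3.mono (le_of_eq ?_)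
  rw [pow_add]
  ring

/-- An instruction that changes one register. -/
theorem Runs.of_update {p : Prog} {σ : Store} {r x : ℤ} {t N : ℕ} {Q : Store → Prop} (hN : 1 ≤ N)
    (hp : Exec p σ (Function.update σ r x) t)
    (hb : ∀ b, 1 ≤ b → BitBound σ b → t ≤ N + 3 * b ∧ bitLen x ≤ 2 ^ N * b)
    (hQ : Q (Function.update σ r x)) : Runs p N σ Q := by
  refine ⟨_, fun b h1 hσ => ⟨t, hp, le_costBound hN h1 (hb b h1 hσ).1, ?_⟩, hQ⟩
  exact (hσ.mono (Nat.le_mul_of_pos_left b (by positivity))).update (hb b h1 hσ).2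

theorem two_mul_le_two_pow_mul {N b : ℕ} (hN : 1 ≤ N) : 2 * b ≤ 2 ^ N * b :=
  Nat.mul_le_mul_right _ (Nat.le_self_pow (by omega) 2)

/-- Weights of instructions. -/
def weight₂ (r c : ℤ) : ℕ := 1 + bitLen r + bitLen c

/-- Weights of arithmetical instructions. -/
def weight₃ (r a b : ℤ) : ℕ := 1 + bitLen r + bitLen a + bitLen b

/-- Weights of tests. -/
def weight₁ (r : ℤ) : ℕ := 1 + bitLen r

theorem Runs.const {r c : ℤ} {σ : Store} {Q : Store → Prop} (hQ : Q (Function.update σ r c)) :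
    Runs (.const r c) (weight₂ r c) σ Q := by
  refine Runs.of_update (by simp only [weight₂]; omega) (Exec.const r c σ) (fun b hb hσ => ?_) hQ
  simp only [weight₂]
  refine ⟨by omega, ?_⟩
  -- The bits of the constant count in the weight, so the growth factor also covers a large constant
  -- in a memory of small numbers.
  have h1 : 1 + bitLen r + bitLen c < 2 ^ (1 + bitLen r + bitLen c) := Nat.lt_two_pow_self
  have h2 : 2 ^ (1 + bitLen r + bitLen c) * 1 ≤ 2 ^ (1 + bitLen r + bitLen c) * b :=
    Nat.mul_le_mul_left _ hb
  omega

theorem Runs.add {r a b : ℤ} {σ : Store} {Q : Store → Prop}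
    (hQ : Q (Function.update σ r (σ a + σ b))) : Runs (.add r a b) (weight₃ r a b) σ Q := by
  refine Runs.of_update (by simp only [weight₃]; omega) (Exec.add r a b σ) (fun d hd hσ => ?_) hQ
  have h1 := hσ a
  have h2 := hσ b
  simp only [weight₃, acc]
  exact ⟨by omega, (bitLen_add_le _ _).trans
    (le_trans (by omega) (two_mul_le_two_pow_mul (by omega)))⟩

theorem Runs.sub {r a b : ℤ} {σ : Store} {Q : Store → Prop}
    (hQ : Q (Function.update σ r (σ a - σ b))) : Runs (.sub r a b) (weight₃ r a b) σ Q := by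
  refine Runs.of_update (by simp only [weight₃]; omega) (Exec.sub r a b σ) (fun d hd hσ => ?_) hQ
  have h1 := hσ a
  have h2 := hσ b
  simp only [weight₃, acc]
  exact ⟨by omega, (bitLen_sub_le _ _).trans
    (le_trans (by omega) (two_mul_le_two_pow_mul (by omega)))⟩

theorem Runs.mul {r a b : ℤ} {σ : Store} {Q : Store → Prop}
    (hQ : Q (Function.update σ r (σ a * σ b))) : Runs (.mul r a b) (weight₃ r a b) σ Q := by
  refine Runs.of_update (by simp only [weight₃]; omega) (Exec.mul r a b σ) (fun d hd hσ => ?_) hQ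
  have h1 := hσ a
  have h2 := hσ b
  simp only [weight₃, acc]
  exact ⟨by omega, (bitLen_mul_le _ _).trans
    (le_trans (by omega) (two_mul_le_two_pow_mul (by omega)))⟩

theorem Runs.load {r a : ℤ} {σ : Store} {Q : Store → Prop}
    (hQ : Q (Function.update σ r (σ (σ a)))) : Runs (.load r a) (weight₂ r a) σ Q := by
  refine Runs.of_update (by simp only [weight₂]; omega) (Exec.load r a σ) (fun d hd hσ => ?_) hQ
  have h1 := hσ a
  have h2 := hσ (σ a)
  simp only [weight₂, acc]
  exact ⟨by omega, le_trans (by omega) (two_mul_le_two_pow_mul (by omega))⟩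

theorem Runs.store {a r : ℤ} {σ : Store} {Q : Store → Prop}
    (hQ : Q (Function.update σ (σ a) (σ r))) : Runs (.store a r) (weight₂ a r) σ Q := by
  refine Runs.of_update (by simp only [weight₂]; omega) (Exec.store a r σ) (fun d hd hσ => ?_) hQ
  have h1 := hσ a
  have h2 := hσ r
  simp only [weight₂, acc]
  exact ⟨by omega, le_trans (by omega) (two_mul_le_two_pow_mul (by omega))⟩

/-- Bookkeeping for a test followed by a computation. -/
theorem test_bound {σ σ' : Store} {r : ℤ} {p q : Prog} {N : ℕ} (h : Within p σ σ' N)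
    (hq : ∀ t, Exec p σ σ' t → Exec q σ σ' (1 + acc σ r + t)) :
    Within q σ σ' (weight₁ r + N) := by
  intro b hb hσ
  have hw : 1 ≤ weight₁ r := by simp only [weight₁]; omega
  obtain ⟨t, h1, h2, h3⟩ := h (2 ^ weight₁ r * b) (Nat.mul_pos (by positivity) hb)
    (hσ.mono (Nat.le_mul_of_pos_left b (by positivity)))
  refine ⟨_, hq t h1, ?_, h3.mono (le_of_eq (by rw [pow_add]; ring))⟩
  refine le_trans (add_le_add (le_costBound hw hb ?_) h2) (costBound_add_le _ _ _)
  have := hσ r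
  simp only [acc, weight₁]
  omega

/-- The weights of both branches are added so that the bound does not depend on the outcome of the
test. -/
theorem Runs.ifPos {r : ℤ} {p q : Prog} {σ : Store} {N N' : ℕ} {Q : Store → Prop}
    (hp : 0 < σ r → Runs p N σ Q) (hq : ¬ 0 < σ r → Runs q N' σ Q) :
    Runs (.ifPos r p q) (weight₁ r + (N + N')) σ Q := by
  by_cases h : 0 < σ r
  · obtain ⟨σ', h1, h2⟩ := hp h
    exact ⟨σ', test_bound (h1.mono (by omega)) fun t ht => Exec.ifTrue h ht, h2⟩
  · obtain ⟨σ', h1, h2⟩ := hq h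
    exact ⟨σ', test_bound (h1.mono (by omega)) fun t ht => Exec.ifFalse h ht, h2⟩

/-- A loop whose control register counts down. -/
theorem Runs.while_count {r : ℤ} {p : Prog} {N : ℕ} {P : ℕ → Store → Prop}
    (hr : ∀ n σ, P n σ → σ r = n) (hstep : ∀ n σ, P (n + 1) σ → Runs p N σ (P n)) :
    ∀ n σ, P n σ → Runs (.whilePos r p) (n * (weight₁ r + N) + weight₁ r) σ (P 0) := by
  intro n
  induction n with
  | zero =>
    intro σ hσ
    refine ⟨σ, fun b hb hb' => ⟨_, Exec.whileFalse (by simp [hr 0 σ hσ]), ?_, ?_⟩, hσ⟩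
    · refine le_costBound (by simp only [weight₁]; omega) hb ?_
      have := hb' r
      simp only [acc, weight₁]
      omega
    · exact hb'.mono (Nat.le_mul_of_pos_left b (by positivity))
  | succ n ih =>
    intro σ hσ
    have hpos : 0 < σ r := by rw [hr _ σ hσ]; positivity
    -- One round and the rest of the loop are bounded as a sequential composition. Taking its
    -- execution apart yields the two premises of `Exec.whileTrue`.
    obtain ⟨σ', h1, h2⟩ := Runs.seq (hstep n σ hσ) ih
    refine ⟨σ', (test_bound (r := r) h1 fun t ht => ?_).mono (le_of_eq (by ring)), h2⟩
    cases ht with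
    | seq e1 e2 =>
      rw [← add_assoc]
      exact Exec.whileTrue hpos e1 e2

end Growth

/-! ### A functional language for the random access machine -/

/-- Address of the `r`-th working register. -/
def reg (r : ℕ) : ℤ := -(2 * r + 1)

/-- Address of the copy of the `i`-th entry of the input word. -/
def slot (i : ℕ) : ℤ := -(2 * i + 2)

theorem reg_inj {a b : ℕ} : reg a = reg b ↔ a = b := by simp only [reg]; omega

theorem slot_inj {a b : ℕ} : slot a = slot b ↔ a = b := by simp only [slot]; omega

theorem slot_ne_reg (i r : ℕ) : slot i ≠ reg r := by simp only [slot, reg]; omega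

theorem nat_ne_reg (i r : ℕ) : (i : ℤ) ≠ reg r := by simp only [reg]; omega

theorem nat_ne_slot (i r : ℕ) : (i : ℤ) ≠ slot r := by simp only [slot]; omega

/-- Expressions in `n` variables for functions of `n` integers, the input word, and a bound `H`,
which is the number of iterations of every loop. -/
inductive Fn : ℕ → Type
  | proj {n : ℕ} (i : Fin n) : Fn n
  | const {n : ℕ} (c : ℤ) : Fn n
  | add {n : ℕ} (f g : Fn n) : Fn n
  | sub {n : ℕ} (f g : Fn n) : Fn n
  | mul {n : ℕ} (f g : Fn n) : Fn n
  /-- an entry of the input word -/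
  | inp {n : ℕ} (f : Fn n) : Fn n
  /-- if `c > 0` then `f` else `g` -/
  | ite {n : ℕ} (c f g : Fn n) : Fn n
  /-- iteration; the body knows the number of the iteration and the previous value -/
  | iter {n : ℕ} (init : Fn n) (body : Fn (n + 2)) : Fn n
  | comp {n m : ℕ} (f : Fn m) (g : Fin m → Fn n) : Fn n

/-- The value of an expression. -/
def Fn.eval (w : ℕ → ℤ) (H : ℕ) : {n : ℕ} → Fn n → (Fin n → ℤ) → ℤ
  | _, .proj i, v => v i
  | _, .const c, _ => c
  | _, .add f g, v => f.eval w H v + g.eval w H v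
  | _, .sub f g, v => f.eval w H v - g.eval w H v
  | _, .mul f g, v => f.eval w H v * g.eval w H v
  | _, .inp f, v => if 0 ≤ f.eval w H v then w (f.eval w H v).toNat else 0
  | _, .ite c f g, v => if 0 < c.eval w H v then f.eval w H v else g.eval w H v
  | _, .iter init body, v =>
      Nat.rec (init.eval w H v) (fun i a => body.eval w H (Matrix.vecCons (i : ℤ) (Matrix.vecCons a v))) H
  | _, .comp f g, v => f.eval w H fun j => (g j).eval w H v

/-- `σ'` agrees with `σ` except for the working registers from `s` on. -/
def Agree (s : ℕ) (σ σ' : Store) : Prop := ∀ a, (∀ r, s ≤ r → a ≠ reg r) → σ' a = σ a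

theorem Agree.refl (s : ℕ) (σ : Store) : Agree s σ σ := fun _ _ => rfl

theorem Agree.trans {s s' : ℕ} {σ σ' σ'' : Store} (h : Agree s σ σ') (h' : Agree s' σ' σ'')
    (hs : s ≤ s') : Agree s σ σ'' := fun a ha =>
  (h' a fun r hr => ha r (hs.trans hr)).trans (h a ha)

theorem Agree.update {s r : ℕ} {σ σ' : Store} (h : Agree s σ σ') (hr : s ≤ r) (x : ℤ) :
    Agree s σ (Function.update σ' (reg r) x) := fun a ha => by
  rw [Function.update_of_ne (ha r hr)]
  exact h a ha

theorem Agree.reg {s r : ℕ} {σ σ' : Store} (h : Agree s σ σ') (hr : r < s) :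
    σ' (reg r) = σ (reg r) := h _ fun r' hr' => by rw [Ne, reg_inj]; omega

theorem Agree.slot {s : ℕ} {σ σ' : Store} (h : Agree s σ σ') (i : ℕ) :
    σ' (slot i) = σ (slot i) := h _ fun r _ => slot_ne_reg i r

theorem Agree.nat {s : ℕ} {σ σ' : Store} (h : Agree s σ σ') (i : ℕ) : σ' i = σ i :=
  h _ fun r _ => nat_ne_reg i r

/-- The memory holds the bound `H` and the input word `w`. -/
structure Loaded (w : ℕ → ℤ) (H : ℕ) (σ : Store) : Prop where
  bound : σ (reg 0) = H
  word : ∀ i, σ (slot i) = w i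

theorem Loaded.agree {w : ℕ → ℤ} {H s : ℕ} {σ σ' : Store} (h : Loaded w H σ) (ha : Agree s σ σ')
    (hs : 0 < s) : Loaded w H σ' :=
  ⟨(ha.reg hs).trans h.bound, fun i => (ha.slot i).trans (h.word i)⟩

/-- The program `p` computes `f`, from arguments in the registers `env` to the register `s`, with
weight `c H`. -/
def Implements {n : ℕ} (f : Fn n) (env : Fin n → ℕ) (s : ℕ) (p : Prog) (c : ℕ → ℕ) : Prop :=
  ∀ (w : ℕ → ℤ) (H : ℕ) (σ : Store), Loaded w H σ → Runs p (c H) σ fun σ' =>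
    σ' (reg s) = f.eval w H (fun i => σ (reg (env i))) ∧ Agree s σ σ'

/-- Expressions can be evaluated by programs whose weight is a computable function of `H`. -/
def Implementable {n : ℕ} (f : Fn n) : Prop :=
  ∀ (env : Fin n → ℕ) (s : ℕ), (∀ i, env i < s) → 0 < s →
    ∃ (p : Prog) (c : ℕ → ℕ), Primrec c ∧ Implements f env s p c

theorem primrec_add {c d : ℕ → ℕ} (hc : Primrec c) (hd : Primrec d) : Primrec fun H => c H + d H :=
  Primrec.nat_add.comp hc hd

theorem primrec_mul {c d : ℕ → ℕ} (hc : Primrec c) (hd : Primrec d) : Primrec fun H => c H * d H :=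
  Primrec.nat_mul.comp hc hd

/-- Evaluation of two expressions into consecutive registers. -/
theorem Implementable.pair {n : ℕ} {f g : Fn n} (hf : Implementable f) (hg : Implementable g)
    (env : Fin n → ℕ) (s : ℕ) (henv : ∀ i, env i < s) (hs : 0 < s) :
    ∃ (p : Prog) (c : ℕ → ℕ), Primrec c ∧ ∀ (w : ℕ → ℤ) (H : ℕ) (σ : Store), Loaded w H σ →
      Runs p (c H) σ fun σ' => σ' (reg s) = f.eval w H (fun i => σ (reg (env i))) ∧
        σ' (reg (s + 1)) = g.eval w H (fun i => σ (reg (env i))) ∧ Agree s σ σ' := by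
  obtain ⟨p, c, hc, hp⟩ := hf env s henv hs
  obtain ⟨q, d, hd, hq⟩ := hg env (s + 1) (fun i => (henv i).trans (Nat.lt_succ_self s)) (by omega)
  refine ⟨.seq p q, fun H => c H + d H, primrec_add hc hd, fun w H σ hσ => ?_⟩
  refine (hp w H σ hσ).seq fun σ₁ h₁ => ?_
  refine (hq w H σ₁ (hσ.agree h₁.2 hs)).imp le_rfl fun σ₂ h₂ => ?_
  refine ⟨(h₂.2.reg (Nat.lt_succ_self s)).trans h₁.1, ?_, h₁.2.trans h₂.2 (Nat.le_succ s)⟩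
  rw [h₂.1]
  congr 1
  funext i
  exact h₁.2.reg (henv i)

theorem Implementable.add {n : ℕ} {f g : Fn n} (hf : Implementable f) (hg : Implementable g) :
    Implementable (.add f g) := by
  intro env s henv hs
  obtain ⟨p, c, hc, hp⟩ := hf.pair hg env s henv hs
  refine ⟨.seq p (.add (reg s) (reg s) (reg (s + 1))),
    fun H => c H + weight₃ (reg s) (reg s) (reg (s + 1)), primrec_add hc (Primrec.const _),
    fun w H σ hσ => (hp w H σ hσ).seq fun σ₁ h => Runs.add ⟨?_, h.2.2.update le_rfl _⟩⟩
  rw [Function.update_self, h.1, h.2.1, Fn.eval]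

theorem Implementable.sub {n : ℕ} {f g : Fn n} (hf : Implementable f) (hg : Implementable g) :
    Implementable (.sub f g) := by
  intro env s henv hs
  obtain ⟨p, c, hc, hp⟩ := hf.pair hg env s henv hs
  refine ⟨.seq p (.sub (reg s) (reg s) (reg (s + 1))),
    fun H => c H + weight₃ (reg s) (reg s) (reg (s + 1)), primrec_add hc (Primrec.const _),
    fun w H σ hσ => (hp w H σ hσ).seq fun σ₁ h => Runs.sub ⟨?_, h.2.2.update le_rfl _⟩⟩
  rw [Function.update_self, h.1, h.2.1, Fn.eval]

theorem Implementable.mul {n : ℕ} {f g : Fn n} (hf : Implementable f) (hg : Implementable g) :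
    Implementable (.mul f g) := by
  intro env s henv hs
  obtain ⟨p, c, hc, hp⟩ := hf.pair hg env s henv hs
  refine ⟨.seq p (.mul (reg s) (reg s) (reg (s + 1))),
    fun H => c H + weight₃ (reg s) (reg s) (reg (s + 1)), primrec_add hc (Primrec.const _),
    fun w H σ hσ => (hp w H σ hσ).seq fun σ₁ h => Runs.mul ⟨?_, h.2.2.update le_rfl _⟩⟩
  rw [Function.update_self, h.1, h.2.1, Fn.eval]

/-- Copying a register, with the help of a further one. -/
def copyProg (r a z : ℤ) : Prog := .seq (.const z 0) (.add r a z)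

/-- The weight of `copyProg`. -/
def copyWeight (r a z : ℤ) : ℕ := weight₂ z 0 + weight₃ r a z

theorem Runs.copy {r a z : ℤ} {σ : Store} {Q : Store → Prop} (haz : a ≠ z)
    (hQ : Q (Function.update (Function.update σ z 0) r (σ a))) :
    Runs (copyProg r a z) (copyWeight r a z) σ Q := by
  refine Runs.seq (Q := fun σ' => σ' = Function.update σ z 0) (Runs.const rfl) ?_
  rintro _ rfl
  refine Runs.add ?_
  rw [Function.update_self, Function.update_of_ne haz, add_zero]
  exact hQ

theorem implementable_proj {n : ℕ} (i : Fin n) : Implementable (.proj i) := by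
  intro env s henv hs
  refine ⟨copyProg (reg s) (reg (env i)) (reg (s + 1)),
    fun _ => copyWeight (reg s) (reg (env i)) (reg (s + 1)), Primrec.const _,
    fun w H σ hσ => Runs.copy ?_ ⟨?_, ?_⟩⟩
  · rw [Ne, reg_inj]
    have := henv i
    omega
  · rw [Function.update_self, Fn.eval]
  · exact ((Agree.refl s σ).update (Nat.le_succ s) _).update le_rfl _

theorem implementable_const {n : ℕ} (c : ℤ) : Implementable (.const c : Fn n) := by
  intro env s henv hs
  refine ⟨.const (reg s) c, fun _ => weight₂ (reg s) c, Primrec.const _,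
    fun w H σ hσ => Runs.const ⟨?_, (Agree.refl s σ).update le_rfl _⟩⟩
  rw [Function.update_self, Fn.eval]

theorem Implementable.ite {n : ℕ} {t f g : Fn n} (ht : Implementable t) (hf : Implementable f)
    (hg : Implementable g) : Implementable (.ite t f g) := by
  intro env s henv hs
  obtain ⟨p, c, hc, hp⟩ := ht env s henv hs
  obtain ⟨p₁, c₁, hc₁, hp₁⟩ := hf env s henv hs
  obtain ⟨p₂, c₂, hc₂, hp₂⟩ := hg env s henv hs
  refine ⟨.seq p (.ifPos (reg s) p₁ p₂), fun H => c H + (weight₁ (reg s) + (c₁ H + c₂ H)),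
    primrec_add hc (primrec_add (Primrec.const _) (primrec_add hc₁ hc₂)),
    fun w H σ hσ => (hp w H σ hσ).seq fun σ₁ h => ?_⟩
  have hσ₁ := hσ.agree h.2 hs
  have henv' : (fun i => σ₁ (reg (env i))) = fun i => σ (reg (env i)) :=
    funext fun i => h.2.reg (henv i)
  refine Runs.ifPos (fun hpos => ?_) fun hpos => ?_
  · refine (hp₁ w H σ₁ hσ₁).imp le_rfl fun σ₂ h₂ => ⟨?_, h.2.trans h₂.2 le_rfl⟩
    rw [h.1] at hpos
    rw [h₂.1, henv', Fn.eval, if_pos hpos]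
  · refine (hp₂ w H σ₁ hσ₁).imp le_rfl fun σ₂ h₂ => ⟨?_, h.2.trans h₂.2 le_rfl⟩
    rw [h.1] at hpos
    rw [h₂.1, henv', Fn.eval, if_neg hpos]

theorem Implementable.inp {n : ℕ} {f : Fn n} (hf : Implementable f) : Implementable (.inp f) := by
  intro env s henv hs
  -- `s + 1` receives `f + 1`, and then the address of the entry
  obtain ⟨p, c, hc, hp⟩ := hf.pair (hf.add (implementable_const 1)) env s henv hs
  refine ⟨.seq p (.ifPos (reg (s + 1))
      (.seq (.const (reg (s + 2)) (-2)) (.seq (.mul (reg (s + 1)) (reg (s + 1)) (reg (s + 2)))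
        (.load (reg s) (reg (s + 1)))))
      (.const (reg s) 0)),
    fun H => c H + (weight₁ (reg (s + 1)) + ((weight₂ (reg (s + 2)) (-2) +
      (weight₃ (reg (s + 1)) (reg (s + 1)) (reg (s + 2)) + weight₂ (reg s) (reg (s + 1)))) +
        weight₂ (reg s) 0)), primrec_add hc (Primrec.const _),
    fun w H σ hσ => (hp w H σ hσ).seq fun σ₁ h => ?_⟩
  have hf1 := h.2.1
  simp only [Fn.eval] at hf1
  refine Runs.ifPos (fun hpos => ?_) fun hpos => ?_
  · refine Runs.seq (Q := fun σ' => σ' = _) (Runs.const rfl) ?_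
    rintro _ rfl
    refine Runs.seq (Q := fun σ' => σ' = _) (Runs.mul rfl) ?_
    rintro _ rfl
    refine Runs.load ⟨?_, ((h.2.2.update (by omega) _).update (by omega) _).update le_rfl _⟩
    rw [hf1] at hpos
    have h0 : 0 ≤ f.eval w H fun i => σ (reg (env i)) := by omega
    -- `slot i` is `-2 * (i + 1)`, which is why `f + 1` has been computed; its positivity is also
    -- the test for `0 ≤ f`.
    have haddr : (f.eval w H (fun i => σ (reg (env i))) + 1) * -2 =
        slot (f.eval w H fun i => σ (reg (env i))).toNat := by
      simp only [slot]
      omega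
    have e1 : reg (s + 1) ≠ reg (s + 2) := by rw [Ne, reg_inj]; omega
    rw [Function.update_self, Function.update_self, Function.update_self,
      Function.update_of_ne e1, hf1, haddr, Function.update_of_ne (slot_ne_reg _ _),
      Function.update_of_ne (slot_ne_reg _ _), h.2.2.slot, hσ.word, Fn.eval, if_pos h0]
  · refine Runs.const ⟨?_, h.2.2.update le_rfl _⟩
    rw [hf1] at hpos
    rw [Function.update_self, Fn.eval, if_neg (by omega)]

/-- The arguments are put one after another into the registers from `s` to `s + m - 1`; evaluating
one leaves the registers below its target intact. Then `f` is evaluated above them and its value is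
moved down to `s`. -/
theorem Implementable.comp {n m : ℕ} {f : Fn m} {g : Fin m → Fn n} (hf : Implementable f)
    (hg : ∀ j, Implementable (g j)) : Implementable (.comp f g) := by
  intro env s henv hs
  have hargs : ∀ j ≤ m, ∃ (p : Prog) (c : ℕ → ℕ), Primrec c ∧
      ∀ (w : ℕ → ℤ) (H : ℕ) (σ : Store), Loaded w H σ → Runs p (c H) σ fun σ' =>
        (∀ i : Fin m, (i : ℕ) < j →
          σ' (reg (s + i)) = (g i).eval w H (fun i => σ (reg (env i)))) ∧ Agree s σ σ' := by
    intro j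
    induction j with
    | zero =>
      intro _
      exact ⟨.const (reg s) 0, fun _ => weight₂ (reg s) 0, Primrec.const _, fun w H σ _ =>
        Runs.const ⟨fun i hi => absurd hi (Nat.not_lt_zero _), (Agree.refl s σ).update le_rfl _⟩⟩
    | succ j ih =>
      intro hj
      obtain ⟨p, c, hc, hp⟩ := ih (by omega)
      obtain ⟨q, d, hd, hq⟩ := hg ⟨j, hj⟩ env (s + j) (fun i => (henv i).trans_le (by omega))
        (by omega)
      refine ⟨.seq p q, fun H => c H + d H, primrec_add hc hd, fun w H σ hσ => ?_⟩
      refine (hp w H σ hσ).seq fun σ₁ h₁ => ?_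
      refine (hq w H σ₁ (hσ.agree h₁.2 hs)).imp le_rfl fun σ₂ h₂ =>
        ⟨fun i hi => ?_, h₁.2.trans h₂.2 (by omega)⟩
      rcases Nat.lt_succ_iff_lt_or_eq.1 hi with hi | hi
      · rw [h₂.2.reg (by omega), h₁.1 i hi]
      · obtain rfl : i = ⟨j, hj⟩ := Fin.ext hi
        rw [h₂.1]
        congr 1
        funext i'
        exact h₁.2.reg (henv i')
  obtain ⟨p, c, hc, hp⟩ := hargs m le_rfl
  obtain ⟨q, d, hd, hq⟩ := hf (fun j => s + j) (s + m) (fun j => by omega) (by omega)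
  refine ⟨.seq p (.seq q (copyProg (reg s) (reg (s + m)) (reg (s + m + 1)))),
    fun H => c H + (d H + copyWeight (reg s) (reg (s + m)) (reg (s + m + 1))),
    primrec_add hc (primrec_add hd (Primrec.const _)), fun w H σ hσ => ?_⟩
  refine (hp w H σ hσ).seq fun σ₁ h₁ => ?_
  refine (hq w H σ₁ (hσ.agree h₁.2 hs)).seq fun σ₂ h₂ => ?_
  refine Runs.copy (by rw [Ne, reg_inj]; omega) ⟨?_, ?_⟩
  · rw [Function.update_self, h₂.1, Fn.eval]
    congr 1
    funext j
    exact h₁.1 j j.2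
  · exact ((h₁.2.trans h₂.2 (by omega)).update (by omega) _).update le_rfl _

theorem Implementable.iter {n : ℕ} {init : Fn n} {body : Fn (n + 2)} (hi : Implementable init)
    (hb : Implementable body) : Implementable (.iter init body) := by
  intro env s henv hs
  obtain ⟨p, c, hc, hp⟩ := hi env s henv hs
  -- `s`: the value, `s + 1`: the remaining iterations, `s + 2`: the finished iterations
  obtain ⟨q, d, hd, hq⟩ := hb (Matrix.vecCons (s + 2) (Matrix.vecCons s env)) (s + 4)
    (fun i => by
      refine Fin.cases ?_ (fun i => Fin.cases ?_ (fun i => ?_) i) i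
      · simp
      · simp
      · have := henv i
        simp only [Matrix.cons_val_succ]
        omega) (by omega)
  let loopBody : Prog := .seq q (.seq (copyProg (reg s) (reg (s + 4)) (reg (s + 3)))
    (.seq (.const (reg (s + 3)) 1) (.seq (.add (reg (s + 2)) (reg (s + 2)) (reg (s + 3)))
      (.sub (reg (s + 1)) (reg (s + 1)) (reg (s + 3))))))
  let bw : ℕ := copyWeight (reg s) (reg (s + 4)) (reg (s + 3)) + (weight₂ (reg (s + 3)) 1 +
    (weight₃ (reg (s + 2)) (reg (s + 2)) (reg (s + 3)) +
      weight₃ (reg (s + 1)) (reg (s + 1)) (reg (s + 3))))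
  refine ⟨.seq p (.seq (.const (reg (s + 2)) 0)
      (.seq (.add (reg (s + 1)) (reg 0) (reg (s + 2))) (.whilePos (reg (s + 1)) loopBody))),
    fun H => c H + (weight₂ (reg (s + 2)) 0 + (weight₃ (reg (s + 1)) (reg 0) (reg (s + 2)) +
      (H * (weight₁ (reg (s + 1)) + (d H + bw)) + weight₁ (reg (s + 1))))), ?_, ?_⟩
  · exact primrec_add hc (primrec_add (Primrec.const _) (primrec_add (Primrec.const _)
      (primrec_add (primrec_mul Primrec.id (primrec_add (Primrec.const _)
        (primrec_add hd (Primrec.const _)))) (Primrec.const _))))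
  intro w H σ hσ
  set val : ℕ → ℤ := fun j => Nat.rec (init.eval w H fun i => σ (reg (env i)))
    (fun i a => body.eval w H (Matrix.vecCons (i : ℤ) (Matrix.vecCons a fun i => σ (reg (env i))))) j
    with hval
  refine (hp w H σ hσ).seq fun σ₁ h₁ => ?_
  refine Runs.seq (Q := fun σ' => σ' = _) (Runs.const rfl) ?_
  rintro _ rfl
  refine Runs.seq (Q := fun σ' => σ' = _) (Runs.add rfl) ?_
  rintro _ rfl
  -- With `j` iterations remaining, register `s` holds the value after `H - j` iterations. The
  -- counter is a copy, so register `0` still holds `H` for loops inside the body.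
  refine (Runs.while_count (P := fun j σ' => σ' (reg (s + 1)) = j ∧ j ≤ H ∧
    σ' (reg (s + 2)) = (H - j : ℤ) ∧ σ' (reg s) = val (H - j) ∧ Agree s σ σ')
    (fun j σ' h => h.1) ?_ H _ ⟨?_, le_rfl, ?_, ?_, ?_⟩).imp le_rfl ?_
  · rintro j σ₂ ⟨e1, e2, e3, e4, e5⟩
    refine (hq w H σ₂ (hσ.agree e5 hs)).seq fun σ₃ h₃ => ?_
    refine Runs.seq (Q := fun σ' => σ' = _) (Runs.copy (by rw [Ne, reg_inj]; omega) rfl) ?_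
    rintro _ rfl
    refine Runs.seq (Q := fun σ' => σ' = _) (Runs.const rfl) ?_
    rintro _ rfl
    refine Runs.seq (Q := fun σ' => σ' = _) (Runs.add rfl) ?_
    rintro _ rfl
    refine Runs.sub ⟨?_, by omega, ?_, ?_, ?_⟩
    · simp [reg_inj, h₃.2.reg (show s + 1 < s + 4 by omega), e1]
    · simp [reg_inj, h₃.2.reg (show s + 2 < s + 4 by omega), e3]
      ring
    · have hj : H - j = H - (j + 1) + 1 := by omega
      have harg : (fun i => σ₂ (reg (Matrix.vecCons (s + 2) (Matrix.vecCons s env) i))) =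
          Matrix.vecCons ((H - (j + 1) : ℕ) : ℤ) (Matrix.vecCons (val (H - (j + 1)))
            fun i => σ (reg (env i))) := by
        funext i
        refine Fin.cases ?_ (fun i => Fin.cases ?_ (fun i => ?_) i) i
        · simp only [Matrix.cons_val_zero, e3]
          push_cast [Nat.cast_sub e2]
          ring
        · simp only [Matrix.cons_val_succ, Matrix.cons_val_zero, e4]
        · simp only [Matrix.cons_val_succ]
          exact e5.reg (henv i)
      simp only [Function.update_apply, reg_inj]
      simp only [h₃.1, harg, hj, hval]
      simp
    · exact ((((((e5.trans h₃.2 (by omega)).update (by omega) _).update (by omega) _).update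
        (by omega) _).update (by omega) _)).update (by omega) _
  · have : σ₁ (reg 0) = H := (h₁.2.reg hs).trans hσ.bound
    simp only [Function.update_apply, reg_inj]
    rw [if_neg (show ¬ (0 = s + 2) by omega), this]
    simp
  · simp [reg_inj]
  · simp [reg_inj, h₁.1, hval]
  · exact (h₁.2.update (by omega) _).update (by omega) _
  · rintro σ₄ ⟨-, -, -, h4, h5⟩
    exact ⟨h4, h5⟩

/-- The weight bound depends on `H` alone because every loop runs exactly `H` times, whatever the
input word is. -/
theorem implementable {n : ℕ} (f : Fn n) : Implementable f := by
  induction f with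
  | proj i => exact implementable_proj i
  | const c => exact implementable_const c
  | add f g hf hg => exact hf.add hg
  | sub f g hf hg => exact hf.sub hg
  | mul f g hf hg => exact hf.mul hg
  | inp f hf => exact hf.inp
  | ite c f g hc hf hg => exact hc.ite hf hg
  | iter i b hi hb => exact hi.iter hb
  | comp f g hf hg => exact hf.comp hg

/-! ### The driver program -/

/-- Iterated powers of two. -/
def tower (j x : ℕ) : ℕ := (fun y => 2 ^ y)^[j] x

theorem tower_succ (j x : ℕ) : tower (j + 1) x = 2 ^ tower j x := Function.iterate_succ_apply' _ _ _

theorem primrec_two_pow : Primrec fun x : ℕ => 2 ^ x := by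
  have : Primrec fun x : ℕ => Nat.rec (motive := fun _ => ℕ) 1 (fun _ y => y + y) x :=
    Primrec.nat_rec₁ 1 (Primrec.nat_add.comp Primrec.snd Primrec.snd).to₂
  refine this.of_eq fun x => ?_
  induction x with
  | zero => rfl
  | succ x ih => rw [pow_succ, mul_two, ← ih]

theorem primrec_tower (j : ℕ) {c : ℕ → ℕ} (hc : Primrec c) : Primrec fun k => tower j (c k) := by
  induction j with
  | zero => exact hc
  | succ j ih =>
    refine (primrec_two_pow.comp ih).of_eq fun k => ?_
    rw [tower_succ]

/-- Replacing `x` in the register `0` by `2 ^ x`. -/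
theorem exists_prog_two_pow : ∃ (p : Prog) (c : ℕ → ℕ), Primrec c ∧
    ∀ (x : ℕ) (σ : Store), σ (reg 0) = x → Runs p (c x) σ fun σ' =>
      σ' (reg 0) = (2 ^ x : ℕ) ∧ Agree 0 σ σ' := by
  refine ⟨.seq (.const (reg 1) 1) (.seq (.const (reg 2) 1) (.seq
    (.whilePos (reg 0) (.seq (.add (reg 1) (reg 1) (reg 1)) (.sub (reg 0) (reg 0) (reg 2))))
      (copyProg (reg 0) (reg 1) (reg 2)))),
    fun x => weight₂ (reg 1) 1 + (weight₂ (reg 2) 1 + ((x * (weight₁ (reg 0) +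
      (weight₃ (reg 1) (reg 1) (reg 1) + weight₃ (reg 0) (reg 0) (reg 2))) + weight₁ (reg 0)) +
        copyWeight (reg 0) (reg 1) (reg 2))), ?_, fun x σ hσ => ?_⟩
  · exact primrec_add (Primrec.const _) (primrec_add (Primrec.const _) (primrec_add
      (primrec_add (primrec_mul Primrec.id (Primrec.const _)) (Primrec.const _)) (Primrec.const _)))
  refine Runs.seq (Q := fun σ' => σ' = _) (Runs.const rfl) ?_
  rintro _ rfl
  refine Runs.seq (Q := fun σ' => σ' = _) (Runs.const rfl) ?_
  rintro _ rfl
  refine (Runs.while_count (P := fun j σ' => σ' (reg 0) = j ∧ j ≤ x ∧ σ' (reg 2) = 1 ∧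
    σ' (reg 1) = (2 ^ (x - j) : ℕ) ∧ Agree 0 σ σ') (fun j σ' h => h.1) ?_ x _
      ⟨?_, le_rfl, ?_, ?_, ?_⟩).seq ?_
  · rintro j σ₁ ⟨e1, e2, e3, e4, e5⟩
    refine Runs.seq (Q := fun σ' => σ' = _) (Runs.add rfl) ?_
    rintro _ rfl
    refine Runs.sub ⟨?_, by omega, ?_, ?_, (e5.update (by omega) _).update (by omega) _⟩
    · simp [reg_inj, e1, e3]
    · simp [reg_inj, e3]
    · have : x - j = x - (j + 1) + 1 := by omega
      rw [this, pow_succ]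
      simp only [ne_eq, reg_inj, one_ne_zero, not_false_eq_true, Function.update_of_ne,
        Function.update_self, e4]
      push_cast
      ring
  · simp [reg_inj, hσ]
  · simp
  · simp [reg_inj]
  · exact ((Agree.refl 0 σ).update (by omega) _).update (by omega) _
  · rintro σ₁ ⟨-, -, -, e4, e5⟩
    refine Runs.copy (by rw [Ne, reg_inj]; omega) ⟨?_, (e5.update (by omega) _).update (by omega) _⟩
    rw [Function.update_self, e4, Nat.sub_zero]

theorem exists_prog_tower (j : ℕ) : ∃ (p : Prog) (c : ℕ → ℕ), Primrec c ∧
    ∀ (x : ℕ) (σ : Store), σ (reg 0) = x → Runs p (c x) σ fun σ' =>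
      σ' (reg 0) = tower j x ∧ Agree 0 σ σ' := by
  induction j with
  | zero =>
    refine ⟨.const (reg 1) 0, fun _ => weight₂ (reg 1) 0, Primrec.const _, fun x σ hσ =>
      Runs.const ⟨?_, (Agree.refl 0 σ).update (by omega) _⟩⟩
    simp [reg_inj, hσ, tower]
  | succ j ih =>
    obtain ⟨p, c, hc, hp⟩ := ih
    obtain ⟨q, d, hd, hq⟩ := exists_prog_two_pow
    refine ⟨.seq p q, fun x => c x + d (tower j x),
      primrec_add hc (hd.comp (primrec_tower j Primrec.id)), fun x σ hσ => ?_⟩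
    refine (hp x σ hσ).seq fun σ₁ h₁ => ?_
    refine (hq _ σ₁ h₁.1).imp le_rfl fun σ₂ h₂ => ⟨?_, h₁.2.trans h₂.2 le_rfl⟩
    rw [tower_succ]
    exact h₂.1

/-- Copying the input word to the addresses `slot i`. -/
theorem exists_prog_copy : ∃ (p : Prog) (c : ℕ → ℕ), Primrec c ∧
    ∀ (k : ℕ) (w : ℕ → ℤ) (σ : Store), (∀ i : ℕ, σ i = w i) → (∀ i, σ (slot i) = 0) → w 0 = k →
      (∀ i, 8 * k < i → w i = 0) → Runs p (c k) σ fun σ' =>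
        (∀ i : ℕ, σ' i = w i) ∧ ∀ i, σ' (slot i) = w i := by
  refine ⟨.seq (.const (reg 1) 8) (.seq (.mul (reg 1) 0 (reg 1)) (.seq (.const (reg 2) 1)
    (.seq (.add (reg 1) (reg 1) (reg 2)) (.whilePos (reg 1) (.seq (.sub (reg 1) (reg 1) (reg 2))
      (.seq (.load (reg 3) (reg 1)) (.seq (.const (reg 4) (-2)) (.seq (.mul (reg 5) (reg 1) (reg 4))
        (.seq (.add (reg 5) (reg 5) (reg 4)) (.store (reg 5) (reg 3))))))))))),
    fun k => weight₂ (reg 1) 8 + (weight₃ (reg 1) 0 (reg 1) + (weight₂ (reg 2) 1 +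
      (weight₃ (reg 1) (reg 1) (reg 2) + ((8 * k + 1) * (weight₁ (reg 1) +
        (weight₃ (reg 1) (reg 1) (reg 2) + (weight₂ (reg 3) (reg 1) + (weight₂ (reg 4) (-2) +
          (weight₃ (reg 5) (reg 1) (reg 4) + (weight₃ (reg 5) (reg 5) (reg 4) +
            weight₂ (reg 5) (reg 3))))))) + weight₁ (reg 1))))), ?_, fun k w σ h1 h2 h3 h4 => ?_⟩
  · exact primrec_add (Primrec.const _) (primrec_add (Primrec.const _) (primrec_add
      (Primrec.const _) (primrec_add (Primrec.const _) (primrec_add (primrec_mul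
        (primrec_add (primrec_mul (Primrec.const _) Primrec.id) (Primrec.const _))
          (Primrec.const _)) (Primrec.const _)))))
  have h0 : ∀ r, (0 : ℤ) ≠ reg r := fun r => by simpa using nat_ne_reg 0 r
  refine Runs.seq (Q := fun σ' => σ' = _) (Runs.const rfl) ?_
  rintro _ rfl
  refine Runs.seq (Q := fun σ' => σ' = _) (Runs.mul rfl) ?_
  rintro _ rfl
  refine Runs.seq (Q := fun σ' => σ' = _) (Runs.const rfl) ?_
  rintro _ rfl
  refine Runs.seq (Q := fun σ' => σ' = _) (Runs.add rfl) ?_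
  rintro _ rfl
  -- The entries are copied from index `8 * k` down to `0`. The slots beyond are correct from the
  -- start, since they are `0` and so is the word there.
  refine (Runs.while_count (P := fun j σ' => σ' (reg 1) = j ∧ σ' (reg 2) = 1 ∧
    (∀ i : ℕ, σ' i = w i) ∧ ∀ i, j ≤ i → σ' (slot i) = w i) (fun j σ' h => h.1) ?_ (8 * k + 1) _
      ⟨?_, ?_, ?_, ?_⟩).imp le_rfl ?_
  · rintro j σ₁ ⟨e1, e2, e3, e4⟩
    have ej : ((j + 1 : ℕ) : ℤ) - 1 = (j : ℕ) := by push_cast; ring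
    refine Runs.seq (Q := fun σ' => σ' = _) (Runs.sub rfl) ?_
    rintro _ rfl
    rw [e1, e2, ej]
    refine Runs.seq (Q := fun σ' => σ' = _) (Runs.load rfl) ?_
    rintro _ rfl
    refine Runs.seq (Q := fun σ' => σ' = _) (Runs.const rfl) ?_
    rintro _ rfl
    refine Runs.seq (Q := fun σ' => σ' = _) (Runs.mul rfl) ?_
    rintro _ rfl
    refine Runs.seq (Q := fun σ' => σ' (reg 5) = slot j ∧ σ' (reg 3) = w j ∧ σ' (reg 1) = j ∧
      σ' (reg 2) = 1 ∧ Agree 0 σ₁ σ') (Runs.add ⟨?_, ?_, ?_, ?_, ?_⟩) ?_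
    · simp [reg_inj, slot]
      ring
    · simp [reg_inj, nat_ne_reg, e3]
    · simp [reg_inj]
    · simp [reg_inj, e2]
    · exact (((((Agree.refl 0 σ₁).update (by omega) _).update (by omega) _).update
        (by omega) _).update (by omega) _).update (by omega) _
    · rintro σ₂ ⟨f5, f3, f1, f2, fA⟩
      refine Runs.store ?_
      rw [f5, f3]
      refine ⟨?_, ?_, fun i => ?_, fun i hi => ?_⟩
      · rw [Function.update_of_ne (slot_ne_reg _ _).symm, f1]
      · rw [Function.update_of_ne (slot_ne_reg _ _).symm, f2]
      · rw [Function.update_of_ne (nat_ne_slot _ _), fA.nat, e3]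
      · rcases hi.eq_or_lt with rfl | hi
        · rw [Function.update_self]
        · rw [Function.update_of_ne (by rw [Ne, slot_inj]; omega), fA.slot, e4 i hi]
  · have := h1 0
    simp only [Nat.cast_zero] at this
    simp [reg_inj, h0, this, h3]
    ring
  · simp [reg_inj]
  · intro i
    simp [nat_ne_reg, h1]
  · intro i hi
    simp [slot_ne_reg, h2, h4 i (by omega)]
  · rintro σ₁ ⟨-, -, e3, e4⟩
    exact ⟨e3, fun i => e4 i (Nat.zero_le i)⟩

/-- Writing the values of `outF` as an output word of length `lenF`. -/
theorem exists_prog_output (lenF : Fn 0) (outF : Fn 1) : ∃ (p : Prog) (c : ℕ → ℕ), Primrec c ∧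
    ∀ (w : ℕ → ℤ) (H len : ℕ) (σ : Store), Loaded w H σ → lenF.eval w H ![] = len → len ≤ H →
      Runs p (c H) σ fun σ' => σ' 0 = len ∧
        ∀ j : ℕ, j < len → σ' ((j : ℤ) + 1) = outF.eval w H ![(j : ℤ)] := by
  obtain ⟨p, c, hc, hp⟩ := implementable lenF Fin.elim0 1 (fun i => i.elim0) (by omega)
  obtain ⟨q, d, hd, hq⟩ := implementable outF (fun _ => 1) 2 (fun _ => by omega) (by omega)
  have h0 : ∀ r, (0 : ℤ) ≠ reg r := fun r => by simpa using nat_ne_reg 0 r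
  have h1 : ∀ j r : ℕ, (j : ℤ) + 1 ≠ reg r := fun j r => by simpa using nat_ne_reg (j + 1) r
  refine ⟨.seq p (.seq (.whilePos (reg 1) (.seq (.const (reg 2) 1) (.seq
    (.sub (reg 1) (reg 1) (reg 2)) (.seq q (.seq (.const (reg 3) 1)
      (.seq (.add (reg 3) (reg 1) (reg 3)) (.store (reg 3) (reg 2)))))))) (.seq p
        (copyProg 0 (reg 1) (reg 2)))),
    fun H => c H + ((H * (weight₁ (reg 1) + (weight₂ (reg 2) 1 + (weight₃ (reg 1) (reg 1) (reg 2) +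
      (d H + (weight₂ (reg 3) 1 + (weight₃ (reg 3) (reg 1) (reg 3) +
        weight₂ (reg 3) (reg 2))))))) + weight₁ (reg 1)) +
          (c H + copyWeight 0 (reg 1) (reg 2))), ?_, fun w H len σ hσ hlen hH => ?_⟩
  · exact primrec_add hc (primrec_add (primrec_add (primrec_mul Primrec.id (primrec_add
      (Primrec.const _) (primrec_add (Primrec.const _) (primrec_add (Primrec.const _)
        (primrec_add hd (Primrec.const _)))))) (Primrec.const _))
          (primrec_add hc (Primrec.const _)))
  have hlen' : ∀ v : Fin 0 → ℤ, lenF.eval w H v = len := fun v => by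
    rw [Subsingleton.elim v ![], hlen]
  refine (hp w H σ hσ).seq fun σ₁ g₁ => ?_
  rw [hlen'] at g₁
  -- The output is written from its last entry to its first. It may overwrite the input word, as the
  -- evaluation only reads the copy in the slots.
  refine Runs.seq (Q := fun σ' => Loaded w H σ' ∧
      ∀ j : ℕ, j < len → σ' ((j : ℤ) + 1) = outF.eval w H ![(j : ℤ)])
    ((Runs.while_count (N := weight₂ (reg 2) 1 + (weight₃ (reg 1) (reg 1) (reg 2) +
      (d H + (weight₂ (reg 3) 1 + (weight₃ (reg 3) (reg 1) (reg 3) + weight₂ (reg 3) (reg 2))))))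
      (P := fun j σ' => σ' (reg 1) = j ∧ Loaded w H σ' ∧
      ∀ i : ℕ, j ≤ i → i < len → σ' ((i : ℤ) + 1) = outF.eval w H ![(i : ℤ)])
        (fun j σ' h => h.1) ?_ len σ₁ ⟨g₁.1, hσ.agree g₁.2 (by omega), ?_⟩).imp ?_ ?_) ?_
  · rintro j σ₂ ⟨e1, e2, e3⟩
    refine Runs.seq (Q := fun σ' => σ' = _) (Runs.const rfl) ?_
    rintro _ rfl
    refine Runs.seq (Q := fun σ' => σ' = _) (Runs.sub rfl) ?_
    rintro _ rfl
    have ej : ((j + 1 : ℕ) : ℤ) - 1 = (j : ℕ) := by push_cast; ring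
    have hA : Agree 1 σ₂ (Function.update (Function.update σ₂ (reg 2) 1) (reg 1) (j : ℤ)) :=
      ((Agree.refl 1 σ₂).update (by omega) _).update (by omega) _
    have hval : Function.update σ₂ (reg 2) 1 (reg 1) - Function.update σ₂ (reg 2) 1 (reg 2) =
        (j : ℤ) := by
      rw [Function.update_self, Function.update_of_ne (by rw [Ne, reg_inj]; omega), e1, ej]
    rw [hval]
    refine (hq w H _ (e2.agree hA (by omega))).seq fun σ₃ g₃ => ?_
    simp only [Function.update_self] at g₃
    have hr1 : σ₃ (reg 1) = j := by
      rw [g₃.2.reg (by omega), Function.update_self]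
    refine Runs.seq (Q := fun σ' => σ' = _) (Runs.const rfl) ?_
    rintro _ rfl
    refine Runs.seq (Q := fun σ' => σ' = _) (Runs.add rfl) ?_
    rintro _ rfl
    refine Runs.store ?_
    have hout : (fun _ : Fin 1 => (j : ℤ)) = ![(j : ℤ)] := by
      funext i
      fin_cases i
      rfl
    simp only [ne_eq, reg_inj, Function.update_self, show ¬ (1 = 3) by omega,
      show ¬ (2 = 3) by omega, not_false_eq_true, Function.update_of_ne, hr1, g₃.1, hout]
    refine ⟨?_, ⟨?_, fun i => ?_⟩, fun i hi hil => ?_⟩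
    · rw [Function.update_of_ne (h1 j 1).symm]
      simp [reg_inj, hr1]
    · rw [Function.update_of_ne (h1 j 0).symm]
      simp only [ne_eq, reg_inj, show ¬ (0 = 3) by omega, not_false_eq_true,
        Function.update_of_ne]
      rw [g₃.2.reg (by omega), hA.reg (by omega), e2.bound]
    · have hs : slot i ≠ (j : ℤ) + 1 := by simpa using (nat_ne_slot (j + 1) i).symm
      rw [Function.update_of_ne hs, Function.update_of_ne (slot_ne_reg _ _),
        Function.update_of_ne (slot_ne_reg _ _), g₃.2.slot, hA.slot, e2.word]
    · rcases hi.eq_or_lt with rfl | hi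
      · rw [Function.update_self]
      · have hne : (i : ℤ) + 1 ≠ (j : ℤ) + 1 := by omega
        rw [Function.update_of_ne hne, Function.update_of_ne (h1 i 3),
          Function.update_of_ne (h1 i 3)]
        have hi1 := g₃.2.nat (i + 1)
        have hi2 := hA.nat (i + 1)
        push_cast at hi1 hi2
        rw [hi1, hi2, e3 i hi hil]
  · intro i hi hil
    omega
  · gcongr
  · rintro σ₂ ⟨-, e2, e3⟩
    exact ⟨e2, fun j hj => e3 j (Nat.zero_le j) hj⟩
  · rintro σ₂ ⟨e2, e3⟩
    -- The loop has consumed the length of the output, so it is computed again.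
    refine (hp w H σ₂ e2).seq fun σ₃ g₃ => ?_
    rw [hlen'] at g₃
    refine Runs.copy (by rw [Ne, reg_inj]; omega) ⟨?_, fun j hj => ?_⟩
    · rw [Function.update_self, g₃.1]
    · have hne : (j : ℤ) + 1 ≠ 0 := by omega
      have hj1 := g₃.2.nat (j + 1)
      push_cast at hj1
      rw [Function.update_of_ne hne, Function.update_of_ne (h1 j 2), hj1, e3 j hj]

/-- Loading the input word and the bound `tower J (2 * k + 16)`, and writing the output word. -/
theorem exists_prog (J : ℕ) (lenF : Fn 0) (outF : Fn 1) : ∃ (p : Prog) (c : ℕ → ℕ), Primrec c ∧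
    ∀ (k : ℕ) (w : ℕ → ℤ) (σ : Store), (∀ i : ℕ, σ i = w i) → (∀ i, σ (slot i) = 0) → w 0 = k →
      (∀ i, 8 * k < i → w i = 0) → ∀ len : ℕ, lenF.eval w (tower J (2 * k + 16)) ![] = len →
        len ≤ tower J (2 * k + 16) → Runs p (c k) σ fun σ' => σ' 0 = len ∧
          ∀ j : ℕ, j < len → σ' ((j : ℤ) + 1) = outF.eval w (tower J (2 * k + 16)) ![(j : ℤ)] := by
  obtain ⟨p₁, c₁, hc₁, hp₁⟩ := exists_prog_copy
  obtain ⟨p₂, c₂, hc₂, hp₂⟩ := exists_prog_tower J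
  obtain ⟨p₃, c₃, hc₃, hp₃⟩ := exists_prog_output lenF outF
  have hx : Primrec fun k => 2 * k + 16 :=
    primrec_add (primrec_mul (Primrec.const _) Primrec.id) (Primrec.const _)
  refine ⟨.seq p₁ (.seq (.const (reg 1) 2) (.seq (.mul (reg 0) 0 (reg 1)) (.seq (.const (reg 1) 16)
    (.seq (.add (reg 0) (reg 0) (reg 1)) (.seq p₂ p₃))))),
    fun k => c₁ k + (weight₂ (reg 1) 2 + (weight₃ (reg 0) 0 (reg 1) + (weight₂ (reg 1) 16 +
      (weight₃ (reg 0) (reg 0) (reg 1) + (c₂ (2 * k + 16) + c₃ (tower J (2 * k + 16))))))),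
    primrec_add hc₁ (primrec_add (Primrec.const _) (primrec_add (Primrec.const _) (primrec_add
      (Primrec.const _) (primrec_add (Primrec.const _) (primrec_add (hc₂.comp hx)
        (hc₃.comp (primrec_tower J hx))))))), fun k w σ h1 h2 h3 h4 len h5 h6 => ?_⟩
  refine (hp₁ k w σ h1 h2 h3 h4).seq fun σ₁ g₁ => ?_
  refine Runs.seq (Q := fun σ' => σ' = _) (Runs.const rfl) ?_
  rintro _ rfl
  refine Runs.seq (Q := fun σ' => σ' = _) (Runs.mul rfl) ?_
  rintro _ rfl
  refine Runs.seq (Q := fun σ' => σ' = _) (Runs.const rfl) ?_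
  rintro _ rfl
  refine Runs.seq (Q := fun σ' => σ' = _) (Runs.add rfl) ?_
  rintro _ rfl
  have h0 : ∀ r, (0 : ℤ) ≠ reg r := fun r => by simpa using nat_ne_reg 0 r
  have hk : σ₁ 0 = k := by
    have := g₁.1 0
    rw [h3] at this
    simpa using this
  refine (hp₂ (2 * k + 16) _ ?_).seq fun σ₂ g₂ => ?_
  · simp [reg_inj, h0, hk]
    ring
  · refine hp₃ w _ len σ₂ ⟨g₂.1, fun i => ?_⟩ h5 h6
    rw [g₂.2.slot]
    simp [slot_ne_reg, g₁.2]

theorem outputWord_eq (σ : Store) :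
    outputWord σ = (List.range (σ 0).toNat).map fun j : ℕ => σ ((j : ℤ) + 1) := by
  simp only [outputWord, List.bind_eq_flatMap, List.pure_def, List.map_flatMap, List.map_cons,
    List.map_nil]
  exact (List.map_eq_flatMap).symm

/-- A parameterized problem with answers given by expressions is fixed-parameter tractable. -/
theorem isFPT_of_fn (Q : ParamProblem) (J : ℕ) (lenF : Fn 0) (outF : Fn 1)
    (hlen : ∀ I, (Q.encode I).length = 8 * Q.param I + 1)
    (hparam : ∀ I, (Q.encode I).getD 0 0 = Q.param I)
    (hQ : ∀ I, ∃ len : ℕ, len ≤ tower J (2 * Q.param I + 16) ∧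
      lenF.eval (fun i => (Q.encode I).getD i 0) (tower J (2 * Q.param I + 16)) ![] = len ∧
      Q.Answer I ((List.range len).map fun j : ℕ =>
        outF.eval (fun i => (Q.encode I).getD i 0) (tower J (2 * Q.param I + 16)) ![(j : ℤ)])) :
    Q.IsFPT := by
  obtain ⟨p, c, hc, hp⟩ := exists_prog J lenF outF
  -- The weight `c k` does not depend on the word, so the cost is linear in its length and the
  -- exponent is `1`. The first summand is the factor in `costBound`; the tower bounds the number of
  -- output entries, each of at most `2 ^ c k * wordLen w` bits.
  refine ⟨p, fun k => (c k * 6 + tower J (2 * k + 16)) * 2 ^ c k, 1, ?_, fun I => ?_⟩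
  · refine Primrec.to_comp (primrec_mul (primrec_add (primrec_mul hc (Primrec.const _))
      (primrec_tower J ?_)) (primrec_two_pow.comp hc))
    exact primrec_add (primrec_mul (Primrec.const _) Primrec.id) (Primrec.const _)
  obtain ⟨len, hH, hl, hans⟩ := hQ I
  set k := Q.param I
  set w := Q.encode I
  obtain ⟨σ, hσ, hσ0, hσj⟩ := hp k (fun i => w.getD i 0) (inputStore w)
    (fun i => by simp [inputStore])
    (fun i => if_neg (by simp only [slot]; omega))
    (hparam I) (fun i hi => List.getD_eq_default _ _ (by rw [hlen I]; omega)) len hl hH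
  have hb : ∀ z ∈ w, bitLen z ≤ wordLen w := fun z hz =>
    List.single_le_sum (fun _ _ => Nat.zero_le _) _ (List.mem_map_of_mem hz)
  have hw : 1 ≤ wordLen w := by
    have hne : w ≠ [] := by
      intro h
      have := hlen I
      rw [show Q.encode I = [] from h] at this
      simp at this
    obtain ⟨z, hz⟩ := List.exists_mem_of_ne_nil w hne
    exact (bitLen_pos z).trans (hb z hz)
  have hbound : BitBound (inputStore w) (wordLen w) := by
    intro r
    simp only [inputStore]
    split_ifs
    · rw [List.getD_eq_getElem?_getD]
      rcases h : w[r.toNat]? with _ | z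
      · simpa [bitLen_zero] using hw
      · simpa using hb z (List.mem_of_getElem? h)
    · simpa [bitLen_zero] using hw
  obtain ⟨t, ht, htc, hσb⟩ := hσ (wordLen w) hw hbound
  have hout : outputWord σ = (List.range len).map fun j : ℕ =>
      outF.eval (fun i => w.getD i 0) (tower J (2 * k + 16)) ![(j : ℤ)] := by
    rw [outputWord_eq, hσ0, Int.toNat_natCast]
    exact List.map_congr_left fun j hj => hσj j (List.mem_range.1 hj)
  refine ⟨σ, t, ht, ?_, by rw [hout]; exact hans⟩
  have hwl : wordLen (outputWord σ) ≤ len * (2 ^ c k * wordLen w) := by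
    have h := List.sum_le_card_nsmul ((outputWord σ).map bitLen) (2 ^ c k * wordLen w) fun n hn => by
      obtain ⟨z, hz, rfl⟩ := List.mem_map.1 hn
      rw [outputWord_eq] at hz
      obtain ⟨j, -, rfl⟩ := List.mem_map.1 hz
      exact hσb _
    have hlen' : (outputWord σ).length = len := by simp [outputWord_eq, hσ0]
    simpa [wordLen, hlen'] using h
  calc t + wordLen (outputWord σ)
      ≤ c k * (6 * 2 ^ c k * wordLen w) + tower J (2 * k + 16) * (2 ^ c k * wordLen w) :=
        add_le_add htc (hwl.trans (Nat.mul_le_mul_right _ hH))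
    _ = (c k * 6 + tower J (2 * k + 16)) * 2 ^ c k * wordLen w ^ 1 := by ring

/-! ### Derived expressions -/

namespace Fn

variable {n : ℕ}

instance : Add (Fn n) := ⟨Fn.add⟩
instance : Sub (Fn n) := ⟨Fn.sub⟩
instance : Mul (Fn n) := ⟨Fn.mul⟩
instance (m : ℕ) : OfNat (Fn n) m := ⟨Fn.const m⟩

variable (w : ℕ → ℤ) (H : ℕ) (v : Fin n → ℤ)

@[simp] theorem eval_proj (i : Fin n) : (Fn.proj i).eval w H v = v i := rfl
@[simp] theorem eval_const (c : ℤ) : (Fn.const c : Fn n).eval w H v = c := rfl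
@[simp] theorem eval_add (f g : Fn n) : (f + g).eval w H v = f.eval w H v + g.eval w H v := rfl
@[simp] theorem eval_sub (f g : Fn n) : (f - g).eval w H v = f.eval w H v - g.eval w H v := rfl
@[simp] theorem eval_mul (f g : Fn n) : (f * g).eval w H v = f.eval w H v * g.eval w H v := rfl
@[simp] theorem eval_zero : (0 : Fn n).eval w H v = 0 := rfl
@[simp] theorem eval_one : (1 : Fn n).eval w H v = 1 := rfl
@[simp] theorem eval_two : (2 : Fn n).eval w H v = 2 := rfl
@[simp] theorem eval_three : (3 : Fn n).eval w H v = 3 := rfl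
@[simp] theorem eval_four : (4 : Fn n).eval w H v = 4 := rfl
@[simp] theorem eval_six : (6 : Fn n).eval w H v = 6 := rfl
@[simp] theorem eval_sixteen : (16 : Fn n).eval w H v = 16 := rfl
@[simp] theorem eval_ite (c f g : Fn n) : (Fn.ite c f g).eval w H v =
    if 0 < c.eval w H v then f.eval w H v else g.eval w H v := rfl

theorem eval_inp {f : Fn n} {i : ℕ} (h : f.eval w H v = i) : (Fn.inp f).eval w H v = w i := by
  simp [Fn.eval, h]

/-- Application to one argument. -/
def call₁ (f : Fn 1) (a : Fn n) : Fn n := .comp f ![a]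

/-- Application to two arguments. -/
def call₂ (f : Fn 2) (a b : Fn n) : Fn n := .comp f ![a, b]

/-- Application to three arguments. -/
def call₃ (f : Fn 3) (a b c : Fn n) : Fn n := .comp f ![a, b, c]

/-- Application to four arguments. -/
def call₄ (f : Fn 4) (a b c d : Fn n) : Fn n := .comp f ![a, b, c, d]

@[simp] theorem eval_call₁ (f : Fn 1) (a : Fn n) :
    (call₁ f a).eval w H v = f.eval w H ![a.eval w H v] := by
  simp only [call₁, Fn.eval]
  congr 1
  funext j
  fin_cases j
  rfl

@[simp] theorem eval_call₂ (f : Fn 2) (a b : Fn n) :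
    (call₂ f a b).eval w H v = f.eval w H ![a.eval w H v, b.eval w H v] := by
  simp only [call₂, Fn.eval]
  congr 1
  funext j
  fin_cases j <;> rfl

@[simp] theorem eval_call₃ (f : Fn 3) (a b c : Fn n) :
    (call₃ f a b c).eval w H v = f.eval w H ![a.eval w H v, b.eval w H v, c.eval w H v] := by
  simp only [call₃, Fn.eval]
  congr 1
  funext j
  fin_cases j <;> rfl

@[simp] theorem eval_call₄ (f : Fn 4) (a b c d : Fn n) : (call₄ f a b c d).eval w H v =
    f.eval w H ![a.eval w H v, b.eval w H v, c.eval w H v, d.eval w H v] := by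
  simp only [call₄, Fn.eval]
  congr 1
  funext j
  fin_cases j <;> rfl

/-- An expression, read with two further variables in front. -/
def lift₂ (f : Fn n) : Fn (n + 2) := .comp f fun j => .proj j.succ.succ

@[simp] theorem eval_lift₂ (f : Fn n) (a b : ℤ) :
    (lift₂ f).eval w H (Matrix.vecCons a (Matrix.vecCons b v)) = f.eval w H v := rfl

/-- The body of a loop that does not depend on the previous value. -/
def liftIndex (f : Fn (n + 1)) : Fn (n + 2) := .comp f (Fin.cons (.proj 0) fun j => .proj j.succ.succ)

@[simp] theorem eval_liftIndex (f : Fn (n + 1)) (a b : ℤ) :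
    (liftIndex f).eval w H (Matrix.vecCons a (Matrix.vecCons b v)) =
      f.eval w H (Matrix.vecCons a v) := by
  simp only [liftIndex, Fn.eval]
  congr 1
  funext j
  refine Fin.cases rfl (fun j => rfl) j

/-- Iteration with a prescribed number of iterations. -/
def iterN (N init : Fn n) (body : Fn (n + 2)) : Fn n :=
  .iter init (.ite (lift₂ N - .proj 0) body (.proj 1))

/-- The loop runs `H` times in any case, but the value is frozen after the first `m` rounds. -/
theorem eval_iterN {N init : Fn n} {body : Fn (n + 2)} {m : ℕ} (hN : N.eval w H v = m)
    (hm : m ≤ H) : (iterN N init body).eval w H v = Nat.rec (init.eval w H v)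
      (fun i a => body.eval w H (Matrix.vecCons (i : ℤ) (Matrix.vecCons a v))) m := by
  have key : ∀ j, (Nat.rec (init.eval w H v) (fun i a => (Fn.ite (lift₂ N - .proj 0) body
      (.proj 1)).eval w H (Matrix.vecCons (i : ℤ) (Matrix.vecCons a v))) j : ℤ) =
      Nat.rec (init.eval w H v)
        (fun i a => body.eval w H (Matrix.vecCons (i : ℤ) (Matrix.vecCons a v))) (min j m) := by
    intro j
    induction j with
    | zero => simp
    | succ j ih =>
      simp only [ih]
      simp only [eval_ite, eval_sub, eval_lift₂, hN, eval_proj, Matrix.cons_val_zero]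
      by_cases h : j < m
      · have h1 : min j m = j := min_eq_left h.le
        have h2 : min (j + 1) m = j + 1 := min_eq_left h
        rw [if_pos (by omega), h1, h2]
      · have h1 : min j m = m := min_eq_right (by omega)
        have h2 : min (j + 1) m = m := min_eq_right (by omega)
        rw [if_neg (by omega), h1, h2]
        simp
  have := key H
  rw [min_eq_right hm] at this
  exact this

/-- Finite sums. -/
def sumN (N : Fn n) (body : Fn (n + 1)) : Fn n := iterN N 0 (.proj 1 + liftIndex body)

theorem eval_sumN {N : Fn n} {body : Fn (n + 1)} {m : ℕ} (hN : N.eval w H v = m) (hm : m ≤ H) :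
    (sumN N body).eval w H v =
      ∑ i ∈ Finset.range m, body.eval w H (Matrix.vecCons (i : ℤ) v) := by
  rw [sumN, eval_iterN w H v hN hm]
  clear hN hm
  induction m with
  | zero => simp
  | succ m ih =>
    rw [Finset.sum_range_succ, ← ih]
    simp

/-- Finite products. -/
def prodN (N : Fn n) (body : Fn (n + 1)) : Fn n := iterN N 1 (.proj 1 * liftIndex body)

theorem eval_prodN {N : Fn n} {body : Fn (n + 1)} {m : ℕ} (hN : N.eval w H v = m) (hm : m ≤ H) :
    (prodN N body).eval w H v =
      ∏ i ∈ Finset.range m, body.eval w H (Matrix.vecCons (i : ℤ) v) := by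
  rw [prodN, eval_iterN w H v hN hm]
  clear hN hm
  induction m with
  | zero => simp
  | succ m ih =>
    rw [Finset.prod_range_succ, ← ih]
    simp

/-- Finite maxima of nonnegative numbers. -/
def maxN (N : Fn n) (body : Fn (n + 1)) : Fn n :=
  iterN N 0 (.ite (liftIndex body - .proj 1) (liftIndex body) (.proj 1))

end Fn

/-- The maximum of `0` and the numbers `g 0, …, g (m - 1)`. -/
def maxRange (g : ℕ → ℤ) : ℕ → ℤ
  | 0 => 0
  | m + 1 => max (maxRange g m) (g m)

theorem maxRange_nonneg (g : ℕ → ℤ) (m : ℕ) : 0 ≤ maxRange g m := by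
  induction m with
  | zero => exact le_rfl
  | succ m ih => exact le_max_of_le_left ih

theorem le_maxRange (g : ℕ → ℤ) {m i : ℕ} (h : i < m) : g i ≤ maxRange g m := by
  induction m with
  | zero => omega
  | succ m ih =>
    rcases Nat.lt_succ_iff_lt_or_eq.1 h with h | rfl
    · exact le_max_of_le_left (ih h)
    · exact le_max_right _ _

theorem maxRange_eq_zero_or (g : ℕ → ℤ) (m : ℕ) :
    maxRange g m = 0 ∨ ∃ i < m, maxRange g m = g i := by
  induction m with
  | zero => exact Or.inl rfl
  | succ m ih =>
    rcases max_choice (maxRange g m) (g m) with h | h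
    · rcases ih with h' | ⟨i, hi, h'⟩
      · exact Or.inl (h.trans h')
      · exact Or.inr ⟨i, by omega, h.trans h'⟩
    · exact Or.inr ⟨m, by omega, h⟩

namespace Fn

variable {n : ℕ} (w : ℕ → ℤ) (H : ℕ) (v : Fin n → ℤ)

theorem eval_maxN {N : Fn n} {body : Fn (n + 1)} {m : ℕ} (hN : N.eval w H v = m) (hm : m ≤ H) :
    (maxN N body).eval w H v = maxRange (fun i => body.eval w H (Matrix.vecCons (i : ℤ) v)) m := by
  rw [maxN, eval_iterN w H v hN hm]
  clear hN hm
  induction m with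
  | zero => simp [maxRange]
  | succ m ih =>
    simp only [ih]
    simp only [maxRange, eval_ite, eval_sub, eval_liftIndex, eval_proj, Matrix.cons_val_one,
      Matrix.cons_val_zero]
    split_ifs with h
    · rw [max_eq_right (by omega)]
    · rw [max_eq_left (by omega)]

/-- The quotient of nonnegative integers. -/
def quot : Fn 2 :=
  .iter 0 (.proj 1 + .ite (.proj 2 + 1 - (.proj 0 + 1) * .proj 3) 1 0)

/-- The loop counts the `i` with `(i + 1) * p ≤ c`. There are `c / p` of them, and all are below `H`
because `c ≤ H`. -/
theorem eval_quot {c p : ℕ} (hc : c ≤ H) (hp : 0 < p) :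
    quot.eval w H ![(c : ℤ), (p : ℤ)] = (c / p : ℕ) := by
  have key : ∀ j, (Nat.rec 0 (fun i a => (Fn.proj 1 + .ite (.proj 2 + 1 - (.proj 0 + 1) * .proj 3)
      1 0 : Fn 4).eval w H (Matrix.vecCons (i : ℤ) (Matrix.vecCons a ![(c : ℤ), (p : ℤ)]))) j : ℤ) =
      (min j (c / p) : ℕ) := by
    intro j
    induction j with
    | zero => simp
    | succ j ih =>
      simp only [ih]
      have hiff : 0 < (c : ℤ) + 1 - (j + 1) * p ↔ j + 1 ≤ c / p := by
        rw [Nat.le_div_iff_mul_le hp]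
        zify
        omega
      have he : (Fn.proj 1 + .ite (.proj 2 + 1 - (.proj 0 + 1) * .proj 3) 1 0 : Fn 4).eval w H
          (Matrix.vecCons (j : ℤ) (Matrix.vecCons ((min j (c / p) : ℕ) : ℤ) ![(c : ℤ), (p : ℤ)])) =
          ((min j (c / p) : ℕ) : ℤ) + if 0 < (c : ℤ) + 1 - (j + 1) * p then 1 else 0 := rfl
      rw [he]
      simp only [hiff]
      split_ifs <;> push_cast <;> omega
  have := key H
  rw [min_eq_right ((Nat.div_le_self c p).trans hc)] at this
  exact this

/-- The absolute value. -/
def abs : Fn 1 := .ite (.proj 0) (.proj 0) (0 - .proj 0)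

theorem eval_abs (x : ℤ) : Fn.abs.eval w H ![x] = |x| := by
  have : Fn.abs.eval w H ![x] = if 0 < x then x else 0 - x := rfl
  rw [this]
  split_ifs with h
  · rw [abs_of_pos h]
  · rw [abs_of_nonpos (by omega), zero_sub]

/-- The truth value of `0 ≤ x ∧ 0 ≤ y`. -/
def bothNonneg : Fn 2 := .ite (.proj 0 + 1) (.ite (.proj 1 + 1) 1 0) 0

theorem eval_bothNonneg (x y : ℤ) :
    bothNonneg.eval w H ![x, y] = if 0 ≤ x ∧ 0 ≤ y then 1 else 0 := by
  have : bothNonneg.eval w H ![x, y] = if 0 < x + 1 then if 0 < y + 1 then 1 else 0 else 0 := rfl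
  rw [this]
  split_ifs <;> first | rfl | omega

end Fn

/-! ### The search for an optimal path -/

/-- The number of legs of the paths. -/
def legs (k : ℕ) : ℕ := tower 2 (2 * k + 16)

/-- The common denominator of the coefficients. -/
def denom (k : ℕ) : ℕ := (tower 4 (2 * k + 16)).factorial

/-- The bound on the numerators of the coefficients. -/
def offset (k : ℕ) : ℕ := denom k * tower 4 (2 * k + 16)

/-- The number of values of a coefficient. -/
def radix (k : ℕ) : ℕ := 2 * offset k + 1

/-- The input coordinate with index `j`, and `1` for `j = 4 * k`, multiplied by all denominators. -/
def entry (w : ℕ → ℤ) (k j : ℕ) : ℤ :=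
  ∏ q ∈ Finset.range (4 * k), if q = j then w (2 * q + 1) else w (2 * q + 2)

/-- The `t`-th coefficient that is encoded by `c`. -/
def coeff (k c t : ℕ) : ℤ := ((c / radix k ^ t % radix k : ℕ) : ℤ) - offset k

/-- The index of the `j`-th coefficient of the coordinate `d` of robot `i` in the `u`-th
configuration. -/
def coeffIndex (k u i d j : ℕ) : ℕ := ((u * k + i) * 2 + d) * (4 * k + 1) + j

/-- The coordinate `d` of robot `i` in the `u`-th configuration of the path encoded by `c`,
multiplied by all denominators. -/
def coord (w : ℕ → ℤ) (k c u i d : ℕ) : ℤ :=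
  if 0 < u then
    if u < legs k then
      ∑ j ∈ Finset.range (4 * k + 1), coeff k c (coeffIndex k u i d j) * entry w k j
    else denom k * entry w k (4 * i + 2 + d)
  else denom k * entry w k (4 * i + d)

/-- The distance that robot `i` travels in the leg `u`. -/
def dist₁ (w : ℕ → ℤ) (k c u i : ℕ) : ℤ :=
  |coord w k c (u + 1) i 0 - coord w k c u i 0| + |coord w k c (u + 1) i 1 - coord w k c u i 1|

/-- The duration of the leg `u`. -/
def duration (w : ℕ → ℤ) (k c u : ℕ) : ℤ := maxRange (dist₁ w k c u) k

/-- The time at which the path encoded by `c` reaches its `u`-th configuration. -/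
def time (w : ℕ → ℤ) (k c u : ℕ) : ℤ := ∑ j ∈ Finset.range u, duration w k c j

/-- The amount by which robot `i` is separated from robot `j` in the coordinate `d`. -/
def gap (w : ℕ → ℤ) (k c u i j d : ℕ) : ℤ :=
  coord w k c u i d - coord w k c u j d - denom k * entry w k (4 * k)

/-- Robot `i` exceeds robot `j` in the coordinate `d` at both ends of the leg `u`. -/
def Separated (w : ℕ → ℤ) (k c u i j d : ℕ) : Prop :=
  0 ≤ gap w k c u i j d ∧ 0 ≤ gap w k c (u + 1) i j d

instance (w : ℕ → ℤ) (k c u i j d : ℕ) : Decidable (Separated w k c u i j d) :=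
  inferInstanceAs (Decidable (_ ∧ _))

/-- The relative position of the robots `i < j` changes in the leg `u`. -/
def Conflict (w : ℕ → ℤ) (k c u i j : ℕ) : Prop :=
  i < j ∧ ¬ (Separated w k c u i j 0 ∨ Separated w k c u j i 0 ∨ Separated w k c u i j 1 ∨
    Separated w k c u j i 1)

instance (w : ℕ → ℤ) (k c u i j : ℕ) : Decidable (Conflict w k c u i j) :=
  inferInstanceAs (Decidable (_ ∧ _))

/-- The number of conflicts of the path encoded by `c`. -/
def conflicts (w : ℕ → ℤ) (k c : ℕ) : ℤ :=
  ∑ u ∈ Finset.range (legs k), ∑ i ∈ Finset.range k, ∑ j ∈ Finset.range k,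
    if Conflict w k c u i j then 1 else 0

/-- The first number below `H` that encodes a path without conflicts of smallest duration, or `-1`
if there is none. -/
def best (w : ℕ → ℤ) (k : ℕ) : ℕ → ℤ
  | 0 => -1
  | c + 1 =>
    if 0 < conflicts w k c then best w k c
    else if best w k c < 0 ∨ time w k c (legs k) < time w k (best w k c).toNat (legs k) then c
    else best w k c

theorem best_spec (w : ℕ → ℤ) (k H : ℕ) :
    (best w k H = -1 ∧ ∀ c < H, 0 < conflicts w k c) ∨
    ∃ b : ℕ, best w k H = b ∧ b < H ∧ ¬ 0 < conflicts w k b ∧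
      ∀ c < H, ¬ 0 < conflicts w k c → time w k b (legs k) ≤ time w k c (legs k) := by
  induction H with
  | zero => exact Or.inl ⟨rfl, fun c hc => absurd hc (Nat.not_lt_zero c)⟩
  | succ H ih =>
    rw [best]
    split_ifs with h1 h2
    · rcases ih with ⟨e, h⟩ | ⟨b, e, hb, hb', h⟩
      · refine Or.inl ⟨e, fun c hc => ?_⟩
        rcases Nat.lt_succ_iff_lt_or_eq.1 hc with hc | rfl
        · exact h c hc
        · exact h1
      · refine Or.inr ⟨b, e, by omega, hb', fun c hc hc' => ?_⟩
        rcases Nat.lt_succ_iff_lt_or_eq.1 hc with hc | rfl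
        · exact h c hc hc'
        · exact absurd h1 hc'
    · refine Or.inr ⟨H, rfl, by omega, h1, fun c hc hc' => ?_⟩
      rcases Nat.lt_succ_iff_lt_or_eq.1 hc with hc | rfl
      · rcases ih with ⟨_, h⟩ | ⟨b, e, hb, hb', h⟩
        · exact absurd (h c hc) hc'
        · rw [e] at h2
          simp only [Int.toNat_natCast] at h2
          rcases h2 with h2 | h2
          · omega
          · exact h2.le.trans (h c hc hc')
      · exact le_rfl
    · rcases ih with ⟨e, h⟩ | ⟨b, e, hb, hb', h⟩
      · rw [e] at h2
        exact absurd (Or.inl (by norm_num)) h2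
      · refine Or.inr ⟨b, e, by omega, hb', fun c hc hc' => ?_⟩
        rcases Nat.lt_succ_iff_lt_or_eq.1 hc with hc | rfl
        · exact h c hc hc'
        · rw [e] at h2
          simp only [Int.toNat_natCast, not_or, not_lt] at h2
          exact h2.2

/-- The entry with index `t` of the output word. -/
def outputEntry (w : ℕ → ℤ) (k b t : ℕ) : ℤ :=
  if 0 < t then
    if 1 < t then
      if 2 < t then
        let q := (t - 3) / 6
        let r := (t - 3) % 6
        let i := q / (legs k + 1)
        let u := q % (legs k + 1)
        if 0 < r then
          if 1 < r then
            if 2 < r then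
              if 3 < r then
                if 4 < r then denom k * entry w k (4 * k)
                else coord w k b u i 1
              else denom k * entry w k (4 * k)
            else coord w k b u i 0
          else denom k * entry w k (4 * k)
        else time w k b u
      else legs k
    else denom k * entry w k (4 * k)
  else time w k b (legs k)

/-! ### The search as an expression -/

namespace Fn

/-- The number of robots. -/
def robots {n : ℕ} : Fn n := .inp 0

/-- Iterated powers of two. -/
def towerF {n : ℕ} : ℕ → Fn n
  | 0 => 2 * robots + 16
  | j + 1 => prodN (towerF j) 2

/-- See `legs`. -/
def legsF {n : ℕ} : Fn n := towerF 2

/-- See `denom`. -/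
def denomF {n : ℕ} : Fn n := prodN (towerF 4) (.proj 0 + 1)

/-- See `offset`. -/
def offsetF {n : ℕ} : Fn n := denomF * towerF 4

/-- See `radix`. -/
def radixF {n : ℕ} : Fn n := 2 * offsetF + 1

/-- See `entry`. -/
def entryF : Fn 1 := prodN (4 * robots)
  (.ite (.proj 0 - .proj 1) (.inp (2 * .proj 0 + 2))
    (.ite (.proj 1 - .proj 0) (.inp (2 * .proj 0 + 2)) (.inp (2 * .proj 0 + 1))))

/-- Powers of `radix`. -/
def powF : Fn 1 := prodN (.proj 0) radixF

/-- See `coeff`. -/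
def coeffF : Fn 2 := call₂ quot (.proj 0) (call₁ powF (.proj 1)) -
  radixF * call₂ quot (.proj 0) (call₁ powF (.proj 1 + 1)) - offsetF

/-- See `coord`; the variables are `c`, `u`, `i`, `d`. -/
def coordF : Fn 4 := .ite (.proj 1)
  (.ite (legsF - .proj 1)
    (sumN (4 * robots + 1) (call₂ coeffF (.proj 1)
      (((.proj 2 * robots + .proj 3) * 2 + .proj 4) * (4 * robots + 1) + .proj 0) *
        call₁ entryF (.proj 0)))
    (denomF * call₁ entryF (4 * .proj 2 + 2 + .proj 3)))
  (denomF * call₁ entryF (4 * .proj 2 + .proj 3))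

/-- See `dist₁`; the variables are `c`, `u`, `i`. -/
def distF : Fn 3 :=
  call₁ Fn.abs (call₄ coordF (.proj 0) (.proj 1 + 1) (.proj 2) 0 -
    call₄ coordF (.proj 0) (.proj 1) (.proj 2) 0) +
  call₁ Fn.abs (call₄ coordF (.proj 0) (.proj 1 + 1) (.proj 2) 1 -
    call₄ coordF (.proj 0) (.proj 1) (.proj 2) 1)

/-- See `duration`; the variables are `c`, `u`. -/
def durationF : Fn 2 := maxN robots (call₃ distF (.proj 1) (.proj 2) (.proj 0))

/-- See `time`; the variables are `c`, `u`. -/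
def timeF : Fn 2 := sumN (.proj 1) (call₂ durationF (.proj 1) (.proj 0))

/-- The common denominator of the output. -/
def scaleF {n : ℕ} : Fn n := denomF * call₁ entryF (4 * robots)

/-- See `gap`, for a fixed coordinate; the variables are `c`, `u`, `i`, `j`. -/
def gapF (d : ℕ) : Fn 4 := call₄ coordF (.proj 0) (.proj 1) (.proj 2) (.const d) -
  call₄ coordF (.proj 0) (.proj 1) (.proj 3) (.const d) - scaleF

/-- See `Separated`, for a fixed coordinate; the variables are `c`, `u`, `i`, `j`. -/
def separatedF (d : ℕ) : Fn 4 :=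
  call₂ bothNonneg (gapF d) (call₄ (gapF d) (.proj 0) (.proj 1 + 1) (.proj 2) (.proj 3))

/-- Exchange of the robots. -/
def swapRobots (f : Fn 4) : Fn 4 := call₄ f (.proj 0) (.proj 1) (.proj 3) (.proj 2)

/-- See `Conflict`; the variables are `c`, `u`, `i`, `j`. -/
def conflictF : Fn 4 := .ite (.proj 3 - .proj 2)
  (.ite (separatedF 0 + swapRobots (separatedF 0) + separatedF 1 + swapRobots (separatedF 1)) 0 1) 0

/-- See `conflicts`. -/
def conflictsF : Fn 1 := sumN legsF (sumN robots (sumN robots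
  (call₄ conflictF (.proj 3) (.proj 2) (.proj 1) (.proj 0))))

/-- See `best`. -/
def bestF {n : ℕ} : Fn n := .comp (.iter (0 - 1) (.ite (call₁ conflictsF (.proj 0)) (.proj 1)
  (.ite (0 - .proj 1) (.proj 0)
    (.ite (call₂ timeF (.proj 1) legsF - call₂ timeF (.proj 0) legsF) (.proj 0) (.proj 1))))
      : Fn 0) ![]

/-- The remainder of nonnegative integers. -/
def modF : Fn 2 := .proj 0 - .proj 1 * call₂ quot (.proj 0) (.proj 1)

theorem eval_modF (w : ℕ → ℤ) (H : ℕ) {c p : ℕ} (hc : c ≤ H) (hp : 0 < p) :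
    modF.eval w H ![(c : ℤ), (p : ℤ)] = (c % p : ℕ) := by
  simp only [modF, eval_sub, eval_mul, eval_call₂, eval_proj, Matrix.cons_val_zero,
    Matrix.cons_val_one, eval_quot w H hc hp]
  have := Nat.div_add_mod c p
  zify at this ⊢
  linarith

/-- The entries of the output word that belong to breakpoints; the variables are the remainder and
the quotient of the index. -/
def breakpointF : Fn 2 :=
  .ite (.proj 0)
    (.ite (.proj 0 - 1)
      (.ite (.proj 0 - 2)
        (.ite (.proj 0 - 3)
          (.ite (.proj 0 - 4) scaleF
            (call₄ coordF bestF (call₂ modF (.proj 1) (legsF + 1))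
              (call₂ quot (.proj 1) (legsF + 1)) 1))
          scaleF)
        (call₄ coordF bestF (call₂ modF (.proj 1) (legsF + 1))
          (call₂ quot (.proj 1) (legsF + 1)) 0))
      scaleF)
    (call₂ timeF bestF (call₂ modF (.proj 1) (legsF + 1)))

/-- See `outputEntry`. -/
def outputF : Fn 1 := .ite (.proj 0) (.ite (.proj 0 - 1) (.ite (.proj 0 - 2)
  (call₂ breakpointF (call₂ modF (.proj 0 - 3) 6) (call₂ quot (.proj 0 - 3) 6)) legsF) scaleF)
    (call₂ timeF bestF legsF)

/-- The length of the output word. -/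
def lengthF : Fn 0 := 3 + 6 * (robots * (legsF + 1))

end Fn

/-! ### Correctness of the expressions of the search -/

theorem maxRange_congr {f g : ℕ → ℤ} {m : ℕ} (hfg : ∀ i < m, f i = g i) :
    maxRange f m = maxRange g m := by
  induction m with
  | zero => rfl
  | succ m ih =>
    rw [maxRange, maxRange, ih fun i hi => hfg i (by omega), hfg m (by omega)]

/-- The bound `H` is large enough for the search. -/
structure Adequate (w : ℕ → ℤ) (k H : ℕ) : Prop where
  param : w 0 = k
  tower_le : tower 4 (2 * k + 16) ≤ H
  size : 100 * ((legs k + 2) * ((k + 1) * (k + 1))) ≤ H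

namespace Adequate

open Fn

variable {w : ℕ → ℤ} {k H n : ℕ} (h : Adequate w k H)

include h

theorem legs_le : legs k + 1 ≤ H := by
  have h1 := h.size
  have h2 : (legs k + 2) * 1 ≤ (legs k + 2) * ((k + 1) * (k + 1)) :=
    Nat.mul_le_mul_left _ (Nat.mul_pos (by omega) (by omega))
  omega

theorem robots_le : 4 * k + 1 ≤ H := by
  have h1 := h.size
  have h2 : 1 * ((k + 1) * (k + 1)) ≤ (legs k + 2) * ((k + 1) * (k + 1)) :=
    Nat.mul_le_mul_right _ (by omega)
  have h3 : (k + 1) * 1 ≤ (k + 1) * (k + 1) := Nat.mul_le_mul_left _ (by omega)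
  omega

theorem coeffIndex_lt {u i d j : ℕ} (hu : u < legs k) (hi : i < k) (hd : d ≤ 1) (hj : j ≤ 4 * k) :
    coeffIndex k u i d j + 1 ≤ H := by
  have h1 := h.size
  have e1 : (u * k + i) * 2 + d ≤ (legs k * (k + 1)) * 2 := by
    have : u * k + i < legs k * (k + 1) := by nlinarith
    omega
  have e2 : ((u * k + i) * 2 + d) * (4 * k + 1) ≤ (legs k * (k + 1)) * 2 * (4 * (k + 1)) :=
    Nat.mul_le_mul e1 (by omega)
  have e3 := h.robots_le
  have e4 : (legs k * (k + 1)) * 2 * (4 * (k + 1)) = 8 * (legs k * ((k + 1) * (k + 1))) := by ring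
  have e5 : (k + 1) * 1 ≤ (k + 1) * (k + 1) := Nat.mul_le_mul_left _ (by omega)
  rw [add_mul] at h1
  simp only [coeffIndex]
  omega

theorem eval_robots (v : Fin n → ℤ) : robots.eval w H v = k :=
  (eval_inp w H v (i := 0) rfl).trans h.param

theorem eval_towerF {j : ℕ} (hj : j ≤ 4) (v : Fin n → ℤ) :
    (towerF j).eval w H v = tower j (2 * k + 16) := by
  induction j with
  | zero =>
    simp [towerF, h.eval_robots, tower]
  | succ j ih =>
    have hle : tower j (2 * k + 16) ≤ H := by
      refine le_trans ?_ h.tower_le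
      have hmono : Monotone fun i => tower i (2 * k + 16) := monotone_nat_of_le_succ fun i => by
        rw [tower_succ]
        exact Nat.lt_two_pow_self.le
      exact hmono (by omega)
    rw [towerF, eval_prodN w H v (ih (by omega)) hle, tower_succ]
    simp

theorem eval_legsF (v : Fin n → ℤ) : legsF.eval w H v = legs k := h.eval_towerF (by norm_num) v

theorem eval_denomF (v : Fin n → ℤ) : denomF.eval w H v = denom k := by
  rw [denomF, eval_prodN w H v (h.eval_towerF le_rfl v) h.tower_le, denom,
    ← Finset.prod_range_add_one_eq_factorial]
  push_cast
  exact Finset.prod_congr rfl fun i _ => by simp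

theorem eval_offsetF (v : Fin n → ℤ) : offsetF.eval w H v = offset k := by
  rw [offsetF, eval_mul, h.eval_denomF, h.eval_towerF le_rfl, offset, Nat.cast_mul]

theorem eval_radixF (v : Fin n → ℤ) : radixF.eval w H v = radix k := by
  rw [radixF, eval_add, eval_mul, eval_two, eval_one, h.eval_offsetF, radix]
  push_cast
  rfl

theorem eval_entryF (j : ℕ) : entryF.eval w H ![(j : ℤ)] = entry w k j := by
  have hN : (4 * robots : Fn 1).eval w H ![(j : ℤ)] = (4 * k : ℕ) := by simp [h.eval_robots]
  rw [entryF, eval_prodN w H _ hN (by have := h.robots_le; omega), entry]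
  refine Finset.prod_congr rfl fun q _ => ?_
  have e1 : (Fn.inp (2 * .proj 0 + 1) : Fn 2).eval w H ![(q : ℤ), (j : ℤ)] = w (2 * q + 1) :=
    eval_inp w H _ (by simp)
  have e2 : (Fn.inp (2 * .proj 0 + 2) : Fn 2).eval w H ![(q : ℤ), (j : ℤ)] = w (2 * q + 2) :=
    eval_inp w H _ (by simp)
  simp only [eval_ite, e1, e2, eval_sub, eval_proj, Matrix.cons_val_zero, Matrix.cons_val_one]
  split_ifs <;> first | rfl | omega

theorem eval_powF {t : ℕ} (ht : t ≤ H) : powF.eval w H ![(t : ℤ)] = (radix k ^ t : ℕ) := by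
  rw [powF, eval_prodN w H _ (m := t) rfl ht]
  simp [h.eval_radixF]

theorem eval_coeffF {c t : ℕ} (hc : c ≤ H) (ht : t + 1 ≤ H) :
    coeffF.eval w H ![(c : ℤ), (t : ℤ)] = coeff k c t := by
  have hr : 0 < radix k := Nat.succ_pos _
  have e1 : ((t : ℤ) + 1) = ((t + 1 : ℕ) : ℤ) := by push_cast; rfl
  simp only [coeffF, eval_sub, eval_mul, eval_call₂, eval_call₁, eval_proj, Matrix.cons_val_zero,
    Matrix.cons_val_one, eval_add, eval_one, e1, h.eval_powF ht,
    h.eval_powF (Nat.le_of_succ_le ht), h.eval_radixF, h.eval_offsetF,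
    eval_quot w H hc (pow_pos hr _), coeff]
  -- With `R` the radix, `c / R ^ t - R * (c / R ^ (t + 1))` is the remainder of `c / R ^ t` modulo
  -- `R`, that is, the digit.
  rw [pow_succ, ← Nat.div_div_eq_div_mul]
  have := Nat.div_add_mod (c / radix k ^ t) (radix k)
  zify at this ⊢
  linarith

theorem eval_coordF {c u i d : ℕ} (hc : c ≤ H) (hi : i < k) (hd : d ≤ 1) :
    coordF.eval w H ![(c : ℤ), (u : ℤ), (i : ℤ), (d : ℤ)] = coord w k c u i d := by
  have e1 : (4 : ℤ) * i + 2 + d = ((4 * i + 2 + d : ℕ) : ℤ) := by push_cast; ring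
  have e2 : (4 : ℤ) * i + d = ((4 * i + d : ℕ) : ℤ) := by push_cast; ring
  have hN : (4 * robots + 1 : Fn 4).eval w H ![(c : ℤ), (u : ℤ), (i : ℤ), (d : ℤ)] =
      (4 * k + 1 : ℕ) := by simp [h.eval_robots]
  simp only [coordF, eval_ite, eval_proj, eval_sub, h.eval_legsF, eval_mul, h.eval_denomF,
    eval_call₁, eval_add, eval_two, eval_four, Matrix.cons_val_zero, Matrix.cons_val_one,
    Matrix.cons_val,
    e1, e2, h.eval_entryF, eval_sumN w H _ hN h.robots_le, coord, sub_pos,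
    Nat.cast_pos, Nat.cast_lt]
  split_ifs with h1 h2
  · refine Finset.sum_congr rfl fun j hj => ?_
    have hj' : j ≤ 4 * k := by
      have := Finset.mem_range.1 hj
      omega
    have e3 : (((u : ℤ) * k + i) * 2 + d) * (4 * k + 1) + j = (coeffIndex k u i d j : ℕ) := by
      simp only [coeffIndex]
      push_cast
      ring
    simp only [eval_call₂, eval_proj, eval_add, eval_mul, eval_one, eval_two, eval_four,
      h.eval_robots,
      Matrix.cons_val_zero, Matrix.cons_val_one, Matrix.cons_val, e3,
      h.eval_coeffF hc (h.coeffIndex_lt h2 hi hd hj')]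
  · rfl
  · rfl

theorem eval_coordF_zero {c u i : ℕ} (hc : c ≤ H) (hi : i < k) :
    coordF.eval w H ![(c : ℤ), (u : ℤ), (i : ℤ), 0] = coord w k c u i 0 :=
  h.eval_coordF (d := 0) hc hi (by omega)

theorem eval_coordF_one {c u i : ℕ} (hc : c ≤ H) (hi : i < k) :
    coordF.eval w H ![(c : ℤ), (u : ℤ), (i : ℤ), 1] = coord w k c u i 1 :=
  h.eval_coordF (d := 1) hc hi (by omega)

theorem eval_distF {c u i : ℕ} (hc : c ≤ H) (hi : i < k) :
    distF.eval w H ![(c : ℤ), (u : ℤ), (i : ℤ)] = dist₁ w k c u i := by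
  have e1 : ((u : ℤ) + 1) = ((u + 1 : ℕ) : ℤ) := by push_cast; rfl
  simp only [distF, eval_add, eval_call₁, eval_sub, eval_call₄, eval_proj, eval_zero, eval_one,
    Matrix.cons_val_zero, Matrix.cons_val_one, Matrix.cons_val, e1,
    h.eval_coordF_zero hc hi, h.eval_coordF_one hc hi, eval_abs, dist₁]

theorem eval_durationF {c u : ℕ} (hc : c ≤ H) :
    durationF.eval w H ![(c : ℤ), (u : ℤ)] = duration w k c u := by
  rw [durationF, eval_maxN w H _ (h.eval_robots _) (by have := h.robots_le; omega), duration]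
  refine maxRange_congr fun i hi => ?_
  simp only [eval_call₃, eval_proj, Matrix.cons_val_zero, Matrix.cons_val_one, Matrix.cons_val,
    h.eval_distF hc hi]

theorem eval_timeF {c u : ℕ} (hc : c ≤ H) (hu : u ≤ legs k) :
    timeF.eval w H ![(c : ℤ), (u : ℤ)] = time w k c u := by
  rw [timeF, eval_sumN w H _ (m := u) rfl (by have := h.legs_le; omega), time]
  refine Finset.sum_congr rfl fun j _ => ?_
  simp only [eval_call₂, eval_proj, Matrix.cons_val_zero, Matrix.cons_val_one, h.eval_durationF hc]

theorem eval_scaleF (v : Fin n → ℤ) : scaleF.eval w H v = denom k * entry w k (4 * k) := by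
  have e1 : (4 : ℤ) * k = ((4 * k : ℕ) : ℤ) := by push_cast; ring
  simp only [scaleF, eval_mul, h.eval_denomF, eval_call₁, eval_four, h.eval_robots,
    e1, h.eval_entryF]

theorem eval_gapF {c u i j d : ℕ} (hc : c ≤ H) (hi : i < k) (hj : j < k) (hd : d ≤ 1) :
    (gapF d).eval w H ![(c : ℤ), (u : ℤ), (i : ℤ), (j : ℤ)] = gap w k c u i j d := by
  simp only [gapF, eval_sub, eval_call₄, eval_proj, eval_const, Matrix.cons_val_zero,
    Matrix.cons_val_one, Matrix.cons_val, h.eval_coordF hc hi hd, h.eval_coordF hc hj hd,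
    h.eval_scaleF, gap]

theorem eval_separatedF {c u i j d : ℕ} (hc : c ≤ H) (hi : i < k) (hj : j < k) (hd : d ≤ 1) :
    (separatedF d).eval w H ![(c : ℤ), (u : ℤ), (i : ℤ), (j : ℤ)] =
      if Separated w k c u i j d then 1 else 0 := by
  have e1 : ((u : ℤ) + 1) = ((u + 1 : ℕ) : ℤ) := by push_cast; rfl
  simp only [separatedF, eval_call₂, eval_call₄, eval_proj, eval_add, eval_one,
    Matrix.cons_val_zero, Matrix.cons_val_one, Matrix.cons_val, e1, h.eval_gapF hc hi hj hd,
    eval_bothNonneg]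
  exact if_congr Iff.rfl rfl rfl

theorem eval_conflictF {c u i j : ℕ} (hc : c ≤ H) (hi : i < k) (hj : j < k) :
    conflictF.eval w H ![(c : ℤ), (u : ℤ), (i : ℤ), (j : ℤ)] =
      if Conflict w k c u i j then 1 else 0 := by
  simp only [conflictF, swapRobots, eval_ite, eval_sub, eval_add, eval_call₄, eval_proj, eval_zero,
    eval_one,
    Matrix.cons_val_zero, Matrix.cons_val_one, Matrix.cons_val,
    h.eval_separatedF hc hi hj (Nat.zero_le 1), h.eval_separatedF hc hi hj le_rfl,
    h.eval_separatedF hc hj hi (Nat.zero_le 1), h.eval_separatedF hc hj hi le_rfl, sub_pos,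
    Nat.cast_lt, Conflict]
  by_cases hij : i < j
  · by_cases h1 : Separated w k c u i j 0 <;> by_cases h2 : Separated w k c u j i 0 <;>
      by_cases h3 : Separated w k c u i j 1 <;> by_cases h4 : Separated w k c u j i 1 <;>
      simp [hij, h1, h2, h3, h4]
  · simp [hij]

theorem eval_conflictsF {c : ℕ} (hc : c ≤ H) :
    conflictsF.eval w H ![(c : ℤ)] = conflicts w k c := by
  have hk : k ≤ H := by have := h.robots_le; omega
  rw [conflictsF, eval_sumN w H _ (h.eval_legsF _) (by have := h.legs_le; omega), conflicts]
  refine Finset.sum_congr rfl fun u _ => ?_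
  rw [eval_sumN w H _ (h.eval_robots _) hk]
  refine Finset.sum_congr rfl fun i hi => ?_
  rw [eval_sumN w H _ (h.eval_robots _) hk]
  refine Finset.sum_congr rfl fun j hj => ?_
  simp only [eval_call₄, eval_proj, Matrix.cons_val_zero, Matrix.cons_val_one, Matrix.cons_val]
  exact h.eval_conflictF hc (Finset.mem_range.1 hi) (Finset.mem_range.1 hj)

theorem eval_bestF (v : Fin n → ℤ) : bestF.eval w H v = best w k H := by
  have key : ∀ m ≤ H, (Nat.rec (-1) (fun c b => (Fn.ite (call₁ conflictsF (.proj 0)) (.proj 1)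
      (.ite (0 - .proj 1) (.proj 0) (.ite (call₂ timeF (.proj 1) legsF -
        call₂ timeF (.proj 0) legsF) (.proj 0) (.proj 1))) : Fn 2).eval w H
          ![(c : ℤ), b]) m : ℤ) = best w k m := by
    intro m hm
    induction m with
    | zero => rfl
    | succ m ih =>
      have hm' : m ≤ H := by omega
      simp only [ih hm']
      simp only [eval_ite, eval_call₁, eval_call₂, eval_proj, eval_sub, eval_zero,
        Matrix.cons_val_zero, Matrix.cons_val_one, h.eval_conflictsF hm', h.eval_legsF,
        zero_sub, h.eval_timeF hm' le_rfl, best]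
      -- The time of the stored candidate is only known for codes up to `H`. While the candidate is
      -- `-1`, the preceding test makes this time irrelevant.
      rcases best_spec w k m with ⟨e, -⟩ | ⟨b, e, hb, -⟩
      · rw [e]
        simp
      · rw [e]
        simp only [h.eval_timeF (show b ≤ H by omega) le_rfl, Int.toNat_natCast]
        split_ifs <;> first | rfl | omega
  have hv : (fun j : Fin 0 => ((![] : Fin 0 → Fn n) j).eval w H v) = ![] := Subsingleton.elim _ _
  rw [bestF, Fn.eval, hv]
  exact key H le_rfl

theorem eval_lengthF : lengthF.eval w H ![] = (3 + 6 * (k * (legs k + 1)) : ℕ) := by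
  rw [lengthF, eval_add, eval_mul, eval_mul, eval_add, eval_three, eval_six, eval_one,
    h.eval_robots,
    h.eval_legsF]
  push_cast
  rfl

theorem length_le : 3 + 6 * (k * (legs k + 1)) ≤ H := by
  have h1 := h.size
  have h2 : (legs k + 1) * k ≤ (legs k + 2) * ((k + 1) * (k + 1)) :=
    Nat.mul_le_mul (by omega) (by nlinarith)
  have h3 : 1 ≤ (legs k + 2) * ((k + 1) * (k + 1)) := Nat.mul_pos (by omega) (by positivity)
  rw [mul_comm (legs k + 1)] at h2
  omega

theorem eval_outputF {b t : ℕ} (hb : best w k H = b) (hbH : b ≤ H)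
    (ht : t < 3 + 6 * (k * (legs k + 1))) :
    outputF.eval w H ![(t : ℤ)] = outputEntry w k b t := by
  have htH := ht.le.trans h.length_le
  have e1 : ∀ m : ℕ, 0 < (t : ℤ) - m ↔ m < t := fun m => by omega
  have e1' := e1 1
  have e2' := e1 2
  simp only [Nat.cast_one, Nat.cast_ofNat] at e1' e2'
  simp only [outputF, outputEntry, eval_ite, eval_proj, eval_sub, eval_one, eval_two, eval_three,
    eval_six, Matrix.cons_val_zero,
    Nat.cast_pos, e1', e2', eval_call₂, h.eval_bestF, h.eval_legsF, hb,
    h.eval_timeF hbH le_rfl, h.eval_scaleF]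
  refine if_congr Iff.rfl (if_congr Iff.rfl ?_ rfl) rfl
  by_cases h2 : 2 < t
  swap
  · rw [if_neg h2, if_neg h2]
  rw [if_pos h2, if_pos h2]
  have hs : (t : ℤ) - 3 = ((t - 3 : ℕ) : ℤ) := by omega
  have hs' : t - 3 ≤ H := by omega
  have hm := eval_modF w H (p := 6) hs' (by norm_num)
  have hq := eval_quot w H (p := 6) hs' (by norm_num)
  simp only [Nat.cast_ofNat] at hm hq
  rw [hs, hm, hq]
  generalize hr : (t - 3) % 6 = r
  generalize hqq : (t - 3) / 6 = q
  have hqk : q < k * (legs k + 1) := by omega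
  have hqH : q ≤ H := by omega
  have hℓ : 0 < legs k + 1 := Nat.succ_pos _
  have hi : q / (legs k + 1) < k := (Nat.div_lt_iff_lt_mul (by omega)).2 hqk
  have hu : q % (legs k + 1) ≤ legs k := Nat.lt_succ_iff.1 (Nat.mod_lt _ (by omega))
  have e3 : ((legs k : ℤ) + 1) = ((legs k + 1 : ℕ) : ℤ) := by push_cast; rfl
  have r1 : 0 < (r : ℤ) - 1 ↔ 1 < r := by omega
  have r2 : 0 < (r : ℤ) - 2 ↔ 2 < r := by omega
  have r3 : 0 < (r : ℤ) - 3 ↔ 3 < r := by omega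
  have r4 : 0 < (r : ℤ) - 4 ↔ 4 < r := by omega
  simp only [breakpointF, eval_ite, eval_proj, eval_sub, eval_add, eval_zero, eval_one, eval_two,
    eval_three, eval_four, Matrix.cons_val_zero,
    Matrix.cons_val_one, Nat.cast_pos, eval_call₂,
    eval_call₄, h.eval_scaleF, h.eval_bestF, h.eval_legsF, hb, e3, eval_modF w H hqH hℓ,
    eval_quot w H hqH hℓ, h.eval_coordF_zero hbH hi, h.eval_coordF_one hbH hi,
    h.eval_timeF hbH hu, r1, r2, r3, r4]

end Adequate

/-! ### Sizes -/

/-- This climbs one level of the tower: four times a fourth power from one level fits below the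
next. -/
theorem four_mul_pow_four_le {n : ℕ} (hn : 20 ≤ n) : 4 * n ^ 4 ≤ 2 ^ n := by
  induction n, hn using Nat.le_induction with
  | base => norm_num
  | succ n hn ih =>
    have h1 : (n + 1) ^ 4 ≤ 2 * n ^ 4 := by
      have h2 : n ^ 2 ≤ n ^ 3 := Nat.pow_le_pow_right (by omega) (by norm_num)
      have h3 : n ≤ n ^ 3 := Nat.le_self_pow (by norm_num) n
      have h4 : 20 * n ^ 3 ≤ n ^ 4 := by
        rw [pow_succ n 3, mul_comm]
        exact Nat.mul_le_mul_left _ hn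
      have h5 : (n + 1) ^ 4 = n ^ 4 + 4 * n ^ 3 + 6 * n ^ 2 + 4 * n + 1 := by ring
      omega
    rw [pow_succ 2]
    omega

/-- The left side bounds the number of orderings, so every simple path can be padded to `legs k`
legs. -/
theorem choose_two_le_legs (k : ℕ) : 4 ^ k.choose 2 ≤ legs k := by
  have h1 : 2 * k.choose 2 ≤ 2 ^ (2 * k + 16) := by
    have h2 : k ≤ 2 ^ k := Nat.lt_two_pow_self.le
    have h3 : k * k ≤ 2 ^ k * 2 ^ k := Nat.mul_le_mul h2 h2
    have h4 : 2 ^ (2 * k + 16) = 2 ^ k * 2 ^ k * 2 ^ 16 := by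
      rw [← pow_add, ← pow_add]
      congr 1
      ring
    have h5 : k * (k - 1) ≤ k * k := Nat.mul_le_mul_left _ (Nat.sub_le _ _)
    have h6 : 2 * k.choose 2 ≤ k * (k - 1) := by
      rw [Nat.choose_two_right, mul_comm]
      exact Nat.div_mul_le_self _ _
    have h7 : (2 : ℕ) ^ k * 2 ^ k ≤ 2 ^ k * 2 ^ k * 2 ^ 16 := Nat.le_mul_of_pos_right _ (by norm_num)
    omega
  rw [legs, tower_succ, tower_succ, show (4 : ℕ) = 2 ^ 2 from rfl, ← pow_mul]
  exact Nat.pow_le_pow_right (by norm_num) h1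

theorem le_legs (k : ℕ) : 2 * k + 200 ≤ legs k := by
  rw [legs, tower_succ, tower_succ]
  change _ ≤ 2 ^ 2 ^ (2 * k + 16)
  have h2 : 4 * (2 * k + 16 + 4) ^ 4 ≤ 2 ^ (2 * k + 16 + 4) := four_mul_pow_four_le (by omega)
  have h3 : 2 * k + 20 ≤ 2 ^ (2 * k + 16) := by
    rw [pow_add 2 _ 4] at h2
    have h4 : (20 : ℕ) ^ 3 ≤ (2 * k + 16 + 4) ^ 3 := Nat.pow_le_pow_left (by omega) 3
    have h5 : (2 * k + 16 + 4) * 20 ^ 3 ≤ (2 * k + 16 + 4) ^ 4 := by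
      rw [pow_succ' _ 3]
      exact Nat.mul_le_mul_left _ h4
    omega
  have h4 : (2 : ℕ) ^ (2 * k + 20) ≤ 2 ^ 2 ^ (2 * k + 16) := Nat.pow_le_pow_right (by norm_num) h3
  have h5 : 4 * (2 * k + 20) ^ 4 ≤ 2 ^ (2 * k + 20) := four_mul_pow_four_le (by omega)
  have h6 : (20 : ℕ) ^ 3 ≤ (2 * k + 20) ^ 3 := Nat.pow_le_pow_left (by omega) 3
  have h7 : (2 * k + 20) * 20 ^ 3 ≤ (2 * k + 20) ^ 4 := by
    rw [pow_succ' _ 3]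
    exact Nat.mul_le_mul_left _ h6
  omega

theorem legs_pow_four_le (k : ℕ) : 4 * legs k ^ 4 ≤ tower 3 (2 * k + 16) := by
  rw [tower_succ]
  have := le_legs k
  exact four_mul_pow_four_le (n := legs k) (by omega)

theorem le_tower_succ (j x : ℕ) : tower j x ≤ tower (j + 1) x := by
  rw [tower_succ]
  exact Nat.lt_two_pow_self.le

theorem le_tower_four (k : ℕ) : 4 * legs k ^ 4 ≤ tower 4 (2 * k + 16) :=
  (legs_pow_four_le k).trans (le_tower_succ 3 _)

theorem factorial_le_two_pow (m : ℕ) : m.factorial ≤ 2 ^ (m * m) := by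
  rw [pow_mul]
  exact (Nat.factorial_le_pow m).trans (Nat.pow_le_pow_left Nat.lt_two_pow_self.le m)

/-- `m` is the number of variables of the program with `legs k` legs. Since `m ≤ legs k ^ 2`, the
binary logarithm of the bound is at most `m + m * m + 3 * m ≤ 4 * legs k ^ 4`, which is below level
`3`. -/
theorem cramer_bound_le_tower {k m : ℕ} (hm : m = 2 * k * (legs k + 1) + legs k) :
    m * (m.factorial * 5 ^ m) ≤ tower 4 (2 * k + 16) := by
  have h1 := le_legs k
  have h2 : m ≤ legs k ^ 2 := by
    rw [hm]
    nlinarith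
  have h3 : m * (m.factorial * 5 ^ m) ≤ 2 ^ m * (2 ^ (m * m) * 2 ^ (3 * m)) := by
    refine Nat.mul_le_mul Nat.lt_two_pow_self.le (Nat.mul_le_mul (factorial_le_two_pow m) ?_)
    rw [pow_mul]
    exact Nat.pow_le_pow_left (by norm_num) m
  refine h3.trans ?_
  rw [← pow_add, ← pow_add, tower_succ]
  refine Nat.pow_le_pow_right (by norm_num) (le_trans ?_ (legs_pow_four_le k))
  have h4 : m * m ≤ legs k ^ 2 * legs k ^ 2 := Nat.mul_le_mul h2 h2
  have h5 : m ≤ m * m := Nat.le_mul_self m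
  have h6 : legs k ^ 2 * legs k ^ 2 = legs k ^ 4 := by rw [← pow_add]
  have h7 : 4 * m ≤ 2 * (legs k ^ 2 * legs k ^ 2) := by
    have : 2 ≤ legs k ^ 2 := le_trans (by omega) (Nat.le_self_pow (by norm_num) (legs k))
    nlinarith
  omega

theorem dvd_denom {k q : ℕ} (h0 : 0 < q) (hq : q ≤ tower 4 (2 * k + 16)) : q ∣ denom k :=
  Nat.dvd_factorial h0 hq

theorem radix_le (k : ℕ) : radix k ≤ 2 ^ (4 * tower 4 (2 * k + 16) ^ 2) := by
  have h0 : 0 < tower 4 (2 * k + 16) := by rw [tower_succ]; positivity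
  rw [radix, offset, denom]
  generalize tower 4 (2 * k + 16) = T at h0
  have h1 := factorial_le_two_pow T
  have h2 : T ≤ 2 ^ T := Nat.lt_two_pow_self.le
  have h3 : T.factorial * T ≤ 2 ^ (T * T) * 2 ^ T := Nat.mul_le_mul h1 h2
  have h4 : 1 ≤ 2 ^ (T * T) * 2 ^ T := Nat.mul_pos (by positivity) (by positivity)
  have h5 : 2 * (T.factorial * T) + 1 ≤ 2 ^ (T * T) * 2 ^ T * 2 ^ 2 := by omega
  refine h5.trans ?_
  rw [← pow_add, ← pow_add]
  refine Nat.pow_le_pow_right (by norm_num) ?_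
  nlinarith

/-- With `T` the value at level `4`, a code has at most `T` digits, each below `2 ^ (4 * T ^ 2)`; as
`4 * T ^ 3 ≤ 2 ^ T`, two further levels suffice for all codes. -/
theorem radix_pow_le (k : ℕ) :
    radix k ^ tower 4 (2 * k + 16) ≤ tower 6 (2 * k + 16) := by
  have h0 : 20 ≤ tower 4 (2 * k + 16) := by
    have h1 := le_legs k
    have h2 := le_tower_four k
    have h3 : legs k ≤ legs k ^ 4 := Nat.le_self_pow (by norm_num) _
    omega
  refine (Nat.pow_le_pow_left (radix_le k) _).trans ?_
  rw [tower_succ 5, tower_succ 4, ← pow_mul]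
  generalize tower 4 (2 * k + 16) = T at h0
  refine Nat.pow_le_pow_right (by norm_num) (le_trans ?_ (four_mul_pow_four_le h0))
  have h1 : 4 * T ^ 2 * T = 4 * T ^ 3 := by ring
  rw [h1]
  exact Nat.mul_le_mul_left _ (Nat.pow_le_pow_right (by omega) (by norm_num))

theorem coeffIndex_lt {k u i d j : ℕ} (hu : u < legs k) (hi : i < k) (hd : d < 2)
    (hj : j < 4 * k + 1) : coeffIndex k u i d j < tower 4 (2 * k + 16) := by
  have h1 := le_legs k
  have h2 : u * k + i + 1 ≤ legs k * k := by
    have := Nat.mul_le_mul_right k (Nat.succ_le_of_lt hu)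
    rw [Nat.succ_mul] at this
    omega
  have h3 : (u * k + i) * 2 + d + 1 ≤ 2 * (legs k * k) := by omega
  have h4 : coeffIndex k u i d j + 1 ≤ 2 * (legs k * k) * (4 * k + 1) := by
    have := Nat.mul_le_mul_right (4 * k + 1) h3
    rw [Nat.succ_mul] at this
    rw [coeffIndex]
    omega
  have h5 : 2 * (legs k * k) * (4 * k + 1) ≤ 4 * legs k ^ 4 := by
    have h6 : 2 * (legs k * k) ≤ legs k ^ 2 := by nlinarith
    have h7 : 4 * k + 1 ≤ legs k ^ 2 := by nlinarith
    have h8 := Nat.mul_le_mul h6 h7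
    rw [← pow_add, show 2 + 2 = 4 from rfl] at h8
    omega
  have := le_tower_four k
  omega

theorem adequate_tower {w : ℕ → ℤ} {k : ℕ} (hw : w 0 = k) :
    Adequate w k (tower 6 (2 * k + 16)) where
  param := hw
  tower_le := (le_tower_succ 4 _).trans (le_tower_succ 5 _)
  size := by
    refine le_trans ?_ ((le_tower_four k).trans ((le_tower_succ 4 _).trans (le_tower_succ 5 _)))
    have h1 := le_legs k
    have h2 : 100 * (legs k + 2) ≤ legs k ^ 2 := by nlinarith
    have h3 : (k + 1) * (k + 1) ≤ legs k ^ 2 := by nlinarith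
    have h4 := Nat.mul_le_mul h2 h3
    rw [← pow_add, show 2 + 2 = 4 from rfl] at h4
    rw [← mul_assoc]
    omega

/-- Every sequence of digits is the expansion of a number. -/
theorem exists_digits {R : ℕ} (T : ℕ) (δ : ℕ → ℕ) (hδ : ∀ t, δ t < R) :
    ∃ c < R ^ T, ∀ t < T, c / R ^ t % R = δ t := by
  induction T generalizing δ with
  | zero => exact ⟨0, by simp, fun t ht => absurd ht (Nat.not_lt_zero t)⟩
  | succ T ih =>
    obtain ⟨c, hc, h⟩ := ih (fun t => δ (t + 1)) fun t => hδ _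
    have hR : 0 < R := (Nat.zero_le _).trans_lt (hδ 0)
    refine ⟨δ 0 + R * c, ?_, fun t ht => ?_⟩
    · have h1 := Nat.mul_le_mul_left R (Nat.succ_le_of_lt hc)
      rw [Nat.mul_succ] at h1
      rw [pow_succ']
      have := hδ 0
      omega
    · rcases t with _ | t
      · simp [Nat.mod_eq_of_lt (hδ 0)]
      · rw [pow_succ', ← Nat.div_div_eq_div_mul, Nat.add_mul_div_left _ _ hR,
          Nat.div_eq_of_lt (hδ 0), zero_add]
        exact h t (by omega)

attribute [local irreducible] tower

/-! ### The paths that are encoded by numbers -/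

/-- The factor by which the coordinates are multiplied. -/
def scale (w : ℕ → ℤ) (k : ℕ) : ℤ := denom k * entry w k (4 * k)

/-- The `u`-th configuration of the path encoded by `c`. -/
noncomputable def node (w : ℕ → ℤ) (k c u : ℕ) : Pos k := fun i =>
  ((coord w k c u i 0 : ℝ) / scale w k, (coord w k c u i 1 : ℝ) / scale w k)

/-- The duration of the leg `u` of the path encoded by `c`. -/
noncomputable def legTime (w : ℕ → ℤ) (k c u : ℕ) : ℝ := (duration w k c u : ℝ) / scale w k

section

variable {w : ℕ → ℤ} {k : ℕ}

theorem denom_pos (k : ℕ) : 0 < denom k := Nat.factorial_pos _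

theorem scale_pos (hD : 0 < entry w k (4 * k)) : (0 : ℝ) < scale w k := by
  have := denom_pos k
  rw [scale]
  exact_mod_cast mul_pos (by exact_mod_cast this) hD

theorem arrival_legTime (w : ℕ → ℤ) (k c u : ℕ) :
    arrival (legTime w k c) u = (time w k c u : ℝ) / scale w k := by
  rw [arrival, time, Int.cast_sum, Finset.sum_div]
  rfl

theorem gap_nonneg_fst (hD : 0 < entry w k (4 * k)) (c u : ℕ) (i j : Fin k) :
    0 ≤ gap w k c u i j 0 ↔ (node w k c u j).1 + 1 ≤ (node w k c u i).1 := by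
  have hS := scale_pos hD
  rw [node, node, div_add_one hS.ne', div_le_div_iff_of_pos_right hS, gap]
  change 0 ≤ _ - scale w k ↔ _
  rw [sub_nonneg, le_sub_iff_add_le, add_comm]
  exact_mod_cast Iff.rfl

theorem gap_nonneg_snd (hD : 0 < entry w k (4 * k)) (c u : ℕ) (i j : Fin k) :
    0 ≤ gap w k c u i j 1 ↔ (node w k c u j).2 + 1 ≤ (node w k c u i).2 := by
  have hS := scale_pos hD
  rw [node, node, div_add_one hS.ne', div_le_div_iff_of_pos_right hS, gap]
  change 0 ≤ _ - scale w k ↔ _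
  rw [sub_nonneg, le_sub_iff_add_le, add_comm]
  exact_mod_cast Iff.rfl

/-- A common ordering may be assembled pair by pair, so testing the four relations for each pair
suffices and the search never enumerates orderings. -/
theorem shareOrdering_node_iff (hD : 0 < entry w k (4 * k)) (c u : ℕ) :
    ShareOrdering (node w k c u) (node w k c (u + 1)) ↔
      ∀ i < k, ∀ j < k, ¬ Conflict w k c u i j := by
  have key : ∀ i j : Fin k,
      (∃ d : Dir, d.Holds (node w k c u i) (node w k c u j) ∧
        d.Holds (node w k c (u + 1) i) (node w k c (u + 1) j)) ↔
      (Separated w k c u i j 0 ∨ Separated w k c u j i 0 ∨ Separated w k c u i j 1 ∨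
        Separated w k c u j i 1) := fun i j => by
    simp only [Separated, gap_nonneg_fst hD, gap_nonneg_snd hD]
    constructor
    · rintro ⟨d, h1, h2⟩
      cases d
      · exact Or.inl ⟨h1, h2⟩
      · exact Or.inr (Or.inl ⟨h1, h2⟩)
      · exact Or.inr (Or.inr (Or.inl ⟨h1, h2⟩))
      · exact Or.inr (Or.inr (Or.inr ⟨h1, h2⟩))
    · rintro (h | h | h | h)
      · exact ⟨.right, h⟩
      · exact ⟨.left, h⟩
      · exact ⟨.up, h⟩
      · exact ⟨.down, h⟩
  rw [shareOrdering_iff]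
  constructor
  · intro h i hi j hj hc
    exact hc.2 ((key ⟨i, hi⟩ ⟨j, hj⟩).1 (h _ _ hc.1))
  · intro h i j hij
    refine (key i j).2 (not_not.1 fun hn => h i i.2 j j.2 ⟨hij, hn⟩)

theorem not_conflicts_pos_iff (c : ℕ) : ¬ 0 < conflicts w k c ↔
    ∀ u < legs k, ∀ i < k, ∀ j < k, ¬ Conflict w k c u i j := by
  have h1 : ∀ u i j, (0 : ℤ) ≤ if Conflict w k c u i j then 1 else 0 := fun u i j => by
    split_ifs <;> norm_num
  have h0 : 0 ≤ conflicts w k c := Finset.sum_nonneg fun u _ => Finset.sum_nonneg fun i _ =>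
    Finset.sum_nonneg fun j _ => h1 u i j
  rw [not_lt, h0.ge_iff_eq', conflicts, Finset.sum_eq_zero_iff_of_nonneg fun u _ =>
    Finset.sum_nonneg fun i _ => Finset.sum_nonneg fun j _ => h1 u i j]
  refine forall_congr' fun u => ?_
  rw [Finset.mem_range, Finset.sum_eq_zero_iff_of_nonneg fun i _ =>
    Finset.sum_nonneg fun j _ => h1 u i j]
  refine imp_congr_right fun _ => forall_congr' fun i => ?_
  rw [Finset.mem_range, Finset.sum_eq_zero_iff_of_nonneg fun j _ => h1 u i j]
  refine imp_congr_right fun _ => forall_congr' fun j => ?_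
  rw [Finset.mem_range]
  simp

theorem l1_node_sub (hD : 0 < entry w k (4 * k)) (c u : ℕ) (i : Fin k) :
    l1 (node w k c (u + 1) i - node w k c u i) = (dist₁ w k c u i : ℝ) / scale w k := by
  have hS := scale_pos hD
  simp only [l1, node, Prod.fst_sub, Prod.snd_sub, dist₁, ← sub_div, abs_div, abs_of_pos hS]
  push_cast
  ring

theorem isPath_node (hD : 0 < entry w k (4 * k)) {c : ℕ} (hc : ¬ 0 < conflicts w k c) :
    IsPath (legs k) (node w k c) (legTime w k c) where
  nonneg u _ := div_nonneg (by exact_mod_cast maxRange_nonneg _ _) (scale_pos hD).le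
  metric u _ i := by
    rw [l1_node_sub hD]
    exact div_le_div_of_nonneg_right (by exact_mod_cast le_maxRange _ i.2) (scale_pos hD).le
  ordered u hu := (shareOrdering_node_iff hD c u).2 ((not_conflicts_pos_iff c).1 hc u hu)

/-- The encoded durations are the smallest admissible ones, so no path through the same
configurations is faster. -/
theorem legTime_le (hD : 0 < entry w k (4 * k)) {c u : ℕ} {x : ℝ} (hx : 0 ≤ x)
    (h : ∀ i, l1 (node w k c (u + 1) i - node w k c u i) ≤ x) : legTime w k c u ≤ x := by
  rw [legTime, duration]
  rcases maxRange_eq_zero_or (dist₁ w k c u) k with h' | ⟨i, hi, h'⟩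
  · simpa [h'] using hx
  · rw [h', ← l1_node_sub hD c u ⟨i, hi⟩]
    exact h _

theorem coord_zero (w : ℕ → ℤ) (k c i d : ℕ) :
    coord w k c 0 i d = denom k * entry w k (4 * i + d) := by simp [coord]

theorem coord_legs (w : ℕ → ℤ) (k c i d : ℕ) :
    coord w k c (legs k) i d = denom k * entry w k (4 * i + 2 + d) := by
  have := le_legs k
  simp [coord, show 0 < legs k by omega]

theorem scaled_div (x : ℤ) :
    ((denom k * x : ℤ) : ℝ) / scale w k = (x : ℝ) / entry w k (4 * k) := by
  have h1 : (denom k : ℝ) ≠ 0 := by exact_mod_cast (denom_pos k).ne'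
  rw [scale]
  push_cast
  exact mul_div_mul_left _ _ h1

theorem node_zero {A B : Pos k}
    (hθ : IsParams A B fun j => (entry w k j : ℝ) / entry w k (4 * k)) (c : ℕ) :
    node w k c 0 = A := by
  funext i
  rw [node, coord_zero, coord_zero, scaled_div, scaled_div]
  exact Prod.ext (hθ.startX i) (hθ.startY i)

theorem node_legs {A B : Pos k}
    (hθ : IsParams A B fun j => (entry w k j : ℝ) / entry w k (4 * k)) (c : ℕ) :
    node w k c (legs k) = B := by
  funext i
  rw [node, coord_legs, coord_legs, scaled_div, scaled_div]
  exact Prod.ext (hθ.targetX i) (hθ.targetY i)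

/-- All bounded coefficients are encoded by a number. -/
theorem exists_code (k : ℕ) (c : ℕ → Fin k → Bool → ℕ → ℤ)
    (hc : ∀ u i d j, |c u i d j| ≤ offset k) :
    ∃ b < radix k ^ tower 4 (2 * k + 16), ∀ u < legs k, ∀ (i : Fin k) (d : Bool),
      ∀ j < 4 * k + 1, coeff k b (coeffIndex k u i d.toNat j) = c u i d j := by
  -- Inverts `coeffIndex`: division by `4 * k + 1`, `2` and `k` recovers `j`, `d`, `i` and `u`. The
  -- default `0` occurs only for `k = 0`.
  let δ : ℕ → ℤ := fun t =>
    if h : t / (4 * k + 1) / 2 % k < k then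
      c (t / (4 * k + 1) / 2 / k) ⟨_, h⟩ (decide (t / (4 * k + 1) % 2 = 1)) (t % (4 * k + 1))
    else 0
  have hδ : ∀ t, |δ t| ≤ offset k := fun t => by
    simp only [δ]
    split_ifs
    · exact hc _ _ _ _
    · simp
  obtain ⟨b, hb, h⟩ := exists_digits (R := radix k) (tower 4 (2 * k + 16))
    -- Adding the offset turns a signed coefficient into a digit below the radix.
    (fun t => (δ t + offset k).toNat) fun t => by
      have := abs_le.1 (hδ t)
      rw [radix]
      omega
  refine ⟨b, hb, fun u hu i d j hj => ?_⟩
  have hi := i.2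
  have hd : d.toNat < 2 := by cases d <;> simp
  rw [coeff, h _ (coeffIndex_lt hu hi hd hj)]
  have h1 := abs_le.1 (hδ (coeffIndex k u i d.toNat j))
  rw [Int.toNat_of_nonneg (by omega), add_sub_cancel_right]
  have e1 : coeffIndex k u i d.toNat j / (4 * k + 1) = (u * k + i) * 2 + d.toNat := by
    rw [coeffIndex, mul_comm, Nat.mul_add_div (by omega), Nat.div_eq_of_lt hj, add_zero]
  have e2 : coeffIndex k u i d.toNat j % (4 * k + 1) = j := by
    rw [coeffIndex, mul_comm, Nat.mul_add_mod, Nat.mod_eq_of_lt hj]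
  have e3 : ((u * k + i) * 2 + d.toNat) / 2 = u * k + i := by omega
  have e4 : ((u * k + i) * 2 + d.toNat) % 2 = d.toNat := by omega
  have e5 : (u * k + i) % k = i := by
    rw [mul_comm, Nat.mul_add_mod, Nat.mod_eq_of_lt hi]
  have e6 : (u * k + i) / k = u := by
    rw [mul_comm, Nat.mul_add_div (by omega), Nat.div_eq_of_lt hi, add_zero]
  have e7 : decide (d.toNat = 1) = d := by cases d <;> simp
  simp only [δ, e1, e2, e3, e4, e5, e6, e7, hi, dif_pos, Fin.eta]

/-- The code holds the coefficients of an optimal path with vertex coordinates. Start and target are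
read from the input, not from the code, so every code has the correct ends. -/
theorem exists_optimal_code (hD : 0 < entry w k (4 * k)) {A B : Pos k} (hA : A ∈ confSpace k)
    (hB : B ∈ confSpace k) (hθ : IsParams A B fun j => (entry w k j : ℝ) / entry w k (4 * k)) :
    ∃ (L : ℝ), IsMinMakespan A B L ∧ ∃ c < tower 6 (2 * k + 16), ¬ 0 < conflicts w k c ∧
      arrival (legTime w k c) (legs k) ≤ L := by
  have hlegs := le_legs k
  obtain ⟨I, φ, hI0, hI1, hI, hL, c, hc, hIc⟩ := exists_optimal_path hA hB hθ
    (ℓ := legs k) (Q := tower 4 (2 * k + 16)) (E := denom k) (by omega) (choose_two_le_legs k) rfl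
    (cramer_bound_le_tower rfl) fun q h0 hq => dvd_denom h0 hq
  obtain ⟨b, hb, h⟩ := exists_code k c fun u i d j => by
    rw [offset]
    exact_mod_cast hc u i d j
  have hD' : (entry w k (4 * k) : ℝ) ≠ 0 := by exact_mod_cast hD.ne'
  have hE' : (denom k : ℝ) ≠ 0 := by exact_mod_cast (denom_pos k).ne'
  have hcoord : ∀ u, 0 < u → u < legs k → ∀ (i : Fin k) (d : Bool) (x : ℝ),
      (denom k : ℝ) * x = ∑ j ∈ Finset.range (4 * k + 1),
        (c u i d j : ℝ) * ((entry w k j : ℝ) / entry w k (4 * k)) →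
      (coord w k b u i d.toNat : ℝ) / scale w k = x := fun u h0 hu i d x hx => by
    rw [coord, if_pos h0, if_pos hu, scale]
    push_cast
    rw [mul_comm (denom k : ℝ), ← div_div, div_eq_iff hE', mul_comm x, hx, Finset.sum_div]
    refine Finset.sum_congr rfl fun j hj => ?_
    rw [h u hu i d j (Finset.mem_range.1 hj), mul_div_assoc]
  have hnode : ∀ u ≤ legs k, node w k b u = I u := fun u hu => by
    rcases Nat.eq_zero_or_pos u with rfl | h0
    · rw [node_zero hθ, hI0]
    rcases hu.eq_or_lt with rfl | hu
    · rw [node_legs hθ, hI1]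
    funext i
    exact Prod.ext (hcoord u h0 hu i false _ (hIc u i).1) (hcoord u h0 hu i true _ (hIc u i).2)
  refine ⟨_, hL, b, hb.trans_le (radix_pow_le k), ?_, ?_⟩
  · rw [not_conflicts_pos_iff]
    intro u hu
    rw [← shareOrdering_node_iff hD, hnode u hu.le, hnode (u + 1) hu]
    exact hI.ordered u hu
  · refine Finset.sum_le_sum fun u hu => ?_
    have hu := Finset.mem_range.1 hu
    refine legTime_le hD (hI.nonneg u hu) fun i => ?_
    rw [hnode u hu.le, hnode (u + 1) hu]
    exact hI.metric u hu i

/-- The best code takes no longer than the optimal one, and, being free of conflicts, it describes a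
schedule, so it cannot be faster than the minimum. -/
theorem exists_best (hD : 0 < entry w k (4 * k)) {A B : Pos k} (hA : A ∈ confSpace k)
    (hB : B ∈ confSpace k) (hθ : IsParams A B fun j => (entry w k j : ℝ) / entry w k (4 * k)) :
    ∃ b : ℕ, best w k (tower 6 (2 * k + 16)) = b ∧ b < tower 6 (2 * k + 16) ∧
      ¬ 0 < conflicts w k b ∧ IsMinMakespan A B (arrival (legTime w k b) (legs k)) := by
  obtain ⟨L, hL, c, hc, hc', hcL⟩ := exists_optimal_code hD hA hB hθ
  rcases best_spec w k (tower 6 (2 * k + 16)) with ⟨_, h⟩ | ⟨b, e, hb, hb', h⟩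
  · exact absurd (h c hc) hc'
  refine ⟨b, e, hb, hb', ?_⟩
  have h1 : arrival (legTime w k b) (legs k) ≤ L := by
    refine le_trans ?_ hcL
    rw [arrival_legTime, arrival_legTime]
    exact div_le_div_of_nonneg_right (by exact_mod_cast h c hc hc') (scale_pos hD).le
  have hp := isPath_node hD hb'
  obtain ⟨N, hN⟩ : ∃ N, legs k = N + 1 := ⟨legs k - 1, by have := le_legs k; omega⟩
  have h0 := node_zero hθ b
  have h2 := node_legs hθ b
  rw [hN] at hp h1 h2 ⊢
  obtain ⟨M, hM, -⟩ := hp.exists_schedule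
  rw [h0, h2] at hM
  rwa [le_antisymm h1 (hL.2 ⟨0, _, M, hM, (sub_zero _).le⟩)]

end

/-! ### Min-Makespan CMP -/

theorem getD_flatMap {α β : Type*} {f : α → List β} {m : ℕ} (hf : ∀ a, (f a).length = m) (z : β) :
    ∀ (l : List α) (i r : ℕ) (hi : i < l.length), r < m →
      (l.flatMap f).getD (m * i + r) z = (f l[i]).getD r z
  | a :: l, 0, r, _, hr => by
    rw [List.flatMap_cons, mul_zero, zero_add, List.getD_append _ _ _ _ (by rwa [hf])]
    rfl
  | a :: l, i + 1, r, hi, hr => by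
    rw [List.flatMap_cons, List.getD_append_right _ _ _ _ (by rw [hf]; nlinarith), hf,
      show m * (i + 1) + r - m = m * i + r by rw [mul_add_one]; omega]
    exact getD_flatMap hf z l i r (by simpa using hi) hr

namespace Instance

variable (I : Instance)

theorem length_encode : I.encode.length = 8 * I.k + 1 := by
  simp [encode, encodePt, List.length_flatMap, mul_comm]

/-- The input word, continued by zeros. -/
def word (t : ℕ) : ℤ := I.encode.getD t 0

theorem word_zero : I.word 0 = I.k := rfl

theorem word_add_one (i : Fin I.k) {r : ℕ} (hr : r < 8) :
    I.word (8 * i + r + 1) = (encodePt (I.A i) ++ encodePt (I.B i)).getD r 0 := by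
  rw [word, encode, List.getD_cons_succ, getD_flatMap (m := 8) (fun _ => rfl) 0 _ i r (by simp) hr]
  simp

/-- The `d`-th of the four coordinates of robot `i`. -/
def param (i : Fin I.k) : ℕ → ℚ
  | 0 => (I.A i).1
  | 1 => (I.A i).2
  | 2 => (I.B i).1
  | _ => (I.B i).2

theorem word_num (i : Fin I.k) {d : ℕ} (hd : d < 4) :
    I.word (2 * (4 * i + d) + 1) = (I.param i d).num := by
  rw [show 2 * (4 * (i : ℕ) + d) = 8 * i + 2 * d by ring, I.word_add_one i (by omega)]
  interval_cases d <;> rfl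

theorem word_den (i : Fin I.k) {d : ℕ} (hd : d < 4) :
    I.word (2 * (4 * i + d) + 2) = (I.param i d).den := by
  rw [show 2 * (4 * (i : ℕ) + d) + 2 = 8 * i + (2 * d + 1) + 1 by ring,
    I.word_add_one i (by omega)]
  interval_cases d <;> rfl

theorem word_den_pos {q : ℕ} (hq : q < 4 * I.k) : 0 < I.word (2 * q + 2) := by
  have h := I.word_den ⟨q / 4, by omega⟩ (d := q % 4) (by omega)
  rw [Nat.div_add_mod] at h
  rw [h]
  exact_mod_cast (I.param _ _).den_pos

theorem entry_last : entry I.word I.k (4 * I.k) =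
    ∏ q ∈ Finset.range (4 * I.k), I.word (2 * q + 2) :=
  Finset.prod_congr rfl fun _ hq => if_neg (Finset.mem_range.1 hq).ne

theorem entry_last_pos : 0 < entry I.word I.k (4 * I.k) := by
  rw [entry_last]
  exact Finset.prod_pos fun q hq => I.word_den_pos (Finset.mem_range.1 hq)

/-- In the product of all denominators, `entry` replaces one denominator by its numerator; division
by the full product leaves that fraction. -/
theorem entry_div (i : Fin I.k) {d : ℕ} (hd : d < 4) :
    (entry I.word I.k (4 * i + d) : ℝ) / entry I.word I.k (4 * I.k) = (I.param i d : ℝ) := by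
  have hi := i.2
  have hmem : 4 * (i : ℕ) + d ∈ Finset.range (4 * I.k) := Finset.mem_range.2 (by omega)
  have h0 : (entry I.word I.k (4 * I.k) : ℝ) ≠ 0 := by exact_mod_cast I.entry_last_pos.ne'
  have h1 : entry I.word I.k (4 * i + d) * (I.param i d).den =
      entry I.word I.k (4 * I.k) * (I.param i d).num := by
    rw [entry_last, entry, ← Finset.mul_prod_erase _ _ hmem, ← Finset.mul_prod_erase _ _ hmem,
      if_pos rfl, I.word_num i hd, I.word_den i hd, Finset.prod_congr rfl fun q hq =>
        if_neg (Finset.ne_of_mem_erase hq)]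
    ring
  have h2 : ((I.param i d).den : ℝ) ≠ 0 := by exact_mod_cast (I.param i d).den_nz
  rw [div_eq_iff h0, Rat.cast_def, div_mul_eq_mul_div, eq_div_iff h2, mul_comm _ (entry _ _ _ : ℝ)]
  exact_mod_cast h1

theorem isParams : IsParams (fun i => toPt (I.A i)) (fun i => toPt (I.B i))
    fun j => (entry I.word I.k j : ℝ) / entry I.word I.k (4 * I.k) where
  one := div_self (by exact_mod_cast I.entry_last_pos.ne')
  startX i := I.entry_div i (d := 0) (by norm_num)
  startY i := I.entry_div i (d := 1) (by norm_num)
  targetX i := I.entry_div i (d := 2) (by norm_num)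
  targetY i := I.entry_div i (d := 3) (by norm_num)

end Instance

/-! ### Correctness of the output word -/

theorem outputEntry_breakpoint (w : ℕ → ℤ) (k b i : ℕ) {u r : ℕ} (hu : u ≤ legs k) (hr : r < 6) :
    outputEntry w k b (3 + 6 * (i * (legs k + 1) + u) + r) =
      if r = 0 then time w k b u else if r = 2 then coord w k b u i 0
      else if r = 4 then coord w k b u i 1 else scale w k := by
  have e1 : (3 + 6 * (i * (legs k + 1) + u) + r - 3) / 6 = i * (legs k + 1) + u := by omega
  have e2 : (3 + 6 * (i * (legs k + 1) + u) + r - 3) % 6 = r := by omega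
  have e3 : (i * (legs k + 1) + u) / (legs k + 1) = i := by
    rw [mul_comm, Nat.mul_add_div (by omega), Nat.div_eq_of_lt (by omega), add_zero]
  have e4 : (i * (legs k + 1) + u) % (legs k + 1) = u := by
    rw [mul_comm, Nat.mul_add_mod, Nat.mod_eq_of_lt (by omega)]
  rw [outputEntry, if_pos (by omega), if_pos (by omega), if_pos (by omega)]
  simp only [e1, e2, e3, e4, scale]
  clear e1 e2 e3 e4
  interval_cases r <;> rfl

theorem Instance.answer (I : Instance) {b : ℕ} (hb : ¬ 0 < conflicts I.word I.k b)
    (hL : IsMinMakespan (fun i => toPt (I.A i)) (fun i => toPt (I.B i))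
      (arrival (legTime I.word I.k b) (legs I.k))) {w : List ℤ}
    (hlen : w.length = 3 + 6 * (I.k * (legs I.k + 1)))
    (hw : ∀ t < 3 + 6 * (I.k * (legs I.k + 1)), w.getD t 0 = outputEntry I.word I.k b t) :
    I.Answer w := by
  have hD := I.entry_last_pos
  have hS : 0 < scale I.word I.k := by exact_mod_cast scale_pos hD
  have hbp : ∀ (i : Fin I.k), ∀ u ≤ legs I.k, ∀ r < 6,
      w.getD (3 + 6 * (i * (legs I.k + 1) + u) + r) 0 =
        if r = 0 then time I.word I.k b u else if r = 2 then coord I.word I.k b u i 0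
        else if r = 4 then coord I.word I.k b u i 1 else scale I.word I.k := fun i u hu r hr => by
    have h1 := Nat.mul_le_mul_right (legs I.k + 1) (Nat.succ_le_of_lt i.2)
    rw [Nat.succ_mul] at h1
    rw [hw _ (by omega), outputEntry_breakpoint _ _ _ _ hu hr]
  have hw0 : w.getD 0 0 = time I.word I.k b (legs I.k) := hw 0 (by omega)
  have hw1 : w.getD 1 0 = scale I.word I.k := hw 1 (by omega)
  have hw2 : w.getD 2 0 = legs I.k := hw 2 (by omega)
  have hfrac : fracAt w 0 = arrival (legTime I.word I.k b) (legs I.k) := by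
    rw [fracAt, hw0, hw1, arrival_legTime]
  have htime : ∀ (i : Fin I.k), ∀ u ≤ legs I.k,
      fracAt w (3 + 6 * (i * (legs I.k + 1) + u)) = arrival (legTime I.word I.k b) u :=
    fun i u hu => by
      rw [fracAt, hbp i u hu 1 (by norm_num), ← add_zero (3 + 6 * (_ + u)),
        hbp i u hu 0 (by norm_num), arrival_legTime]
      simp
  have hpos : ∀ (i : Fin I.k), ∀ u ≤ legs I.k,
      (fracAt w (3 + 6 * (i * (legs I.k + 1) + u) + 2),
        fracAt w (3 + 6 * (i * (legs I.k + 1) + u) + 4)) = node I.word I.k b u i :=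
    fun i u hu => by
      rw [fracAt, fracAt, hbp i u hu 2 (by norm_num), hbp i u hu (2 + 1) (by norm_num),
        hbp i u hu 4 (by norm_num), hbp i u hu (4 + 1) (by norm_num)]
      simp [node]
  have hp := isPath_node hD hb
  obtain ⟨M, hM1, hM2, hM3⟩ : ∃ M : Fin I.k → ℝ → Pt,
      IsSchedule (node I.word I.k b 0) (node I.word I.k b (legs I.k)) 0
        (arrival (legTime I.word I.k b) (legs I.k)) M ∧
      (∀ i, ∀ u ≤ legs I.k, M i (arrival (legTime I.word I.k b) u) = node I.word I.k b u i) ∧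
      ∀ i, ∀ u < legs I.k, ∀ a ∈ Set.Icc (0 : ℝ) 1,
        M i ((1 - a) * arrival (legTime I.word I.k b) u +
          a * arrival (legTime I.word I.k b) (u + 1)) =
        (1 - a) • node I.word I.k b u i + a • node I.word I.k b (u + 1) i := by
    obtain ⟨N, hN⟩ : ∃ N, legs I.k = N + 1 := ⟨legs I.k - 1, by have := le_legs I.k; omega⟩
    rw [hN] at hp ⊢
    obtain ⟨M, h1, h2, h3, -⟩ := hp.exists_schedule
    exact ⟨M, h1, h2, h3⟩
  rw [node_zero I.isParams, node_legs I.isParams] at hM1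
  refine ⟨legs I.k, hw2, hlen, by rw [hw1]; exact hS, fun i j hj => ?_, ?_, fun i => ?_, M, ?_,
    ?_, ?_⟩
  · rw [hbp i j hj 1 (by norm_num), hbp i j hj 3 (by norm_num), hbp i j hj 5 (by norm_num)]
    exact ⟨hS, hS, hS⟩
  · rw [hfrac]
    exact hL
  · beta_reduce
    refine ⟨?_, ?_, fun j hj => ?_⟩
    · rw [htime i 0 (Nat.zero_le _), arrival_zero]
    · rw [htime i _ le_rfl, hfrac]
    · rw [htime i j hj.le, htime i (j + 1) hj, arrival_succ]
      exact le_add_of_nonneg_right (hp.nonneg j hj)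
  · rw [hfrac]
    exact hM1
  · intro i j hj
    beta_reduce
    rw [htime i j hj, hM2 i j hj, ← hpos i j hj]
  · intro i j hj a ha
    beta_reduce
    rw [htime i j hj.le, htime i (j + 1) hj, hM3 i j hj a ha, ← hpos i j hj.le,
      ← hpos i (j + 1) hj]

/-- The bound `tower 6 (2 * k + 16)` serves twice: as the number of iterations of every loop and as
the range of the codes that are searched. -/
theorem minMakespanCMP_isFPT : minMakespanCMP.IsFPT := by
  refine isFPT_of_fn minMakespanCMP 6 Fn.lengthF Fn.outputF Instance.length_encode
    (fun _ => rfl) fun I => ?_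
  have h : Adequate (Instance.word I) (Instance.k I) (tower 6 (2 * Instance.k I + 16)) :=
    adequate_tower (Instance.word_zero I)
  obtain ⟨b, e, hb, hb', hL⟩ := exists_best (Instance.entry_last_pos I) (Instance.hA I)
    (Instance.hB I) (Instance.isParams I)
  refine ⟨_, h.length_le, h.eval_lengthF, Instance.answer I hb' hL (by simp) fun t ht => ?_⟩
  rw [List.getD_eq_getElem _ _ (by simpa using ht), List.getElem_map, List.getElem_range]
  exact h.eval_outputF e hb.le ht

end CMP

/-! ### The main theorem -/

theorem mainTheorem2 :
    -- the problem is fixed-parameter tractable in the number of robots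
    CMP.minMakespanCMP.IsFPT ∧
    -- some optimal schedule follows a simple path of the transition graph
    (∀ (k : ℕ) (A B : CMP.Pos k), A ∈ CMP.confSpace k → B ∈ CMP.confSpace k →
      ∃ (n : ℕ) (O : Fin (n + 1) → CMP.Ordering k) (t₀ t₁ : ℝ) (M : Fin k → ℝ → CMP.Pt),
        CMP.IsSimplePath O ∧ CMP.IsSchedule A B t₀ t₁ M ∧ CMP.Obeys O t₀ t₁ M ∧
        CMP.IsMinMakespan A B (t₁ - t₀)) ∧
    -- every sequence of `n + 1` orderings is optimized by its linear program
    (∀ (k n : ℕ), 0 < k →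
      Fintype.card (CMP.LPVar k n) = 2 * k * (n + 2) + (n + 1) ∧
      Fintype.card (CMP.LPCon k n) =
        4 * k * (n + 1) + 2 * k.choose 2 * (n + 1) + 8 * k ∧
      ∀ (O : Fin (n + 1) → CMP.Ordering k) (A B : CMP.Pos k),
        A ∈ CMP.confSpace k → B ∈ CMP.confSpace k →
        ((∃ x, (CMP.makespanLP O A B).Feasible x) ↔
          ∃ t₀ t₁ M, CMP.IsSchedule A B t₀ t₁ M ∧ CMP.Obeys O t₀ t₁ M) ∧
        ((∃ x, (CMP.makespanLP O A B).Feasible x) → ∃ x, (CMP.makespanLP O A B).Optimal x) ∧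
        ∀ x, (CMP.makespanLP O A B).Optimal x →
          IsLeast {L : ℝ | ∃ t₀ t₁ M, CMP.IsSchedule A B t₀ t₁ M ∧ CMP.Obeys O t₀ t₁ M ∧
            t₁ - t₀ = L} ((CMP.makespanLP O A B).obj ⬝ᵥ x)) := by
  refine ⟨CMP.minMakespanCMP_isFPT, CMP.exists_simplePath_schedule, fun k n hk =>
    ⟨CMP.card_lpVar k n, CMP.card_lpCon k n, fun O A B _ _ => ⟨⟨?_, ?_⟩, ?_, fun x hx =>
      CMP.isLeast_of_optimal hk hx⟩⟩⟩
  · rintro ⟨x, hx⟩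
    obtain ⟨M, hM, hO⟩ := CMP.exists_schedule_of_feasible hk hx
    exact ⟨0, _, M, hM, hO⟩
  · rintro ⟨t₀, t₁, M, hM, hO⟩
    obtain ⟨x, hx, -⟩ := CMP.exists_feasible_of_obeys hM hO
    exact ⟨x, hx⟩
  · rintro ⟨x, hx⟩
    obtain ⟨y, hy, -⟩ := CMP.makespanLP_exists_optimal hk hx
    exact ⟨y, hy⟩
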